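/- **Setting.** Let $N>2$, $a'=N+1-a$ for $a=1,\dots,N$, and let $q\in\mathbb C\setminus\{0\}$ with a fixed square root $q^{1/2}$ and $q^2\neq 1$. Put $\rho_a=\tfrac N2-a$ for $a<a'$, $\rho_a=0$ for $a=a'$, $\rho_a=-\rho_{a'}$ for $a>a'$, and $C_{ab}=C^{ab}=q^{-\rho_a}\delta_{ab'}$ (so $C^2=\mathbf 1$). Let $R=(R^{ab}_{\;\;cd})$ be the orthogonal $R$-matrix, whose only nonzero entries are - $R^{aa}_{\;\;aa}=q$ and $R^{aa'}_{\;\;aa'}=q^{-1}$ for $a\ne a'$, and $R^{aa}_{\;\;aa}=1$ for $a=a'$; - $R^{ab}_{\;\;ab}=1$ for $a\neq b$, $b\ne a'$, and $R^{ab}_{\;\;ba}=q-q^{-1}$ for $a>b$, $b\neq a'$; - $R^{aa'}_{\;\;a'a}=(q-q^{-1})(1-q^{\rho_a-\rho_{a'}})$ for $a>a'$, and $R^{aa'}_{\;\;bb'}=-(q-q^{-1})q^{\rho_a-\rho_b}$ for $a>b$, $b\neq a'$. Let $\hat R^{ab}_{\;\;cd}=R^{ba}_{\;\;cd}$, $(P_0)^{ab}_{\;\;cd}=(\sum_{e,f}C_{ef}C^{ef})^{-1}C^{ab}C_{cd}$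 and $P_A=\frac1{q+q^{-1}}\big[-\hat R+q\,\mathbf 1-(q-q^{1-N})P_0\big]$; the denominators $q+q^{-1}$ and $\sum_{e,f} C_{ef}C^{ef}$ are assumed to be nonzero. The Hopf algebra $SO_q(N)$ is the complex unital algebra generated by the entries of $T=(T^a{}_b)$ with relations $R_{12}T_1T_2=T_2T_1R_{12}$, $TCT^t=C$, $T^tCT=C$ and $\det_qT=1$; the last one means $\sum_{j}T^{i_1}{}_{j_1}\cdots T^{i_N}{}_{j_N}\,\varepsilon^{j_1\dots j_N}=\varepsilon^{i_1\dots i_N}$ for the quantum epsilon tensor, i.e. for the tensors $\varepsilon$ fixed by $P_A$ acting on any two neighbouring indices. Its structure maps are $\Delta(T^a{}_b)=\sum_cT^a{}_c\otimes T^c{}_b$, $\varepsilon(T^a{}_b)=\delta^a_b$, $\kappa(T)=CT^tC$. The $q$-orthogonal plane is the algebra generated by $x^1,\dots,x^N$ with relations $\sum_{c,d}(P_A)^{ab}_{\;\;cd}x^cx^d=0$, with the coaction $\delta(x^a)=\sum_bT^a{}_b\otimes x^b$, an algebra map. A *conjugation* of a Hopf algebra is an antilinear, antimultiplicative involution $*$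 with $\Delta\circ *=(*\otimes *)\circ\Delta$ and $\varepsilon(x^*)=\overline{\varepsilon(x)}$; a conjugation of an algebra is an antilinear, antimultiplicative involution. A conjugation $*$ of the plane is compatible with a conjugation $*$ of $SO_q(N)$ if $\delta\circ *=(*\otimes *)\circ\delta$. A bar over a matrix is entrywise complex conjugation. **Theorem.** Let $\mathcal D$ be a complex $N\times N$ matrix with $R_{12}\mathcal D_1\mathcal D_2=\mathcal D_2\mathcal D_1R_{12}$, $\mathcal D^tC\mathcal D=C$ and $\mathcal D^2=\mathbf 1$ or $\mathcal D^2=-\mathbf 1$. Then $T\mapsto\mathcal DT\mathcal D^{-1}$ extends to an involutive Hopf algebra automorphism $\sharp$ of $SO_q(N)$ (compatible with product, coproduct, counit and antipode). Moreover: 1. Suppose $|q|=1$, and let $\times$ be the conjugation of $SO_q(N)$ with $T^\times=T$, which exists. Then $\sharp\circ\times$ is a conjugation if and only if $\sharp\circ\times=\times\circ\sharp$, and this holds if and only if either $\overline{\mathcal D}=\mathcal D$ and $\mathcal D^2=\mathbf 1$, or $\overline{\mathcal D}=-\mathcal D$ and $\mathcal D^2=-\mathbf 1$. If $\sharp\circ\times=\times\circ\sharp$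 and $\mathcal D^2=\mathbf 1$, then $x\mapsto\mathcal Dx$ extends to a well-defined conjugation of the $q$-orthogonal plane, compatible with $\sharp\circ\times$ under the coaction. 2. Suppose $q$ is real, and $q^{1/2}$ is real too when $N$ is odd, and let $\star$ be the conjugation of $SO_q(N)$ with $T^\star=C^tTC^t$, which exists. Then $\sharp\circ\star$ is a conjugation if and only if $\sharp\circ\star=\star\circ\sharp$, and this holds if and only if $\overline{\mathcal D}=C^t\mathcal DC^t$. If $\sharp\circ\star=\star\circ\sharp$ and $\mathcal D^2=\mathbf 1$, then $x\mapsto C^t\mathcal Dx$ extends to a well-defined conjugation of the $q$-orthogonal plane, compatible with $\sharp\circ\star$ under the coaction. -/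

import Mathlib

open scoped TensorProduct

noncomputable section

set_option linter.unusedSectionVars false

namespace QOrthogonal

/-! ### The numerical data: metric, R-matrix, projectors

The deformation parameter is `q = s ^ 2`, where `s` is a nonzero complex number (a fixed square
root of `q`). The index set `{1, ..., N}` is `Fin N`, shifted by one, so that the primed index
`a' = N + 1 - a` is `a.rev`. -/

/-- Twice the vector `ρ`: `2 ρ_a = N - 2 a` for `a < a'`, `0` for `a = a'`, and
`ρ_a = - ρ_{a'}` for `a > a'` (with `a = 1, ..., N`; here `a = 0, ..., N - 1`). -/
def twoRho {N : ℕ} (a : Fin N) : ℤ :=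
  if a < a.rev then (N : ℤ) - 2 * (a : ℕ) - 2
  else if a = a.rev then 0
  else (N : ℤ) - 2 * (a : ℕ)

/-- The antidiagonal metric `C_{ab} = q ^ (- ρ_a) δ_{a b'}`. The inverse metric `C^{ab}` is the
same matrix. -/
def metric (N : ℕ) (s : ℂˣ) : Matrix (Fin N) (Fin N) ℂ :=
  fun a b => if b = a.rev then ((s ^ (-twoRho a) : ℂˣ) : ℂ) else 0

/-- The component `R^{ab}_{cd}` of the R-matrix of the orthogonal series. -/
def rEntry {N : ℕ} (s : ℂˣ) (a b c d : Fin N) : ℂ :=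
  let q : ℂ := (s : ℂ) ^ 2
  if a = c ∧ b = d then
    if a = b then (if a = a.rev then 1 else q)
    else if b = a.rev then q⁻¹
    else 1
  else if a = d ∧ b = c ∧ b < a ∧ b ≠ a.rev then q - q⁻¹
  else if b = a.rev ∧ c = b ∧ d = a ∧ b < a then
    (q - q⁻¹) * (1 - ((s ^ (twoRho a - twoRho b) : ℂˣ) : ℂ))
  else if b = a.rev ∧ d = c.rev ∧ c < a ∧ c ≠ b then
    -(q - q⁻¹) * ((s ^ (twoRho a - twoRho c) : ℂˣ) : ℂ)
  else 0

/-- The matrix `R_{12}`, with rows `(a, b)` and columns `(c, d)`. -/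
def rMatrix (N : ℕ) (s : ℂˣ) : Matrix (Fin N × Fin N) (Fin N × Fin N) ℂ :=
  fun i j => rEntry s i.1 i.2 j.1 j.2

/-- The braid form of the R-matrix, with components `R^{ba}_{cd}` in row `(a, b)` and
column `(c, d)`. -/
def rHat (N : ℕ) (s : ℂˣ) : Matrix (Fin N × Fin N) (Fin N × Fin N) ℂ :=
  fun i j => rMatrix N s i.swap j

/-- `C^{ab} C_{cd}`, a multiple of the projector `P_0`. -/
def metricProj (N : ℕ) (s : ℂˣ) : Matrix (Fin N × Fin N) (Fin N × Fin N) ℂ :=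
  fun i j => metric N s i.1 i.2 * metric N s j.1 j.2

/-- The projector `(P_0)^{ab}_{cd} = (C_{ef} C^{ef})⁻¹ C^{ab} C_{cd}`. -/
def projZero (N : ℕ) (s : ℂˣ) : Matrix (Fin N × Fin N) (Fin N × Fin N) ℂ :=
  (∑ e, ∑ f, metric N s e f * metric N s e f)⁻¹ • metricProj N s

/-- The `q`-antisymmetrizer
`P_A = (q + q⁻¹)⁻¹ (- R̂ + q 1 - (q - q ^ (1 - N)) P_0)`. -/
def projA (N : ℕ) (s : ℂˣ) : Matrix (Fin N × Fin N) (Fin N × Fin N) ℂ :=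
  ((s : ℂ) ^ 2 + ((s : ℂ) ^ 2)⁻¹)⁻¹ •
    (-rHat N s + (s : ℂ) ^ 2 • (1 : Matrix (Fin N × Fin N) (Fin N × Fin N) ℂ)
      - ((s : ℂ) ^ 2 - ((s : ℂ) ^ 2) ^ (1 - (N : ℤ))) • projZero N s)

/-- Tensors `ε^{i_1 ... i_N}` that are totally `q`-antisymmetric: fixed by `P_A` acting on any two
neighbouring indices. When the denominators in `P_A` do not vanish and `q ^ 2 ≠ 1`, such a tensor
is determined by its component `ε^{1 2 ... N}`: they are the multiples of the quantum epsilon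
tensor. -/
def IsQAntisymmetric {N : ℕ} (s : ℂˣ) (ε : (Fin N → Fin N) → ℂ) : Prop :=
  ∀ (k : ℕ) (hk : k + 1 < N) (i : Fin N → Fin N),
    ∑ c, ∑ d, projA N s (i ⟨k, by omega⟩, i ⟨k + 1, hk⟩) (c, d) *
      ε (Function.update (Function.update i ⟨k, by omega⟩ c) ⟨k + 1, hk⟩ d) = ε i

/-! ### Matrices with entries in an algebra -/

/-- A complex matrix, viewed as a matrix with entries in the algebra `B`. -/
def scalarMat {m n : Type*} (B : Type*) [Semiring B] [Algebra ℂ B] (M : Matrix m n ℂ) :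
    Matrix m n B :=
  M.map (algebraMap ℂ B)

/-- `M_1 M_2`, with entry `M^a_c M^b_d` in row `(a, b)` and column `(c, d)`. -/
def tensorSq {N : ℕ} {B : Type*} [Mul B] (M : Matrix (Fin N) (Fin N) B) :
    Matrix (Fin N × Fin N) (Fin N × Fin N) B :=
  fun i j => M i.1 j.1 * M i.2 j.2

/-- `M_2 M_1`, with entry `M^b_d M^a_c` in row `(a, b)` and column `(c, d)`. -/
def tensorSqOp {N : ℕ} {B : Type*} [Mul B] (M : Matrix (Fin N) (Fin N) B) :
    Matrix (Fin N × Fin N) (Fin N × Fin N) B :=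
  fun i j => M i.2 j.2 * M i.1 j.1

/-- `M_1 M_2 ... M_k`, with entry `M^{i_1}_{j_1} M^{i_2}_{j_2} ... M^{i_k}_{j_k}` in row `i` and
column `j`. -/
def tensorPow {N k : ℕ} {B : Type*} [Monoid B] (M : Matrix (Fin N) (Fin N) B) :
    Matrix (Fin k → Fin N) (Fin k → Fin N) B :=
  fun i j => (List.ofFn fun k => M (i k) (j k)).prod

/-! ### The algebra of functions on the quantum group -/

/-- The free algebra on generators `T^a_b`. -/
abbrev Free (N : ℕ) : Type := FreeAlgebra ℂ (Fin N × Fin N)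

/-- The matrix of free generators. -/
def freeT (N : ℕ) : Matrix (Fin N) (Fin N) (Free N) :=
  fun a b => FreeAlgebra.ι ℂ (a, b)

/-- The defining relations of `SO_q(N)`: `R_{12} T_1 T_2 = T_2 T_1 R_{12}`, `T C Tᵗ = C`,
`Tᵗ C T = C` and `det_q T = 1`. As the quantum determinant is given by
`T^{i_1}_{j_1} ... T^{i_N}_{j_N} ε^{j_1 ... j_N} = (det_q T) ε^{i_1 ... i_N}`, the last relation
says that `T_1 ... T_N ε = ε` for the quantum epsilon tensor `ε`. -/
inductive Rel (N : ℕ) (s : ℂˣ) : Free N → Free N → Prop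
  | rtt (i j : Fin N × Fin N) :
      Rel N s ((scalarMat (Free N) (rMatrix N s) * tensorSq (freeT N)) i j)
        ((tensorSqOp (freeT N) * scalarMat (Free N) (rMatrix N s)) i j)
  | orth_left (a b : Fin N) :
      Rel N s ((freeT N * scalarMat (Free N) (metric N s) * (freeT N).transpose) a b)
        (scalarMat (Free N) (metric N s) a b)
  | orth_right (a b : Fin N) :
      Rel N s (((freeT N).transpose * scalarMat (Free N) (metric N s) * freeT N) a b)
        (scalarMat (Free N) (metric N s) a b)
  | det (ε : (Fin N → Fin N) → ℂ) (hε : IsQAntisymmetric s ε) (i : Fin N → Fin N) :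
      Rel N s (∑ j, tensorPow (freeT N) i j * algebraMap ℂ (Free N) (ε j)) (algebraMap ℂ (Free N) (ε i))

/-- The algebra `SO_q(N)`. -/
def SOq (N : ℕ) (s : ℂˣ) : Type := RingQuot (Rel N s)

instance (N : ℕ) (s : ℂˣ) : Ring (SOq N s) := inferInstanceAs (Ring (RingQuot (Rel N s)))

instance (N : ℕ) (s : ℂˣ) : Algebra ℂ (SOq N s) :=
  inferInstanceAs (Algebra ℂ (RingQuot (Rel N s)))

/-- The quotient map from the free algebra. -/
def SOq.mk (N : ℕ) (s : ℂˣ) : Free N →ₐ[ℂ] SOq N s :=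
  RingQuot.mkAlgHom ℂ (Rel N s)

/-- The matrix `T` of generators of `SO_q(N)`. -/
def genT (N : ℕ) (s : ℂˣ) : Matrix (Fin N) (Fin N) (SOq N s) :=
  fun a b => SOq.mk N s (freeT N a b)

/-- A matrix with entries in an algebra that satisfies the defining relations of `SO_q(N)`. -/
structure IsQOrthogonal {N : ℕ} (s : ℂˣ) {B : Type*} [Ring B] [Algebra ℂ B]
    (M : Matrix (Fin N) (Fin N) B) : Prop where
  rtt : scalarMat B (rMatrix N s) * tensorSq M = tensorSqOp M * scalarMat B (rMatrix N s)
  orth_left : M * scalarMat B (metric N s) * M.transpose = scalarMat B (metric N s)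
  orth_right : M.transpose * scalarMat B (metric N s) * M = scalarMat B (metric N s)
  det : ∀ ε : (Fin N → Fin N) → ℂ, IsQAntisymmetric s ε → ∀ i,
    ∑ j, tensorPow M i j * algebraMap ℂ B (ε j) = algebraMap ℂ B (ε i)

section Maps

variable {N : ℕ} {s : ℂˣ} {B B' : Type*} [Ring B] [Algebra ℂ B] [Ring B'] [Algebra ℂ B']

theorem map_scalarMat {m n : Type*} (f : B →ₐ[ℂ] B') (M : Matrix m n ℂ) :
    (scalarMat B M).map f = scalarMat B' M := by
  ext i j; simp [scalarMat]

theorem map_tensorSq (f : B →ₐ[ℂ] B') (M : Matrix (Fin N) (Fin N) B) :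
    (tensorSq M).map f = tensorSq (M.map f) := by
  ext i j; simp [tensorSq]

theorem map_tensorSqOp (f : B →ₐ[ℂ] B') (M : Matrix (Fin N) (Fin N) B) :
    (tensorSqOp M).map f = tensorSqOp (M.map f) := by
  ext i j; simp [tensorSqOp]

theorem map_tensorPow (f : B →ₐ[ℂ] B') (M : Matrix (Fin N) (Fin N) B) {k : ℕ}
    (i j : Fin k → Fin N) : f (tensorPow M i j) = tensorPow (M.map f) i j := by
  simp [tensorPow, map_list_prod, List.map_ofFn, Function.comp_def]

theorem map_entry {m n p : Type*} [Fintype n] (f : B →ₐ[ℂ] B') (M : Matrix m n B)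
    (M' : Matrix n p B) (i : m) (j : p) : f ((M * M') i j) = (M.map f * M'.map f) i j := by
  simp [Matrix.mul_apply]

theorem IsQOrthogonal.map {M : Matrix (Fin N) (Fin N) B} (h : IsQOrthogonal s M)
    (f : B →ₐ[ℂ] B') : IsQOrthogonal s (M.map f) where
  rtt := by
    have := congrArg (fun X => X.map f) h.rtt
    simpa only [Matrix.map_mul, map_scalarMat, map_tensorSq, map_tensorSqOp] using this
  orth_left := by
    have := congrArg (fun X => X.map f) h.orth_left
    simpa only [Matrix.map_mul, map_scalarMat, Matrix.transpose_map] using this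
  orth_right := by
    have := congrArg (fun X => X.map f) h.orth_right
    simpa only [Matrix.map_mul, map_scalarMat, Matrix.transpose_map] using this
  det := by
    intro ε hε i
    have := congrArg f (h.det ε hε i)
    simpa [map_sum, map_tensorPow] using this

theorem isQOrthogonal_genT (N : ℕ) (s : ℂˣ) : IsQOrthogonal s (genT N s) := by
  have hrel : ∀ {x y}, Rel N s x y → SOq.mk N s x = SOq.mk N s y :=
    fun h => RingQuot.mkAlgHom_rel ℂ h
  have hT : (freeT N).map (SOq.mk N s) = genT N s := rfl
  refine ⟨?_, ?_, ?_, ?_⟩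
  · ext i j
    have := hrel (Rel.rtt i j)
    simpa only [map_entry, map_scalarMat, map_tensorSq, map_tensorSqOp, hT] using this
  · ext i j
    have := hrel (Rel.orth_left i j)
    rw [← map_scalarMat (SOq.mk N s) (metric N s), Matrix.map_apply, ← this, map_entry,
      Matrix.map_mul, Matrix.transpose_map, hT]
  · ext i j
    have := hrel (Rel.orth_right i j)
    rw [← map_scalarMat (SOq.mk N s) (metric N s), Matrix.map_apply, ← this, map_entry,
      Matrix.map_mul, Matrix.transpose_map, hT]
  · intro ε hε i
    have := hrel (Rel.det ε hε i)
    simpa [map_sum, map_tensorPow, hT] using this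

/-- The universal property: a matrix satisfying the relations defines an algebra map. -/
def SOq.lift (M : Matrix (Fin N) (Fin N) B) (h : IsQOrthogonal s M) : SOq N s →ₐ[ℂ] B :=
  RingQuot.liftAlgHom ℂ ⟨FreeAlgebra.lift ℂ (fun p : Fin N × Fin N => M p.1 p.2), by
    have hT : (freeT N).map (FreeAlgebra.lift ℂ (fun p : Fin N × Fin N => M p.1 p.2)) = M := by
      ext a b; simp [freeT]
    intro x y hxy
    cases hxy with
    | rtt i j =>
      simp only [map_entry, map_scalarMat, map_tensorSq, map_tensorSqOp, hT, h.rtt]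
    | orth_left a b =>
      rw [map_entry, Matrix.map_mul, Matrix.transpose_map, hT, map_scalarMat, h.orth_left]
      simp [scalarMat]
    | orth_right a b =>
      rw [map_entry, Matrix.map_mul, Matrix.transpose_map, hT, map_scalarMat, h.orth_right]
      simp [scalarMat]
    | det ε hε i =>
      simpa [map_sum, map_tensorPow, hT] using h.det ε hε i⟩

@[simp] theorem SOq.lift_genT (M : Matrix (Fin N) (Fin N) B) (h : IsQOrthogonal s M)
    (a b : Fin N) : SOq.lift M h (genT N s a b) = M a b := by
  unfold SOq.lift genT SOq.mk
  erw [RingQuot.liftAlgHom_mkAlgHom_apply]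
  simp [freeT]

theorem SOq.hom_ext {f g : SOq N s →ₐ[ℂ] B} (h : ∀ a b, f (genT N s a b) = g (genT N s a b)) :
    f = g := by
  apply RingQuot.ringQuot_ext'
  apply FreeAlgebra.hom_ext
  funext p
  exact h p.1 p.2

theorem SOq.induction {P : SOq N s → Prop} (hc : ∀ c : ℂ, P (algebraMap ℂ _ c))
    (hT : ∀ a b, P (genT N s a b)) (hadd : ∀ x y, P x → P y → P (x + y))
    (hmul : ∀ x y, P x → P y → P (x * y)) (x : SOq N s) : P x := by
  obtain ⟨y, rfl⟩ := RingQuot.mkAlgHom_surjective ℂ (Rel N s) x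
  change P (SOq.mk N s y)
  induction y using FreeAlgebra.induction with
  | grade0 c => rw [AlgHom.commutes]; exact hc c
  | grade1 p => exact hT p.1 p.2
  | mul a b ha hb => rw [map_mul]; exact hmul _ _ ha hb
  | add a b ha hb => rw [map_add]; exact hadd _ _ ha hb

/-! ### The Hopf algebra structure -/

theorem twoRho_rev (a : Fin N) : twoRho a.rev = -twoRho a := by
  have := a.2
  unfold twoRho
  simp only [Fin.rev_rev, Fin.lt_def, Fin.ext_iff, Fin.val_rev]
  split_ifs <;> omega

theorem metric_mul_metric (N : ℕ) (s : ℂˣ) : metric N s * metric N s = 1 := by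
  ext a b
  rw [Matrix.mul_apply, Finset.sum_eq_single a.rev]
  · simp only [metric, if_true, twoRho_rev, Fin.rev_rev, Matrix.one_apply, eq_comm (a := b)]
    split_ifs
    · rw [← Units.val_mul, ← zpow_add]; simp
    · simp
  · intro c _ hc
    simp [metric, hc]
  · simp

theorem scalarMat_mul {m n p : Type*} [Fintype n] (M : Matrix m n ℂ) (M' : Matrix n p ℂ) :
    scalarMat B (M * M') = scalarMat B M * scalarMat B M' := by
  simp [scalarMat, Matrix.map_mul]

theorem scalarMat_one {m : Type*} [DecidableEq m] : scalarMat B (1 : Matrix m m ℂ) = 1 := by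
  simp [scalarMat]

theorem scalarMat_metric_sq : scalarMat B (metric N s) * scalarMat B (metric N s) = 1 := by
  rw [← scalarMat_mul, metric_mul_metric, scalarMat_one]

theorem scalarMat_metric_sq' :
    (scalarMat B (metric N s)).transpose * (scalarMat B (metric N s)).transpose = 1 := by
  have : (scalarMat B (metric N s)).transpose = scalarMat B (metric N s).transpose := rfl
  rw [this, ← scalarMat_mul, ← Matrix.transpose_mul, metric_mul_metric, Matrix.transpose_one,
    scalarMat_one]

theorem transpose_scalarMat_mul {m n p : Type*} [Fintype n] (M : Matrix m n ℂ)
    (X : Matrix n p B) :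
    (scalarMat B M * X).transpose = X.transpose * (scalarMat B M).transpose := by
  ext i j
  simp only [Matrix.transpose_apply, Matrix.mul_apply, scalarMat, Matrix.map_apply]
  exact Finset.sum_congr rfl fun c _ => Algebra.commutes _ _

theorem transpose_mul_scalarMat {m n p : Type*} [Fintype n] (X : Matrix m n B)
    (M : Matrix n p ℂ) :
    (X * scalarMat B M).transpose = (scalarMat B M).transpose * X.transpose := by
  ext i j
  simp only [Matrix.transpose_apply, Matrix.mul_apply, scalarMat, Matrix.map_apply]
  exact Finset.sum_congr rfl fun c _ => (Algebra.commutes _ _).symm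

theorem tensorPow_succ {k : ℕ} (M : Matrix (Fin N) (Fin N) B) (i j : Fin (k + 1) → Fin N) :
    tensorPow M i j = M (i 0) (j 0) * tensorPow M (Fin.tail i) (Fin.tail j) := by
  simp [tensorPow, List.ofFn_succ, Fin.tail]

theorem sum_fin_succ_pi {k : ℕ} {A : Type*} [AddCommMonoid A] (f : (Fin (k + 1) → Fin N) → A) :
    ∑ j, f j = ∑ a, ∑ j', f (Fin.cons a j') := by
  rw [← Fintype.sum_prod_type']
  exact ((Fin.consEquiv (fun _ => Fin N)).sum_comp f).symm

theorem tensorSq_one : tensorSq (1 : Matrix (Fin N) (Fin N) B) = 1 := by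
  ext ⟨a, b⟩ ⟨c, d⟩
  simp only [tensorSq, Matrix.one_apply, Prod.mk.injEq]
  split_ifs <;> simp_all

theorem tensorSqOp_one : tensorSqOp (1 : Matrix (Fin N) (Fin N) B) = 1 := by
  ext ⟨a, b⟩ ⟨c, d⟩
  simp only [tensorSqOp, Matrix.one_apply, Prod.mk.injEq]
  split_ifs <;> simp_all

theorem tensorPow_one {k : ℕ} :
    tensorPow (k := k) (1 : Matrix (Fin N) (Fin N) B) = 1 := by
  ext i j
  induction k with
  | zero => rw [Subsingleton.elim i j]; simp [tensorPow]
  | succ k ih =>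
    rw [tensorPow_succ, ih, Matrix.one_apply, Matrix.one_apply, Matrix.one_apply]
    have : i = j ↔ i 0 = j 0 ∧ Fin.tail i = Fin.tail j := by
      constructor
      · rintro rfl; exact ⟨rfl, rfl⟩
      · rintro ⟨h0, h1⟩
        rw [← Fin.cons_self_tail i, ← Fin.cons_self_tail j, h0, h1]
    by_cases h0 : i 0 = j 0 <;> by_cases h1 : Fin.tail i = Fin.tail j <;> simp [this, h0, h1]

theorem isQOrthogonal_one : IsQOrthogonal s (1 : Matrix (Fin N) (Fin N) B) where
  rtt := by rw [tensorSq_one, tensorSqOp_one, mul_one, one_mul]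
  orth_left := by simp
  orth_right := by simp
  det := by
    intro ε _ i
    rw [tensorPow_one]
    simp [Matrix.one_apply]

theorem tensorSq_mul {M M' : Matrix (Fin N) (Fin N) B}
    (hc : ∀ a b c d, Commute (M a b) (M' c d)) :
    tensorSq (M * M') = tensorSq M * tensorSq M' := by
  ext ⟨a, b⟩ ⟨c, d⟩
  simp only [tensorSq, Matrix.mul_apply, Fintype.sum_prod_type, Finset.sum_mul_sum]
  refine Finset.sum_congr rfl fun e _ => Finset.sum_congr rfl fun f _ => ?_
  exact (hc _ _ _ _).symm.mul_mul_mul_comm _ _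

theorem tensorSqOp_mul {M M' : Matrix (Fin N) (Fin N) B}
    (hc : ∀ a b c d, Commute (M a b) (M' c d)) :
    tensorSqOp (M * M') = tensorSqOp M * tensorSqOp M' := by
  ext ⟨a, b⟩ ⟨c, d⟩
  simp only [tensorSqOp, Matrix.mul_apply, Fintype.sum_prod_type, Finset.sum_mul_sum]
  rw [Finset.sum_comm]
  refine Finset.sum_congr rfl fun e _ => Finset.sum_congr rfl fun f _ => ?_
  exact (hc _ _ _ _).symm.mul_mul_mul_comm _ _

theorem commute_tensorPow {k : ℕ} {x : B} {M : Matrix (Fin N) (Fin N) B}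
    (hc : ∀ a b, Commute x (M a b)) (i j : Fin k → Fin N) : Commute x (tensorPow M i j) := by
  induction k with
  | zero => simp [tensorPow]
  | succ k ih => rw [tensorPow_succ]; exact (hc _ _).mul_right (ih _ _)

theorem tensorPow_mul {k : ℕ} {M M' : Matrix (Fin N) (Fin N) B}
    (hc : ∀ a b c d, Commute (M a b) (M' c d)) :
    tensorPow (k := k) (M * M') = tensorPow M * tensorPow M' := by
  induction k with
  | zero => ext i j; simp [tensorPow, Matrix.mul_apply]
  | succ k ih =>
    ext i j
    rw [tensorPow_succ, ih, Matrix.mul_apply, Matrix.mul_apply, Matrix.mul_apply, sum_fin_succ_pi,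
      Finset.sum_mul_sum]
    refine Finset.sum_congr rfl fun a _ => Finset.sum_congr rfl fun j' _ => ?_
    rw [tensorPow_succ, tensorPow_succ, Fin.tail_cons, Fin.cons_zero]
    exact (commute_tensorPow (fun c d => (hc c d _ _).symm) _ _).mul_mul_mul_comm _ _

theorem transpose_mul_of_commute {M M' : Matrix (Fin N) (Fin N) B}
    (hc : ∀ a b c d, Commute (M a b) (M' c d)) :
    (M * M').transpose = M'.transpose * M.transpose := by
  ext i j
  simp only [Matrix.transpose_apply, Matrix.mul_apply]
  exact Finset.sum_congr rfl fun c _ => hc _ _ _ _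

theorem IsQOrthogonal.mul {M M' : Matrix (Fin N) (Fin N) B} (h : IsQOrthogonal s M)
    (h' : IsQOrthogonal s M') (hc : ∀ a b c d, Commute (M a b) (M' c d)) :
    IsQOrthogonal s (M * M') where
  rtt := by
    rw [tensorSq_mul hc, tensorSqOp_mul hc, ← mul_assoc, h.rtt, mul_assoc, h'.rtt, mul_assoc]
  orth_left := by
    rw [transpose_mul_of_commute hc]
    calc M * M' * scalarMat B (metric N s) * (M'.transpose * M.transpose)
        = M * (M' * scalarMat B (metric N s) * M'.transpose) * M.transpose := by
          simp only [mul_assoc]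
      _ = _ := by rw [h'.orth_left, h.orth_left]
  orth_right := by
    rw [transpose_mul_of_commute hc]
    calc M'.transpose * M.transpose * scalarMat B (metric N s) * (M * M')
        = M'.transpose * (M.transpose * scalarMat B (metric N s) * M) * M' := by
          simp only [mul_assoc]
      _ = _ := by rw [h.orth_right, h'.orth_right]
  det := by
    intro ε hε i
    rw [tensorPow_mul hc]
    calc ∑ j, (tensorPow (k := N) M * tensorPow (k := N) M') i j * algebraMap ℂ B (ε j)
        = ∑ l, tensorPow M i l * ∑ j, tensorPow M' l j * algebraMap ℂ B (ε j) := by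
          simp only [Matrix.mul_apply, Finset.sum_mul, Finset.mul_sum, mul_assoc]
          rw [Finset.sum_comm]
      _ = _ := by simp only [h'.det ε hε, h.det ε hε]

/-- `C Mᵗ C`, the inverse of a `q`-orthogonal matrix `M`. -/
def qInv (s : ℂˣ) (M : Matrix (Fin N) (Fin N) B) : Matrix (Fin N) (Fin N) B :=
  scalarMat B (metric N s) * M.transpose * scalarMat B (metric N s)

theorem IsQOrthogonal.qInv_mul {M : Matrix (Fin N) (Fin N) B} (h : IsQOrthogonal s M) :
    qInv s M * M = 1 := by
  have := h.orth_right
  rw [qInv, mul_assoc, mul_assoc, ← mul_assoc M.transpose, this, scalarMat_metric_sq]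

theorem IsQOrthogonal.mul_qInv {M : Matrix (Fin N) (Fin N) B} (h : IsQOrthogonal s M) :
    M * qInv s M = 1 := by
  have := h.orth_left
  rw [qInv, ← mul_assoc, ← mul_assoc, this, scalarMat_metric_sq]

theorem tensorSq_mul_tensorSqOp {M K : Matrix (Fin N) (Fin N) B} (h : M * K = 1) :
    tensorSq M * tensorSqOp K = 1 := by
  ext ⟨a, b⟩ ⟨c, d⟩
  have e : ∀ x y, ∑ e, M x e * K e y = (1 : Matrix (Fin N) (Fin N) B) x y := by
    intro x y; rw [← h, Matrix.mul_apply]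
  simp only [tensorSq, tensorSqOp, Matrix.mul_apply, Fintype.sum_prod_type]
  calc ∑ x, ∑ y, M a x * M b y * (K y d * K x c)
      = ∑ x, M a x * (∑ y, M b y * K y d) * K x c := by
        simp only [Finset.sum_mul, Finset.mul_sum, mul_assoc]
    _ = _ := by
        simp only [e, Matrix.one_apply, Prod.mk.injEq]
        by_cases hb : b = d
        · simp [hb, e, Matrix.one_apply]
        · simp [hb]

theorem tensorSqOp_mul_tensorSq {M K : Matrix (Fin N) (Fin N) B} (h : M * K = 1) :
    tensorSqOp M * tensorSq K = 1 := by
  ext ⟨a, b⟩ ⟨c, d⟩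
  have e : ∀ x y, ∑ e, M x e * K e y = (1 : Matrix (Fin N) (Fin N) B) x y := by
    intro x y; rw [← h, Matrix.mul_apply]
  simp only [tensorSq, tensorSqOp, Matrix.mul_apply, Fintype.sum_prod_type]
  rw [Finset.sum_comm]
  calc ∑ y, ∑ x, M b y * M a x * (K x c * K y d)
      = ∑ y, M b y * (∑ x, M a x * K x c) * K y d := by
        simp only [Finset.sum_mul, Finset.mul_sum, mul_assoc]
    _ = _ := by
        simp only [e, Matrix.one_apply, Prod.mk.injEq]
        by_cases hb : a = c
        · simp [hb, e, Matrix.one_apply]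
        · simp [hb]

theorem sum_op_tensorPow_mul {k : ℕ} {M K : Matrix (Fin N) (Fin N) B} (h : K * M = 1)
    (i l : Fin k → Fin N) :
    ∑ j, (tensorPow (K.map MulOpposite.op) i j).unop * tensorPow M j l =
      (1 : Matrix (Fin k → Fin N) (Fin k → Fin N) B) i l := by
  have e : ∀ x y, ∑ e, K x e * M e y = (1 : Matrix (Fin N) (Fin N) B) x y := by
    intro x y; rw [← h, Matrix.mul_apply]
  rw [← tensorPow_one]
  induction k with
  | zero => simp [tensorPow]
  | succ k ih =>
    rw [sum_fin_succ_pi, tensorPow_succ, ← ih, Finset.sum_comm, Finset.mul_sum]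
    refine Finset.sum_congr rfl fun j' _ => ?_
    simp only [tensorPow_succ, Fin.tail_cons, Fin.cons_zero, MulOpposite.unop_mul, Matrix.map_apply,
      MulOpposite.unop_op]
    calc ∑ x, (tensorPow (K.map MulOpposite.op) (Fin.tail i) j').unop * K (i 0) x *
            (M x (l 0) * tensorPow M j' (Fin.tail l))
        = (tensorPow (K.map MulOpposite.op) (Fin.tail i) j').unop * (∑ x, K (i 0) x * M x (l 0)) *
            tensorPow M j' (Fin.tail l) := by
          simp only [Finset.sum_mul, Finset.mul_sum, mul_assoc]
      _ = _ := by
          rw [e, Matrix.one_apply]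
          split_ifs <;> simp

theorem scalarMat_mul_op {m n p : Type*} [Fintype n] (M : Matrix m n ℂ) (X : Matrix n p B) :
    scalarMat Bᵐᵒᵖ M * X.map MulOpposite.op = (scalarMat B M * X).map MulOpposite.op := by
  ext i j
  simp only [Matrix.mul_apply, Matrix.map_apply, scalarMat, MulOpposite.algebraMap_apply,
    ← MulOpposite.op_mul, Finset.op_sum]
  refine Finset.sum_congr rfl fun c _ => ?_
  rw [Algebra.commutes]

theorem op_mul_scalarMat {m n p : Type*} [Fintype n] (X : Matrix m n B) (M : Matrix n p ℂ) :
    X.map MulOpposite.op * scalarMat Bᵐᵒᵖ M = (X * scalarMat B M).map MulOpposite.op := by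
  ext i j
  simp only [Matrix.mul_apply, Matrix.map_apply, scalarMat, MulOpposite.algebraMap_apply,
    ← MulOpposite.op_mul, Finset.op_sum]
  refine Finset.sum_congr rfl fun c _ => ?_
  rw [Algebra.commutes]

theorem op_mul_op {m n p : Type*} [Fintype n] (X : Matrix m n B) (Y : Matrix n p B) :
    X.map MulOpposite.op * Y.map MulOpposite.op =
      ((Y.transpose * X.transpose).transpose).map MulOpposite.op := by
  ext i j
  simp [Matrix.mul_apply]

theorem IsQOrthogonal.op_qInv {M : Matrix (Fin N) (Fin N) B} (h : IsQOrthogonal s M) :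
    IsQOrthogonal s ((qInv s M).map MulOpposite.op) where
  rtt := by
    have e1 : tensorSq ((qInv s M).map MulOpposite.op) =
        (tensorSqOp (qInv s M)).map MulOpposite.op := rfl
    have e2 : tensorSqOp ((qInv s M).map MulOpposite.op) =
        (tensorSq (qInv s M)).map MulOpposite.op := rfl
    rw [e1, e2, scalarMat_mul_op, op_mul_scalarMat]
    congr 1
    have h1 := tensorSq_mul_tensorSqOp h.qInv_mul
    have h2 := tensorSq_mul_tensorSqOp h.mul_qInv
    calc scalarMat B (rMatrix N s) * tensorSqOp (qInv s M)
        = tensorSq (qInv s M) * (tensorSqOp M * scalarMat B (rMatrix N s)) *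
            tensorSqOp (qInv s M) := by
          rw [← mul_assoc (tensorSq (qInv s M)), h1, one_mul]
      _ = _ := by rw [← h.rtt, mul_assoc, mul_assoc, h2, mul_one]
  orth_left := by
    rw [← Matrix.transpose_map, op_mul_scalarMat, op_mul_op, Matrix.transpose_transpose,
      transpose_mul_scalarMat]
    have e : qInv s M * ((scalarMat B (metric N s)).transpose * (qInv s M).transpose) =
        (scalarMat B (metric N s)).transpose := by
      rw [qInv, transpose_mul_scalarMat, transpose_scalarMat_mul, Matrix.transpose_transpose]
      calc _ = scalarMat B (metric N s) * (M.transpose * scalarMat B (metric N s) *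
              (((scalarMat B (metric N s)).transpose * (scalarMat B (metric N s)).transpose) * M)) *
              (scalarMat B (metric N s)).transpose := by simp only [mul_assoc]
        _ = _ := by
          rw [scalarMat_metric_sq', one_mul, h.orth_right, scalarMat_metric_sq, one_mul]
    rw [e]
    rfl
  orth_right := by
    rw [← Matrix.transpose_map, op_mul_scalarMat, op_mul_op, transpose_mul_scalarMat,
      Matrix.transpose_transpose]
    have e : (qInv s M).transpose * ((scalarMat B (metric N s)).transpose * qInv s M) =
        (scalarMat B (metric N s)).transpose := by
      rw [qInv, transpose_mul_scalarMat, transpose_scalarMat_mul, Matrix.transpose_transpose]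
      calc _ = (scalarMat B (metric N s)).transpose * (M * (((scalarMat B (metric N s)).transpose *
              (scalarMat B (metric N s)).transpose) * scalarMat B (metric N s)) * M.transpose) *
              scalarMat B (metric N s) := by simp only [mul_assoc]
        _ = _ := by
          rw [scalarMat_metric_sq', one_mul, h.orth_left, mul_assoc, scalarMat_metric_sq, mul_one]
    rw [e]
    rfl
  det := by
    intro ε hε i
    apply MulOpposite.unop_injective
    rw [Finset.unop_sum]
    simp only [MulOpposite.unop_mul, MulOpposite.algebraMap_apply, MulOpposite.unop_op]
    calc ∑ j, algebraMap ℂ B (ε j) * (tensorPow ((qInv s M).map MulOpposite.op) i j).unop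
        = ∑ j, (tensorPow ((qInv s M).map MulOpposite.op) i j).unop *
            ∑ l, tensorPow M j l * algebraMap ℂ B (ε l) := by
          refine Finset.sum_congr rfl fun j _ => ?_
          rw [h.det ε hε, Algebra.commutes]
      _ = ∑ l, (∑ j, (tensorPow ((qInv s M).map MulOpposite.op) i j).unop * tensorPow M j l) *
            algebraMap ℂ B (ε l) := by
          simp only [Finset.sum_mul, Finset.mul_sum, mul_assoc]
          rw [Finset.sum_comm]
      _ = algebraMap ℂ B (ε i) := by
          simp [sum_op_tensorPow_mul h.qInv_mul, Matrix.one_apply]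

/-- `T ⊗ T`, the matrix with entries `T^a_c ⊗ T^c_b`. -/
def tensorT (N : ℕ) (s : ℂˣ) : Matrix (Fin N) (Fin N) (SOq N s ⊗[ℂ] SOq N s) :=
  fun a b => ∑ c, genT N s a c ⊗ₜ[ℂ] genT N s c b

theorem isQOrthogonal_tensorT (N : ℕ) (s : ℂˣ) : IsQOrthogonal s (tensorT N s) := by
  have e : tensorT N s =
      (genT N s).map (Algebra.TensorProduct.includeLeft : SOq N s →ₐ[ℂ] SOq N s ⊗[ℂ] SOq N s) *
        (genT N s).map
          (Algebra.TensorProduct.includeRight : SOq N s →ₐ[ℂ] SOq N s ⊗[ℂ] SOq N s) := by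
    ext a b
    simp [tensorT, Matrix.mul_apply]
  rw [e]
  refine ((isQOrthogonal_genT N s).map _).mul ((isQOrthogonal_genT N s).map _) ?_
  intro a b c d
  simp [Commute, SemiconjBy]

/-- The coproduct `Δ (T^a_b) = T^a_c ⊗ T^c_b`. -/
def comulHom (N : ℕ) (s : ℂˣ) : SOq N s →ₐ[ℂ] SOq N s ⊗[ℂ] SOq N s :=
  SOq.lift (tensorT N s) (isQOrthogonal_tensorT N s)

/-- The counit `ε (T^a_b) = δ^a_b`. -/
def counitHom (N : ℕ) (s : ℂˣ) : SOq N s →ₐ[ℂ] ℂ :=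
  SOq.lift 1 isQOrthogonal_one

/-- The antipode `κ (T) = C Tᵗ C`, as an algebra map into the opposite algebra. -/
def antipodeHom (N : ℕ) (s : ℂˣ) : SOq N s →ₐ[ℂ] (SOq N s)ᵐᵒᵖ :=
  SOq.lift ((qInv s (genT N s)).map MulOpposite.op) (isQOrthogonal_genT N s).op_qInv

/-- The antipode as a linear map. -/
def antipodeLin (N : ℕ) (s : ℂˣ) : SOq N s →ₗ[ℂ] SOq N s :=
  (MulOpposite.opLinearEquiv ℂ).symm.toLinearMap ∘ₗ (antipodeHom N s).toLinearMap

instance (N : ℕ) (s : ℂˣ) : Bialgebra ℂ (SOq N s) :=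
  Bialgebra.ofAlgHom (comulHom N s) (counitHom N s)
    (by
      apply SOq.hom_ext
      intro a b
      simp only [AlgHom.comp_apply, comulHom, SOq.lift_genT, tensorT, map_sum,
        Algebra.TensorProduct.map_tmul, AlgHom.id_apply, TensorProduct.sum_tmul,
        TensorProduct.tmul_sum]
      rw [Finset.sum_comm]
      rfl)
    (by
      apply SOq.hom_ext
      intro a b
      simp only [AlgHom.comp_apply, comulHom, counitHom, SOq.lift_genT, tensorT, map_sum,
        Algebra.TensorProduct.map_tmul, AlgHom.id_apply, Matrix.one_apply]
      rw [Finset.sum_eq_single a]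
      · simp
      · intro c _ hc; simp [Ne.symm hc]
      · simp)
    (by
      apply SOq.hom_ext
      intro a b
      simp only [AlgHom.comp_apply, comulHom, counitHom, SOq.lift_genT, tensorT, map_sum,
        Algebra.TensorProduct.map_tmul, AlgHom.id_apply, Matrix.one_apply]
      rw [Finset.sum_eq_single b]
      · simp
      · intro c _ hc; simp [hc]
      · simp)

theorem comul_genT (a b : Fin N) :
    Coalgebra.comul (R := ℂ) (genT N s a b) = ∑ c, genT N s a c ⊗ₜ[ℂ] genT N s c b :=
  SOq.lift_genT _ _ a b

theorem counit_genT (a b : Fin N) :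
    Coalgebra.counit (R := ℂ) (genT N s a b) = if a = b then 1 else 0 :=
  SOq.lift_genT _ _ a b

theorem antipodeLin_genT (a b : Fin N) :
    antipodeLin N s (genT N s a b) = qInv s (genT N s) a b := by
  simp [antipodeLin, antipodeHom]

theorem antipodeLin_algebraMap (c : ℂ) :
    antipodeLin N s (algebraMap ℂ _ c) = algebraMap ℂ _ c := by
  simp [antipodeLin, MulOpposite.algebraMap_apply]

theorem antipodeLin_mul (x y : SOq N s) :
    antipodeLin N s (x * y) = antipodeLin N s y * antipodeLin N s x := by
  simp [antipodeLin]

theorem mul_antipode_left (x : SOq N s) :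
    LinearMap.mul' ℂ (SOq N s) ((antipodeLin N s).rTensor (SOq N s) (Coalgebra.comul (R := ℂ) x)) =
      algebraMap ℂ _ (Coalgebra.counit (R := ℂ) x) := by
  induction x using SOq.induction with
  | hc c =>
    rw [Bialgebra.comul_algebraMap, Bialgebra.counit_algebraMap,
      Algebra.TensorProduct.algebraMap_apply]
    simp [antipodeLin_algebraMap]
  | hT a b =>
    have h := congrFun (congrFun (isQOrthogonal_genT N s).qInv_mul a) b
    rw [Matrix.mul_apply, Matrix.one_apply] at h
    rw [comul_genT, counit_genT]
    simp only [map_sum, LinearMap.rTensor_tmul, LinearMap.mul'_apply, antipodeLin_genT, h]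
    split_ifs <;> simp
  | hadd x y hx hy => simp only [map_add, hx, hy]
  | hmul x y hx hy =>
    have key : ∀ u v : SOq N s ⊗[ℂ] SOq N s,
        (∃ c : ℂ, LinearMap.mul' ℂ _ ((antipodeLin N s).rTensor _ u) = algebraMap ℂ _ c) →
        LinearMap.mul' ℂ _ ((antipodeLin N s).rTensor _ (u * v)) =
          LinearMap.mul' ℂ _ ((antipodeLin N s).rTensor _ u) *
          LinearMap.mul' ℂ _ ((antipodeLin N s).rTensor _ v) := by
      rintro u v ⟨c, hc⟩
      induction v using TensorProduct.induction_on with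
      | zero => simp
      | add v w hv hw => simp only [mul_add, map_add, hv, hw]
      | tmul p r =>
        have gen : ∀ u : SOq N s ⊗[ℂ] SOq N s,
            LinearMap.mul' ℂ _ ((antipodeLin N s).rTensor _ (u * p ⊗ₜ[ℂ] r)) =
              antipodeLin N s p * LinearMap.mul' ℂ _ ((antipodeLin N s).rTensor _ u) * r := by
          intro u
          induction u using TensorProduct.induction_on with
          | zero => simp
          | add v w hv hw => simp only [mul_add, add_mul, map_add, hv, hw]
          | tmul a b => simp [antipodeLin_mul, mul_assoc]
        rw [gen, hc, ← Algebra.commutes, mul_assoc]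
        simp
    rw [Bialgebra.comul_mul, key _ _ ⟨_, hx⟩, hx, hy, Bialgebra.counit_mul, map_mul]

theorem mul_antipode_right (x : SOq N s) :
    LinearMap.mul' ℂ (SOq N s) ((antipodeLin N s).lTensor (SOq N s) (Coalgebra.comul (R := ℂ) x)) =
      algebraMap ℂ _ (Coalgebra.counit (R := ℂ) x) := by
  induction x using SOq.induction with
  | hc c =>
    rw [Bialgebra.comul_algebraMap, Bialgebra.counit_algebraMap,
      Algebra.TensorProduct.algebraMap_apply]
    have h1 : antipodeLin N s 1 = 1 := by
      simpa using antipodeLin_algebraMap (N := N) (s := s) 1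
    simp [h1]
  | hT a b =>
    have h := congrFun (congrFun (isQOrthogonal_genT N s).mul_qInv a) b
    rw [Matrix.mul_apply, Matrix.one_apply] at h
    rw [comul_genT, counit_genT]
    simp only [map_sum, LinearMap.lTensor_tmul, LinearMap.mul'_apply, antipodeLin_genT, h]
    split_ifs <;> simp
  | hadd x y hx hy => simp only [map_add, hx, hy]
  | hmul x y hx hy =>
    have key : ∀ u v : SOq N s ⊗[ℂ] SOq N s,
        (∃ c : ℂ, LinearMap.mul' ℂ _ ((antipodeLin N s).lTensor _ v) = algebraMap ℂ _ c) →
        LinearMap.mul' ℂ _ ((antipodeLin N s).lTensor _ (u * v)) =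
          LinearMap.mul' ℂ _ ((antipodeLin N s).lTensor _ u) *
          LinearMap.mul' ℂ _ ((antipodeLin N s).lTensor _ v) := by
      rintro u v ⟨c, hc⟩
      induction u using TensorProduct.induction_on with
      | zero => simp
      | add v w hv hw => simp only [add_mul, map_add, hv, hw]
      | tmul p r =>
        have gen : ∀ v : SOq N s ⊗[ℂ] SOq N s,
            LinearMap.mul' ℂ _ ((antipodeLin N s).lTensor _ (p ⊗ₜ[ℂ] r * v)) =
              p * LinearMap.mul' ℂ _ ((antipodeLin N s).lTensor _ v) * antipodeLin N s r := by
          intro u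
          induction u using TensorProduct.induction_on with
          | zero => simp
          | add v w hv hw => simp only [mul_add, add_mul, map_add, hv, hw]
          | tmul a b => simp [antipodeLin_mul, mul_assoc]
        rw [gen, hc, mul_assoc, Algebra.commutes, ← mul_assoc]
        simp
    rw [Bialgebra.comul_mul, key _ _ ⟨_, hy⟩, hx, hy, Bialgebra.counit_mul, map_mul]

instance (N : ℕ) (s : ℂˣ) : HopfAlgebra ℂ (SOq N s) where
  antipode := antipodeLin N s
  mul_antipode_rTensor_comul := LinearMap.ext mul_antipode_left
  mul_antipode_lTensor_comul := LinearMap.ext mul_antipode_right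

/-! ### The quantum orthogonal plane -/

/-- The relations `(P_A)^{ab}_{cd} x^c x^d = 0`. -/
inductive PlaneRel (N : ℕ) (s : ℂˣ) : FreeAlgebra ℂ (Fin N) → FreeAlgebra ℂ (Fin N) → Prop
  | comm (i : Fin N × Fin N) :
      PlaneRel N s (∑ j : Fin N × Fin N, algebraMap ℂ (FreeAlgebra ℂ (Fin N)) (projA N s i j) *
        (FreeAlgebra.ι ℂ j.1 * FreeAlgebra.ι ℂ j.2)) 0

/-- The algebra of the quantum orthogonal plane. -/
def QPlane (N : ℕ) (s : ℂˣ) : Type := RingQuot (PlaneRel N s)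

instance (N : ℕ) (s : ℂˣ) : Ring (QPlane N s) := inferInstanceAs (Ring (RingQuot (PlaneRel N s)))

instance (N : ℕ) (s : ℂˣ) : Algebra ℂ (QPlane N s) :=
  inferInstanceAs (Algebra ℂ (RingQuot (PlaneRel N s)))

/-- The coordinate `x^a` of the quantum plane. -/
def coord (N : ℕ) (s : ℂˣ) (a : Fin N) : QPlane N s :=
  RingQuot.mkAlgHom ℂ (PlaneRel N s) (FreeAlgebra.ι ℂ a)

theorem sum_projA_coord (i : Fin N × Fin N) :
    ∑ j : Fin N × Fin N, algebraMap ℂ (QPlane N s) (projA N s i j) *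
      (coord N s j.1 * coord N s j.2) = 0 := by
  have := RingQuot.mkAlgHom_rel ℂ (PlaneRel.comm (s := s) i)
  simp only [map_sum, map_mul, map_zero, AlgHom.commutes] at this
  exact this

/-- The universal property of the quantum plane. -/
def QPlane.lift (v : Fin N → B) (h : ∀ i : Fin N × Fin N,
    ∑ j : Fin N × Fin N, algebraMap ℂ B (projA N s i j) * (v j.1 * v j.2) = 0) :
    QPlane N s →ₐ[ℂ] B :=
  RingQuot.liftAlgHom ℂ ⟨FreeAlgebra.lift ℂ v, by
    intro x y hxy
    cases hxy with
    | comm i => simpa using h i⟩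

theorem QPlane.lift_coord (v : Fin N → B) (h : ∀ i : Fin N × Fin N,
    ∑ j : Fin N × Fin N, algebraMap ℂ B (projA N s i j) * (v j.1 * v j.2) = 0) (a : Fin N) :
    QPlane.lift v h (coord N s a) = v a := by
  unfold QPlane.lift coord
  erw [RingQuot.liftAlgHom_mkAlgHom_apply]
  simp

theorem IsQOrthogonal.rHat_comm {M : Matrix (Fin N) (Fin N) B} (h : IsQOrthogonal s M) :
    scalarMat B (rHat N s) * tensorSq M = tensorSq M * scalarMat B (rHat N s) := by
  ext i j
  have := congrFun (congrFun h.rtt i.swap) j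
  simp only [Matrix.mul_apply] at this ⊢
  refine Eq.trans this ?_
  rw [← (Equiv.prodComm (Fin N) (Fin N)).sum_comp]
  rfl

theorem IsQOrthogonal.metricProj_comm {M : Matrix (Fin N) (Fin N) B} (h : IsQOrthogonal s M) :
    scalarMat B (metricProj N s) * tensorSq M = tensorSq M * scalarMat B (metricProj N s) := by
  have h1 : ∀ b d, ∑ c, ∑ a, M a b * algebraMap ℂ B (metric N s a c) * M c d =
      algebraMap ℂ B (metric N s b d) := by
    intro b d
    have := congrFun (congrFun h.orth_right b) d
    simpa [Matrix.mul_apply, Finset.sum_mul, scalarMat] using this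
  have h2 : ∀ a d, ∑ c, ∑ b, M a b * algebraMap ℂ B (metric N s b c) * M d c =
      algebraMap ℂ B (metric N s a d) := by
    intro a d
    have := congrFun (congrFun h.orth_left a) d
    simpa [Matrix.mul_apply, Finset.sum_mul, scalarMat] using this
  ext ⟨a, b⟩ ⟨c, d⟩
  simp only [Matrix.mul_apply, Fintype.sum_prod_type, scalarMat, Matrix.map_apply, metricProj,
    tensorSq, map_mul]
  trans algebraMap ℂ B (metric N s a b) * algebraMap ℂ B (metric N s c d)
  · rw [← h1 c d, Finset.mul_sum, Finset.sum_comm]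
    refine Finset.sum_congr rfl fun f _ => ?_
    rw [Finset.mul_sum]
    refine Finset.sum_congr rfl fun e _ => ?_
    rw [mul_assoc, ← mul_assoc (algebraMap ℂ B (metric N s e f)), Algebra.commutes _ (M e c)]
  · rw [← h2 a b, Finset.sum_mul, Finset.sum_comm]
    refine Finset.sum_congr rfl fun f _ => ?_
    rw [Finset.sum_mul]
    refine Finset.sum_congr rfl fun e _ => ?_
    rw [← mul_assoc, mul_assoc (M a e), Algebra.commutes _ (M b f), ← mul_assoc]

theorem scalarMat_add {m n : Type*} (M M' : Matrix m n ℂ) :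
    scalarMat B (M + M') = scalarMat B M + scalarMat B M' := by
  ext i j; simp [scalarMat]

theorem scalarMat_sub {m n : Type*} (M M' : Matrix m n ℂ) :
    scalarMat B (M - M') = scalarMat B M - scalarMat B M' := by
  ext i j; simp [scalarMat]

theorem scalarMat_neg {m n : Type*} (M : Matrix m n ℂ) : scalarMat B (-M) = -scalarMat B M := by
  ext i j; simp [scalarMat]

theorem scalarMat_smul {m n : Type*} (c : ℂ) (M : Matrix m n ℂ) :
    scalarMat B (c • M) = c • scalarMat B M := by
  ext i j; simp [scalarMat, Algebra.smul_def]

theorem IsQOrthogonal.projA_comm {M : Matrix (Fin N) (Fin N) B} (h : IsQOrthogonal s M) :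
    scalarMat B (projA N s) * tensorSq M = tensorSq M * scalarMat B (projA N s) := by
  simp only [projA, projZero, scalarMat_smul, scalarMat_sub, scalarMat_add, scalarMat_neg,
    scalarMat_one, smul_mul_assoc, mul_smul_comm, sub_mul, mul_sub, add_mul, mul_add, neg_mul,
    mul_neg, h.rHat_comm, h.metricProj_comm, one_mul, mul_one]

/-- The coaction `δ (x^a) = T^a_b ⊗ x^b` of `SO_q(N)` on the quantum plane. -/
def coaction (N : ℕ) (s : ℂˣ) : QPlane N s →ₐ[ℂ] SOq N s ⊗[ℂ] QPlane N s :=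
  QPlane.lift (fun a => ∑ b, genT N s a b ⊗ₜ[ℂ] coord N s b) (by
    intro i
    have hc := (isQOrthogonal_genT N s).projA_comm
    calc _ = ∑ l : Fin N × Fin N,
          (scalarMat (SOq N s) (projA N s) * tensorSq (genT N s)) i l ⊗ₜ[ℂ]
            (coord N s l.1 * coord N s l.2) := by
          simp only [Matrix.mul_apply, TensorProduct.sum_tmul, Finset.sum_mul_sum,
            Algebra.TensorProduct.tmul_mul_tmul]
          rw [Finset.sum_comm]
          refine Finset.sum_congr rfl fun j _ => ?_
          rw [Fintype.sum_prod_type, Finset.mul_sum]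
          refine Finset.sum_congr rfl fun e _ => ?_
          rw [Finset.mul_sum]
          refine Finset.sum_congr rfl fun f _ => ?_
          simp [Algebra.TensorProduct.algebraMap_apply, scalarMat, tensorSq]
      _ = ∑ j : Fin N × Fin N, tensorSq (genT N s) i j ⊗ₜ[ℂ]
            ∑ l : Fin N × Fin N, algebraMap ℂ (QPlane N s) (projA N s j l) *
              (coord N s l.1 * coord N s l.2) := by
          rw [hc]
          simp only [Matrix.mul_apply, TensorProduct.sum_tmul, TensorProduct.tmul_sum]
          rw [Finset.sum_comm]
          refine Finset.sum_congr rfl fun j _ => Finset.sum_congr rfl fun l _ => ?_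
          rw [scalarMat, Matrix.map_apply, ← Algebra.commutes, ← Algebra.smul_def,
            ← Algebra.smul_def, TensorProduct.smul_tmul]
      _ = 0 := by simp [sum_projA_coord])

theorem coaction_coord (a : Fin N) :
    coaction N s (coord N s a) = ∑ b, genT N s a b ⊗ₜ[ℂ] coord N s b :=
  QPlane.lift_coord _ _ a

end Maps

/-! ### Conjugations -/

/-- A conjugation of a Hopf algebra `A`: an antilinear, antimultiplicative involution that is
compatible with the coproduct, `Δ ∘ * = (* ⊗ *) ∘ Δ`, and with the counit. -/
structure IsHopfConjugation {A : Type*} [Ring A] [HopfAlgebra ℂ A]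
    (f : A →ₛₗ[starRingEnd ℂ] A) : Prop where
  map_mul : ∀ x y, f (x * y) = f y * f x
  comul : ∀ x, Coalgebra.comul (R := ℂ) (f x) = TensorProduct.map f f (Coalgebra.comul (R := ℂ) x)
  counit : ∀ x, Coalgebra.counit (R := ℂ) (f x) = starRingEnd ℂ (Coalgebra.counit (R := ℂ) x)
  involutive : Function.Involutive f

/-- A conjugation of an algebra: an antilinear, antimultiplicative involution. -/
structure IsAlgConjugation {A : Type*} [Ring A] [Algebra ℂ A]
    (g : A →ₛₗ[starRingEnd ℂ] A) : Prop where
  map_mul : ∀ x y, g (x * y) = g y * g x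
  involutive : Function.Involutive g

/-- The maps `f` of `SO_q(N)` and `g` of the quantum plane are compatible with the coaction:
`δ ∘ g = (f ⊗ g) ∘ δ`. -/
def CoactionCompatible {N : ℕ} {s : ℂˣ} (f : SOq N s →ₛₗ[starRingEnd ℂ] SOq N s)
    (g : QPlane N s →ₛₗ[starRingEnd ℂ] QPlane N s) : Prop :=
  ∀ x, coaction N s (g x) = TensorProduct.map f g (coaction N s x)

end QOrthogonal

end

noncomputable section

namespace QOrthogonal

/-! Write w for the flip weights, K for the rank one matrix C^{ab} C_{cd}, and R̂ for the braid
matrix.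

Existence. All three maps come from one principle, `IsTwistedOrthogonal.sandwich`: if a matrix M
satisfies the relations formed with some antisymmetrizer P and metric G, and V intertwines P with
P_A and carries G to C, then V M V⁻¹ satisfies the relations of SO_q(N). For ♯ take M = T and V = D.
For a conjugation, pass to the opposite algebra with conjugated scalars, where T satisfies the
relations formed with the flipped conjugate of P_A and with the conjugate transpose of C
(`IsQOrthogonal.conjOp`). If |q| = 1 these are P_A and C themselves and V = 1 gives ×. If q is real,
V = Cᵗ is an intertwiner and gives ⋆. The same intertwiners give the conjugations of the plane.

Commutation. That ♯∘* is a conjugation exactly when ♯ and * commute is formal, both being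
involutions (`isHopfConjugation_comp_iff`). If * sends T to W T W⁻¹, then comparison on generators
shows that they commute if and only if X = D⁻¹ W⁻¹ D̄ W commutes with T. The core is that such an X
is scalar (`eq_smul_one_of_commute`), once its first and last diagonal entries are known to agree.
This needs enough representations of SO_q(N). The characters given by the diagonal torus make X
diagonal. Two-dimensional triangular representations built from quantum root vectors
(`isQOrthogonal_rootRep`) make neighbouring diagonal entries of X equal. The determinant relation in
these representations is accessible because a q-antisymmetric tensor is determined by its component
1 2 … N (`IsQAntisymmetric.eq_zero`), so only one row of the relation has to be checked
(`det_of_projA_comm`).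

The scalar. The RTT relation forces the first row of D to vanish off the diagonal
(`apply_first_eq_zero`). Hence the first diagonal entry squares to the sign x with D² = x,
orthogonality makes the last one its inverse, and the complex conjugates of both are determined.
This identifies the scalar as x for × and as 1 for ⋆, which are the stated conditions on D. -/

variable {N : ℕ} {s : ℂˣ}

/-! ### Entries of the braid matrix and its action on the metric -/

/-- The weight with which the braid form of the R-matrix flips `e_a ⊗ e_b`. -/
def flipWeight (s : ℂˣ) (a b : Fin N) : ℂ :=
  if a = b then (if a = a.rev then 1 else (s : ℂ) ^ 2)
  else if b = a.rev then ((s : ℂ) ^ 2)⁻¹ else 1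

theorem metric_rev (a : Fin N) : metric N s a a.rev = ((s ^ (-twoRho a) : ℂˣ) : ℂ) := by
  simp [metric]

theorem metric_of_ne {a b : Fin N} (h : b ≠ a.rev) : metric N s a b = 0 := by
  simp [metric, h]

theorem metric_mul_swap (a : Fin N) : metric N s a a.rev * metric N s a.rev a = 1 := by
  have := metric_rev (s := s) a.rev
  rw [Fin.rev_rev] at this
  rw [metric_rev, this, ← Units.val_mul, ← zpow_add, twoRho_rev]
  simp

theorem rev_eq_comm' {a b : Fin N} : a = b.rev ↔ b = a.rev := by
  constructor <;> rintro rfl <;> simp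

/-- Collects the cases of the R-matrix into three pieces: a weighted flip, the identity truncated to
a < b, and K truncated to c < b. The later identities for R̂ are proved by comparing these pieces.
-/
theorem rHat_apply (a b c d : Fin N) :
    rHat N s (a, b) (c, d) = (if a = d ∧ b = c then flipWeight s a b else 0) +
      ((s : ℂ) ^ 2 - ((s : ℂ) ^ 2)⁻¹) * ((if a = c ∧ b = d ∧ a < b then 1 else 0) -
        (if c < b then metric N s a b * metric N s c d else 0)) := by
  simp only [rHat, rMatrix, Prod.swap_prod_mk, rEntry]
  by_cases hK : b = a.rev ∧ d = c.rev
  · obtain ⟨rfl, rfl⟩ := hK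
    rw [metric_rev, metric_rev, twoRho_rev, ← Units.val_mul, ← zpow_add]
    have e : -twoRho a + -twoRho c = -twoRho a - twoRho c := by ring
    rw [e]
    by_cases h1 : c = a.rev
    · subst h1
      rw [twoRho_rev]
      simp only [flipWeight, Fin.rev_rev, lt_irrefl]
      by_cases h2 : a = a.rev
      · simp [← h2]
      · have h3 : a.rev ≠ a := fun h => h2 h.symm
        simp [h2, h3]
    · by_cases h2 : c = a
      · subst h2
        simp only [flipWeight, Fin.rev_rev]
        have h3 : c.rev ≠ c := fun h => h1 h.symm
        rw [if_neg (by simp [h3]), if_neg (by simp)]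
        by_cases h4 : c < c.rev
        · simp [h3, h1, h4]
        · simp [h3, h1, h4]
      · have h3 : c.rev ≠ a.rev := fun h => h2 (Fin.rev_injective h)
        have h4 : a.rev ≠ c := fun h => h1 h.symm
        have h5 : a ≠ c := fun h => h2 h.symm
        simp only [Fin.rev_rev]
        by_cases h6 : c < a.rev
        · simp [h2, h3, h4, h5, h6]
          ring
        · simp [h2, h3, h4, h5, h6]
  · have hm : metric N s a b * metric N s c d = 0 := by
      by_cases h : b = a.rev
      · rw [metric_of_ne (a := c) fun h' => hK ⟨h, h'⟩, mul_zero]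
      · rw [metric_of_ne h, zero_mul]
    rw [hm]
    by_cases h1 : a = d ∧ b = c
    · obtain ⟨rfl, rfl⟩ := h1
      have h2 : ¬ b = a.rev := fun h => hK ⟨h, rev_eq_comm'.1 h⟩
      have h3 : ¬ a = b.rev := fun h => h2 (rev_eq_comm'.1 h)
      by_cases h4 : a = b
      · subst h4
        simp [flipWeight, h2]
      · have h5 : ¬ b = a := fun h => h4 h.symm
        simp [flipWeight, h2, h3, h4, h5]
    · have h1' : ¬ (b = c ∧ a = d) := fun h => h1 h.symm
      rw [if_neg h1', if_neg h1]
      by_cases h2 : b = d ∧ a = c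
      · obtain ⟨rfl, rfl⟩ := h2
        have h3 : ¬ b = a.rev := fun h => hK ⟨h, h⟩
        have h4 : ¬ a = b.rev := fun h => h3 (rev_eq_comm'.1 h)
        by_cases h5 : a < b <;> simp [h4, h5]
      · have h3 : ¬ (a = b.rev ∧ c = a ∧ d = b ∧ a < b) := fun h => h2 ⟨h.2.2.1.symm, h.2.1.symm⟩
        have h4 : ¬ (a = b.rev ∧ d = c.rev ∧ c < b ∧ c ≠ a) :=
          fun h => hK ⟨rev_eq_comm'.1 h.1, h.2.1⟩
        rw [if_neg (fun h => h2 ⟨h.1, h.2.1⟩), if_neg h3, if_neg h4,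
          if_neg (fun h => h2 ⟨h.2.1, h.1⟩)]
        simp

theorem rev_metric (a : Fin N) : metric N s a.rev a = ((s ^ twoRho a : ℂˣ) : ℂ) := by
  have := metric_rev (s := s) a.rev
  rwa [Fin.rev_rev, twoRho_rev, neg_neg] at this

/-- Each summand is (q - q⁻¹) q^{2ρ_x} = q^{2ρ_x+1} - q^{2ρ_x-1}, and the sum telescopes in each
half of the index range because ρ drops by one there. The extra q - q⁻¹ in the second case comes
from the middle, where ρ = 0 occurs twice (N even) or between 1/2 and -1/2 (N odd). -/
theorem sum_metric_sq_ge (N : ℕ) (s : ℂˣ) (k : ℕ) (hk : k ≤ N) :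
    ∑ x : Fin N, (if k ≤ (x : ℕ) then
      ((s : ℂ) ^ 2 - ((s : ℂ) ^ 2)⁻¹) * metric N s x.rev x ^ 2 else 0) =
    if N ≤ 2 * k then (s : ℂ) ^ (2 * ((N : ℤ) - 2 * k + 1)) - (s : ℂ) ^ (2 * (1 - (N : ℤ)))
    else (s : ℂ) ^ (2 * ((N : ℤ) - 2 * k - 1)) + ((s : ℂ) ^ 2 - ((s : ℂ) ^ 2)⁻¹) -
      (s : ℂ) ^ (2 * (1 - (N : ℤ))) := by
  have hs : (s : ℂ) ≠ 0 := s.ne_zero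
  induction hk using Nat.decreasingInduction with
  | self =>
    rw [Finset.sum_eq_zero]
    · rw [if_pos (by omega), eq_comm, sub_eq_zero]
      congr 1
      ring
    · intro x _
      rw [if_neg (by omega)]
  | of_succ k hk ih =>
    have hsplit : ∀ x : Fin N, (if k ≤ (x : ℕ) then
        ((s : ℂ) ^ 2 - ((s : ℂ) ^ 2)⁻¹) * metric N s x.rev x ^ 2 else 0) =
        (if k + 1 ≤ (x : ℕ) then
          ((s : ℂ) ^ 2 - ((s : ℂ) ^ 2)⁻¹) * metric N s x.rev x ^ 2 else 0) +
        (if x = ⟨k, hk⟩ then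
          ((s : ℂ) ^ 2 - ((s : ℂ) ^ 2)⁻¹) * metric N s x.rev x ^ 2 else 0) := by
      intro x
      simp only [Fin.ext_iff]
      rcases lt_trichotomy (x : ℕ) k with h | h | h
      · rw [if_neg (by omega), if_neg (by omega), if_neg (by omega), add_zero]
      · rw [if_pos (by omega), if_neg (by omega), if_pos (by omega), zero_add]
      · rw [if_pos (by omega), if_pos (by omega), if_neg (by omega), add_zero]
    simp only [hsplit]
    rw [Finset.sum_add_distrib, ih, Finset.sum_ite_eq' Finset.univ, if_pos (Finset.mem_univ _),
      rev_metric, Units.val_zpow_eq_zpow_val, ← zpow_natCast (_ ^ _) 2, ← zpow_mul]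
    have e1 : (s : ℂ) ^ 2 = (s : ℂ) ^ (2 : ℤ) := by norm_cast
    rw [e1, ← zpow_neg, sub_mul, ← zpow_add₀ hs, ← zpow_add₀ hs]
    unfold twoRho
    simp only [Fin.lt_def, Fin.ext_iff, Fin.val_rev]
    push_cast
    split_ifs with h1 h2 h3 h4 h5 h6 <;> first | omega | skip
    · rw [show N = 2 * k + 2 by omega]
      push_cast
      ring_nf
    · rw [show N = 2 * k + 1 by omega]
      push_cast
      ring_nf
    · ring_nf
    · ring_nf

theorem sum_metric_metric (N : ℕ) (s : ℂˣ) :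
    ∑ e, ∑ f, metric N s e f * metric N s e f = ∑ x : Fin N, metric N s x.rev x ^ 2 := by
  rw [← Equiv.sum_comp Fin.revPerm]
  refine Finset.sum_congr rfl fun x _ => ?_
  rw [Finset.sum_eq_single x]
  · simp [sq]
  · intro b _ hb
    rw [metric_of_ne (by simpa using hb), zero_mul]
  · simp

theorem mul_sum_metric_metric (hN : 0 < N) :
    ((s : ℂ) ^ 2 - ((s : ℂ) ^ 2)⁻¹) * ∑ e, ∑ f, metric N s e f * metric N s e f =
      ((s : ℂ) ^ 2) ^ ((N : ℤ) - 1) + ((s : ℂ) ^ 2 - ((s : ℂ) ^ 2)⁻¹) -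
        ((s : ℂ) ^ 2) ^ (1 - (N : ℤ)) := by
  rw [sum_metric_metric, Finset.mul_sum]
  have h := sum_metric_sq_ge N s 0 (Nat.zero_le _)
  simp only [Nat.zero_le, if_true] at h
  rw [h, if_neg (by omega), ← zpow_natCast (s : ℂ) 2, ← zpow_mul, ← zpow_mul]
  simp

/-- The metric is a left eigenvector of R̂. Contracting C with the truncated K in `rHat_apply`
leaves the tail of the sum C_{ef} C^{ef} beyond the index c, which `sum_metric_sq_ge` evaluates; the
other two pieces cancel everything but the eigenvalue term. -/
theorem metric_sum_mul_rHat (c d : Fin N) :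
    ∑ a, ∑ b, metric N s a b * rHat N s (a, b) (c, d) =
      ((s : ℂ) ^ 2) ^ (1 - (N : ℤ)) * metric N s c d := by
  have hs : (s : ℂ) ≠ 0 := s.ne_zero
  have h1 : ∑ a, ∑ b, metric N s a b * rHat N s (a, b) (c, d) =
      metric N s d c * flipWeight s d c +
      (((s : ℂ) ^ 2 - ((s : ℂ) ^ 2)⁻¹) * if c < d then metric N s c d else 0) -
      metric N s c d * ∑ x : Fin N, (if (c : ℕ) + 1 ≤ (x : ℕ) then
        ((s : ℂ) ^ 2 - ((s : ℂ) ^ 2)⁻¹) * metric N s x.rev x ^ 2 else 0) := by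
    have e1 : ∑ a, ∑ b, metric N s a b * (if a = d ∧ b = c then flipWeight s a b else 0) =
        metric N s d c * flipWeight s d c := by
      rw [Finset.sum_eq_single d, Finset.sum_eq_single c]
      · simp
      · intro b _ hb; simp [hb]
      · simp
      · intro b _ hb; simp [hb]
      · simp
    have e2 : ∑ a, ∑ b, metric N s a b * (if a = c ∧ b = d ∧ a < b then (1 : ℂ) else 0) =
        if c < d then metric N s c d else 0 := by
      rw [Finset.sum_eq_single c, Finset.sum_eq_single d]
      · simp
      · intro b _ hb; simp [hb]
      · simp
      · intro b _ hb; simp [hb]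
      · simp
    have e3 : ∑ a, ∑ b, metric N s a b *
        (((s : ℂ) ^ 2 - ((s : ℂ) ^ 2)⁻¹) *
          (if c < b then metric N s a b * metric N s c d else 0)) =
        metric N s c d * ∑ x : Fin N, (if (c : ℕ) + 1 ≤ (x : ℕ) then
          ((s : ℂ) ^ 2 - ((s : ℂ) ^ 2)⁻¹) * metric N s x.rev x ^ 2 else 0) := by
      rw [← Equiv.sum_comp Fin.revPerm, Finset.mul_sum]
      refine Finset.sum_congr rfl fun x _ => ?_
      rw [Finset.sum_eq_single x]
      · simp only [Fin.revPerm_apply, Fin.lt_def, Nat.succ_le_iff]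
        split_ifs <;> ring
      · intro b _ hb
        rw [metric_of_ne (by simpa using hb), zero_mul]
      · simp
    rw [← e1, ← e2, ← e3, Finset.mul_sum, ← Finset.sum_add_distrib, ← Finset.sum_sub_distrib]
    refine Finset.sum_congr rfl fun a _ => ?_
    rw [Finset.mul_sum, ← Finset.sum_add_distrib, ← Finset.sum_sub_distrib]
    refine Finset.sum_congr rfl fun b _ => ?_
    rw [rHat_apply]
    ring
  rw [h1, sum_metric_sq_ge N s _ c.2]
  by_cases hd : d = c.rev
  · subst hd
    have e1 : (s : ℂ) ^ 2 = (s : ℂ) ^ (2 : ℤ) := by norm_cast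
    rw [rev_metric, metric_rev, Units.val_zpow_eq_zpow_val, Units.val_zpow_eq_zpow_val]
    unfold flipWeight twoRho
    have hc := c.2
    simp only [Fin.lt_def, Fin.ext_iff, Fin.val_rev]
    rw [e1, ← zpow_neg, ← zpow_mul]
    split_ifs <;> first | omega | skip
    all_goals
      simp only [mul_sub, sub_mul, mul_add, ← zpow_add₀ hs, mul_one, mul_zero]
    all_goals push_cast
    all_goals ring_nf
    · rw [show (N : ℤ) = 2 * (c : ℕ) + 2 by omega]
      ring_nf
    · rw [show (N : ℤ) = 2 * (c : ℕ) + 1 by omega]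
      ring_nf
  · have hd' : c ≠ d.rev := fun h => hd (rev_eq_comm'.1 h)
    rw [metric_of_ne hd, metric_of_ne hd']
    simp

/-- The metric, as a vector in `ℂ^N ⊗ ℂ^N`. -/
def metricVec (N : ℕ) (s : ℂˣ) : Fin N × Fin N → ℂ := fun i => metric N s i.1 i.2

theorem metricProj_eq : metricProj N s = Matrix.vecMulVec (metricVec N s) (metricVec N s) := rfl

theorem metricVec_dotProduct_self :
    metricVec N s ⬝ᵥ metricVec N s = ∑ e, ∑ f, metric N s e f * metric N s e f := by
  simp [dotProduct, metricVec, Fintype.sum_prod_type]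

theorem metricVec_vecMul_rHat :
    Matrix.vecMul (metricVec N s) (rHat N s) =
      ((s : ℂ) ^ 2) ^ (1 - (N : ℤ)) • metricVec N s := by
  ext ⟨c, d⟩
  have := metric_sum_mul_rHat (s := s) c d
  simpa [Matrix.vecMul, dotProduct, metricVec, Fintype.sum_prod_type] using this

/-- On C the three terms of P_A act by -q^{1-N}, q and -(q - q^{1-N}), which add up to zero. -/
theorem metricVec_vecMul_projA
    (hZ : ∑ e, ∑ f, metric N s e f * metric N s e f ≠ 0) :
    Matrix.vecMul (metricVec N s) (projA N s) = 0 := by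
  rw [projA, projZero, metricProj_eq, Matrix.vecMul_smul, Matrix.vecMul_sub, Matrix.vecMul_add,
    Matrix.vecMul_neg, Matrix.vecMul_smul, Matrix.vecMul_smul, Matrix.vecMul_smul,
    Matrix.vecMul_vecMulVec, metricVec_vecMul_rHat, metricVec_dotProduct_self, Matrix.vecMul_one,
    inv_smul_smul₀ hZ]
  rw [← neg_smul, ← add_smul, ← sub_smul]
  convert smul_zero _
  rw [smul_eq_zero]
  left
  ring

/-! ### Uniqueness of the quantum epsilon tensor -/

section Fixed

variable (hq' : (s : ℂ) ^ 2 + ((s : ℂ) ^ 2)⁻¹ ≠ 0)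
  (hZ : ∑ e, ∑ f, metric N s e f * metric N s e f ≠ 0)

include hq' hZ

/-- Since C annihilates the image of P_A, the P_0 term of P_A t drops out and P_A t = t becomes an
eigenvalue equation for R̂ alone. -/
theorem rHat_mulVec_of_fixed {t : Fin N × Fin N → ℂ} (ht : (projA N s).mulVec t = t) :
    (rHat N s).mulVec t = -((s : ℂ) ^ 2)⁻¹ • t := by
  have h0 : metricVec N s ⬝ᵥ t = 0 := by
    rw [← ht, Matrix.dotProduct_mulVec, metricVec_vecMul_projA hZ, zero_dotProduct]
  have h1 := ht
  rw [projA, projZero, metricProj_eq, Matrix.smul_mulVec, Matrix.sub_mulVec,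
    Matrix.add_mulVec, Matrix.neg_mulVec, Matrix.smul_mulVec, Matrix.smul_mulVec,
    Matrix.smul_mulVec, Matrix.vecMulVec_mulVec, h0, inv_smul_eq_iff₀ hq'] at h1
  simp only [Matrix.one_mulVec, MulOpposite.op_zero, zero_smul, smul_zero, sub_zero] at h1
  ext i
  have h2 := congrFun h1 i
  simp only [Pi.add_apply, Pi.neg_apply, Pi.smul_apply, smul_eq_mul] at h2 ⊢
  linear_combination -h2

/-- Read the component (c, d) of R̂ t = -q⁻¹ t. For d ≤ c the truncated identity is absent and the
truncated K only involves pairs with first index below d, so only the flipped component (d, c)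
remains. For d < c that component is lexicographically earlier; for d = c the factor w + q⁻¹, with w
= 1 or w = q, is nonzero. -/
theorem fixed_apply_eq_zero (hq : ((s : ℂ) ^ 2) ^ 2 ≠ 1) {t : Fin N × Fin N → ℂ}
    (ht : (projA N s).mulVec t = t) {c d : Fin N} (hdc : d ≤ c)
    (h : ∀ a b, a < c ∨ (a = c ∧ b < d) → t (a, b) = 0) : t (c, d) = 0 := by
  have hs : (s : ℂ) ≠ 0 := s.ne_zero
  have h1 := congrFun (rHat_mulVec_of_fixed hq' hZ ht) (c, d)
  have h2 : (rHat N s).mulVec t (c, d) = flipWeight s c d * t (d, c) := by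
    simp only [Matrix.mulVec, dotProduct, Fintype.sum_prod_type]
    rw [Finset.sum_eq_single d, Finset.sum_eq_single c]
    · rw [rHat_apply]
      rcases hdc.lt_or_eq with h3 | h3
      · simp [h3.ne', h d c (Or.inl h3)]
      · subst h3; simp
    · intro f _ hf
      rw [rHat_apply]
      rcases hdc.lt_or_eq with h3 | h3
      · simp [h d f (Or.inl h3)]
      · subst h3; simp [hf.symm]
    · simp
    · intro e _ he
      refine Finset.sum_eq_zero fun f _ => ?_
      rw [rHat_apply]
      by_cases h4 : e < d
      · rw [h e f (Or.inl (h4.trans_le hdc)), mul_zero]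
      · simp [h4, he.symm, hdc.not_gt]
    · simp
  rw [h2] at h1
  simp only [Pi.smul_apply, smul_eq_mul] at h1
  have hqi : ((s : ℂ) ^ 2)⁻¹ ≠ 0 := inv_ne_zero (pow_ne_zero _ hs)
  rcases hdc.lt_or_eq with h3 | h3
  · rw [h d c (Or.inl h3)] at h1
    simpa [hs] using h1
  · subst h3
    rw [flipWeight, if_pos rfl] at h1
    split_ifs at h1
    · have h5 : (1 + ((s : ℂ) ^ 2)⁻¹) * t (d, d) = 0 := by linear_combination h1
      refine (mul_eq_zero.1 h5).resolve_left fun h6 => hq ?_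
      field_simp at h6
      linear_combination ((s : ℂ) ^ 2 - 1) * h6
    · have h5 : ((s : ℂ) ^ 2 + ((s : ℂ) ^ 2)⁻¹) * t (d, d) = 0 := by linear_combination h1
      exact (mul_eq_zero.1 h5).resolve_left hq'

end Fixed

theorem eq_id_of_forall_lt {i : Fin N → Fin N}
    (h : ∀ (k : ℕ) (hk : k + 1 < N), i ⟨k, by omega⟩ < i ⟨k + 1, hk⟩) : i = id := by
  cases N with
  | zero => exact Subsingleton.elim _ _
  | succ n =>
    have hi : StrictMono i := Fin.strictMono_iff_lt_succ.2 fun j => h j (by omega)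
    have h1 := Subsingleton.elim
      (hi.orderIsoOfSurjective i (Finite.injective_iff_surjective.1 hi.injective))
      (OrderIso.refl _)
    exact congrArg (fun e : Fin (n + 1) ≃o Fin (n + 1) => (e : Fin (n + 1) → Fin (n + 1))) h1

/-- Induction on multi-indices in lexicographic order: at a weak descent, `fixed_apply_eq_zero`
deduces vanishing from earlier components, and the only multi-index without a weak descent is the
identity. So a q-antisymmetric tensor is determined by its component 1 2 … N. -/
theorem IsQAntisymmetric.eq_zero (hq : ((s : ℂ) ^ 2) ^ 2 ≠ 1)
    (hq' : (s : ℂ) ^ 2 + ((s : ℂ) ^ 2)⁻¹ ≠ 0)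
    (hZ : ∑ e, ∑ f, metric N s e f * metric N s e f ≠ 0)
    {ε : (Fin N → Fin N) → ℂ} (hε : IsQAntisymmetric s ε) (h0 : ε id = 0) (i : Fin N → Fin N) :
    ε i = 0 := by
  have hlex : ∀ (x y : Fin N → Fin N) (m : Fin N), (∀ j < m, x j = y j) → x m < y m →
      toLex x < toLex y := fun x y m h1 h2 => ⟨m, h1, h2⟩
  induction i using (InvImage.wf (toLex : (Fin N → Fin N) → Lex (Fin N → Fin N))
    wellFounded_lt).induction with
  | h i ih =>
    by_cases hi : ∀ (k : ℕ) (hk : k + 1 < N), i ⟨k, by omega⟩ < i ⟨k + 1, hk⟩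
    · rw [eq_id_of_forall_lt hi, h0]
    · push Not at hi
      obtain ⟨k, hk, hle⟩ := hi
      have hne : (⟨k, by omega⟩ : Fin N) ≠ ⟨k + 1, hk⟩ := by simp
      -- The slice of ε in positions k and k + 1, with all other indices frozen, is a vector fixed
      -- by P_A.
      have key := fixed_apply_eq_zero hq' hZ hq (c := i ⟨k, by omega⟩) (d := i ⟨k + 1, hk⟩)
        (t := fun p => ε (Function.update (Function.update i ⟨k, by omega⟩ p.1)
          ⟨k + 1, hk⟩ p.2)) ?_ hle ?_
      · simpa using key
      · ext ⟨a, b⟩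
        have := hε k hk (Function.update (Function.update i ⟨k, by omega⟩ a) ⟨k + 1, hk⟩ b)
        rw [← this]
        simp only [Matrix.mulVec, dotProduct, Fintype.sum_prod_type]
        refine Finset.sum_congr rfl fun c _ => Finset.sum_congr rfl fun d _ => ?_
        rw [Function.update_self, Function.update_of_ne hne, Function.update_self]
        congr 2
        rw [Function.update_comm hne.symm, Function.update_idem, Function.update_idem]
      · rintro a b hab
        rcases hab with hab | ⟨rfl, hab⟩
        · refine ih _ (hlex _ _ ⟨k, by omega⟩ (fun j hj => ?_) ?_)
          · have h1 : j ≠ ⟨k, by omega⟩ := hj.ne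
            have h2 : j ≠ ⟨k + 1, hk⟩ := (hj.trans (by simp [Fin.lt_def])).ne
            simp [h1, h2]
          · simpa [hne] using hab
        · refine ih _ (hlex _ _ ⟨k + 1, hk⟩ (fun j hj => ?_) ?_)
          · simp [hj.ne]
          · simpa using hab

/-! ### Matrices acting on neighbouring tensor indices -/

section Pow

variable {B : Type*} [Ring B] [Algebra ℂ B]

/-- The multi-index `i` with the entries in positions `k` and `k + 1` replaced. -/
def updatePair {n : ℕ} (i : Fin n → Fin N) (k : ℕ) (hk : k + 1 < n) (p : Fin N × Fin N) :
    Fin n → Fin N :=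
  Function.update (Function.update i ⟨k, by omega⟩ p.1) ⟨k + 1, hk⟩ p.2

/-- The pair of entries of `i` in positions `k` and `k + 1`. -/
def pairAt {n : ℕ} (i : Fin n → Fin N) (k : ℕ) (hk : k + 1 < n) : Fin N × Fin N :=
  (i ⟨k, by omega⟩, i ⟨k + 1, hk⟩)

theorem updatePair_pairAt {n : ℕ} (i : Fin n → Fin N) (k : ℕ) (hk : k + 1 < n) :
    updatePair i k hk (pairAt i k hk) = i := by
  simp [updatePair, pairAt]

theorem pairAt_updatePair {n : ℕ} (i : Fin n → Fin N) (k : ℕ) (hk : k + 1 < n)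
    (p : Fin N × Fin N) : pairAt (updatePair i k hk p) k hk = p := by
  simp [updatePair, pairAt]

theorem updatePair_updatePair {n : ℕ} (i : Fin n → Fin N) (k : ℕ) (hk : k + 1 < n)
    (p p' : Fin N × Fin N) : updatePair (updatePair i k hk p) k hk p' = updatePair i k hk p' := by
  have hne : (⟨k, by omega⟩ : Fin n) ≠ ⟨k + 1, hk⟩ := by simp
  rw [updatePair, updatePair, Function.update_comm hne.symm, Function.update_idem,
    Function.update_idem, updatePair]

/-- Tensors fixed by the matrix `P` acting on any two neighbouring indices. -/
def NeighbourFixed {n : ℕ} (P : Matrix (Fin N × Fin N) (Fin N × Fin N) ℂ)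
    (ε : (Fin n → Fin N) → ℂ) : Prop :=
  ∀ (k : ℕ) (hk : k + 1 < n) (i : Fin n → Fin N),
    ∑ p, P (pairAt i k hk) p * ε (updatePair i k hk p) = ε i

theorem isQAntisymmetric_iff {ε : (Fin N → Fin N) → ℂ} :
    IsQAntisymmetric s ε ↔ NeighbourFixed (projA N s) ε := by
  simp only [IsQAntisymmetric, NeighbourFixed, Fintype.sum_prod_type]
  rfl

/-- The factors x and y are the parts of the word before and after positions k, k + 1. As they do
not depend on the replaced pairs, an identity for `tensorSq M` can be applied inside `tensorPow M`.
-/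
theorem exists_tensorPow_updatePair (M : Matrix (Fin N) (Fin N) B) :
    ∀ {n : ℕ} (k : ℕ) (hk : k + 1 < n) (i j : Fin n → Fin N), ∃ x y : B, ∀ p p',
      tensorPow M (updatePair i k hk p) (updatePair j k hk p') = x * tensorSq M p p' * y := by
  intro n
  induction n with
  | zero => intro k hk; omega
  | succ n ih =>
    intro k hk i j
    cases k with
    | zero =>
      obtain ⟨m, rfl⟩ : ∃ m, n = m + 1 := ⟨n - 1, by omega⟩
      refine ⟨1, tensorPow M (Fin.tail (Fin.tail i)) (Fin.tail (Fin.tail j)), fun p p' => ?_⟩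
      have h0 : ∀ (i : Fin (m + 1 + 1) → Fin N) (p : Fin N × Fin N),
          updatePair i 0 hk p 0 = p.1 := by
        intro i p
        exact congrArg Prod.fst (pairAt_updatePair i 0 hk p)
      have h1 : ∀ (i : Fin (m + 1 + 1) → Fin N) (p : Fin N × Fin N),
          Fin.tail (updatePair i 0 hk p) 0 = p.2 := by
        intro i p
        exact congrArg Prod.snd (pairAt_updatePair i 0 hk p)
      have h2 : ∀ (i : Fin (m + 1 + 1) → Fin N) (p : Fin N × Fin N),
          Fin.tail (Fin.tail (updatePair i 0 hk p)) = Fin.tail (Fin.tail i) := by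
        intro i p
        ext l
        simp [Fin.tail, updatePair, Fin.ext_iff]
      rw [tensorPow_succ, tensorPow_succ, h0, h0, h1, h1, h2, h2, tensorSq, one_mul, mul_assoc]
    | succ k =>
      obtain ⟨x, y, hxy⟩ := ih k (by omega) (Fin.tail i) (Fin.tail j)
      have h0 : ∀ (i : Fin (n + 1) → Fin N) (p : Fin N × Fin N),
          updatePair i (k + 1) hk p 0 = i 0 := by
        intro i p
        simp [updatePair, Fin.ext_iff]
      have h1 : ∀ (i : Fin (n + 1) → Fin N) (p : Fin N × Fin N),
          Fin.tail (updatePair i (k + 1) hk p) =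
            updatePair (Fin.tail i) k (by omega) p := by
        intro i p
        ext l
        simp [Fin.tail, updatePair, Fin.ext_iff, Function.update_apply]
      refine ⟨M (i 0) (j 0) * x, y, fun p p' => ?_⟩
      rw [tensorPow_succ, h0, h0, h1, h1, hxy]
      simp only [mul_assoc]

variable {P₁ P₂ : Matrix (Fin N × Fin N) (Fin N × Fin N) ℂ} {M : Matrix (Fin N) (Fin N) B}

theorem sum_smul_tensorPow (h : scalarMat B P₂ * tensorSq M = tensorSq M * scalarMat B P₁)
    {n : ℕ} (k : ℕ) (hk : k + 1 < n) (i j : Fin n → Fin N) :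
    ∑ p, P₂ (pairAt i k hk) p • tensorPow M (updatePair i k hk p) j =
      ∑ p, P₁ p (pairAt j k hk) • tensorPow M i (updatePair j k hk p) := by
  obtain ⟨x, y, hxy⟩ := exists_tensorPow_updatePair M k hk i j
  have h1 : ∀ p, tensorPow M (updatePair i k hk p) j = x * tensorSq M p (pairAt j k hk) * y := by
    intro p
    rw [← hxy, updatePair_pairAt]
  have h2 : ∀ p, tensorPow M i (updatePair j k hk p) = x * tensorSq M (pairAt i k hk) p * y := by
    intro p
    rw [← hxy, updatePair_pairAt]
  have h3 := congrFun (congrFun h (pairAt i k hk)) (pairAt j k hk)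
  simp only [Matrix.mul_apply, scalarMat, Matrix.map_apply, ← Algebra.commutes (P₁ _ _),
    ← Algebra.smul_def] at h3
  have h4 := congrArg (fun z => x * z * y) h3
  simpa only [h1, h2, Finset.mul_sum, Finset.sum_mul, mul_smul_comm, smul_mul_assoc] using h4

/-- If M ⊗ M intertwines P₁ with P₂, then M₁ … M_n carries tensors fixed by P₁ to tensors fixed by
P₂: move P₂ through the product at positions k, k + 1 and let it act on ε as P₁. -/
theorem sum_smul_sum_tensorPow
    (h : scalarMat B P₂ * tensorSq M = tensorSq M * scalarMat B P₁) {n : ℕ}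
    {ε : (Fin n → Fin N) → ℂ} (hε : NeighbourFixed P₁ ε) (k : ℕ) (hk : k + 1 < n)
    (i : Fin n → Fin N) :
    ∑ p, P₂ (pairAt i k hk) p • ∑ j, ε j • tensorPow M (updatePair i k hk p) j =
      ∑ j, ε j • tensorPow M i j := by
  calc _ = ∑ j, ε j • ∑ p, P₂ (pairAt i k hk) p • tensorPow M (updatePair i k hk p) j := by
        simp only [Finset.smul_sum]
        rw [Finset.sum_comm]
        refine Finset.sum_congr rfl fun j _ => Finset.sum_congr rfl fun p _ => ?_
        rw [smul_comm]
    _ = ∑ x : (Fin n → Fin N) × (Fin N × Fin N),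
        (P₁ x.2 (pairAt x.1 k hk) * ε x.1) • tensorPow M i (updatePair x.1 k hk x.2) := by
        rw [Fintype.sum_prod_type]
        refine Finset.sum_congr rfl fun j _ => ?_
        rw [sum_smul_tensorPow h, Finset.smul_sum]
        refine Finset.sum_congr rfl fun p _ => ?_
        rw [smul_smul, mul_comm]
    _ = ∑ x : (Fin n → Fin N) × (Fin N × Fin N),
        (P₁ (pairAt x.1 k hk) x.2 * ε (updatePair x.1 k hk x.2)) • tensorPow M i x.1 := by
        -- Exchanging the pair stored separately with the pair inside the multi-index moves P₁ from
        -- the summation variable of the product onto ε.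
        have hinv : Function.Involutive fun x : (Fin n → Fin N) × (Fin N × Fin N) =>
            (updatePair x.1 k hk x.2, pairAt x.1 k hk) := by
          rintro ⟨j, p⟩
          simp only [updatePair_updatePair, updatePair_pairAt, pairAt_updatePair]
        rw [← Equiv.sum_comp hinv.toPerm]
        refine Finset.sum_congr rfl fun x _ => ?_
        simp only [Function.Involutive.coe_toPerm, updatePair_updatePair, updatePair_pairAt,
          pairAt_updatePair]
    _ = _ := by
        rw [Fintype.sum_prod_type]
        refine Finset.sum_congr rfl fun j _ => ?_
        dsimp only
        rw [← Finset.sum_smul, hε]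

theorem NeighbourFixed.tensorPow {M : Matrix (Fin N) (Fin N) ℂ}
    (h : P₂ * tensorSq M = tensorSq M * P₁) {n : ℕ} {ε : (Fin n → Fin N) → ℂ}
    (hε : NeighbourFixed P₁ ε) : NeighbourFixed P₂ (Matrix.mulVec (tensorPow M) ε) := by
  intro k hk i
  have h' := sum_smul_sum_tensorPow (B := ℂ) (P₁ := P₁) (P₂ := P₂) (M := M)
    (by simpa [scalarMat] using h) hε k hk i
  simpa [Matrix.mulVec, dotProduct, mul_comm] using h'

end Pow

/-! ### The defining relations expressed through P_A -/

section Criterion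

variable {B : Type*} [Ring B] [Algebra ℂ B] {M : Matrix (Fin N) (Fin N) B}

theorem rHat_eq_projA (hq' : (s : ℂ) ^ 2 + ((s : ℂ) ^ 2)⁻¹ ≠ 0) :
    rHat N s = (s : ℂ) ^ 2 • (1 : Matrix (Fin N × Fin N) (Fin N × Fin N) ℂ) -
      ((s : ℂ) ^ 2 - ((s : ℂ) ^ 2) ^ (1 - (N : ℤ))) •
        (∑ e, ∑ f, metric N s e f * metric N s e f)⁻¹ • metricProj N s -
      ((s : ℂ) ^ 2 + ((s : ℂ) ^ 2)⁻¹) • projA N s := by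
  rw [projA, smul_inv_smul₀ hq', projZero]
  abel

/-- Both sides equal K: contracting C with M ⊗ M from the left uses Mᵗ C M = C, from the right M C
Mᵗ = C. Hence in the presence of orthogonality the RTT relation is the same as commutation with P_A.
-/
theorem metricProj_comm_of_orth
    (hl : M * scalarMat B (metric N s) * M.transpose = scalarMat B (metric N s))
    (hr : M.transpose * scalarMat B (metric N s) * M = scalarMat B (metric N s)) :
    scalarMat B (metricProj N s) * tensorSq M = tensorSq M * scalarMat B (metricProj N s) := by
  have h1 : ∀ b d, ∑ c, ∑ a, M a b * algebraMap ℂ B (metric N s a c) * M c d =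
      algebraMap ℂ B (metric N s b d) := by
    intro b d
    have := congrFun (congrFun hr b) d
    simpa [Matrix.mul_apply, Finset.sum_mul, scalarMat] using this
  have h2 : ∀ a d, ∑ c, ∑ b, M a b * algebraMap ℂ B (metric N s b c) * M d c =
      algebraMap ℂ B (metric N s a d) := by
    intro a d
    have := congrFun (congrFun hl a) d
    simpa [Matrix.mul_apply, Finset.sum_mul, scalarMat] using this
  ext ⟨a, b⟩ ⟨c, d⟩
  simp only [Matrix.mul_apply, Fintype.sum_prod_type, scalarMat, Matrix.map_apply, metricProj,
    tensorSq, map_mul]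
  trans algebraMap ℂ B (metric N s a b) * algebraMap ℂ B (metric N s c d)
  · rw [← h1 c d, Finset.mul_sum, Finset.sum_comm]
    refine Finset.sum_congr rfl fun f _ => ?_
    rw [Finset.mul_sum]
    refine Finset.sum_congr rfl fun e _ => ?_
    rw [mul_assoc, ← mul_assoc (algebraMap ℂ B (metric N s e f)), Algebra.commutes _ (M e c)]
  · rw [← h2 a b, Finset.sum_mul, Finset.sum_comm]
    refine Finset.sum_congr rfl fun f _ => ?_
    rw [Finset.sum_mul]
    refine Finset.sum_congr rfl fun e _ => ?_
    rw [← mul_assoc, mul_assoc (M a e), Algebra.commutes _ (M b f), ← mul_assoc]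

theorem rtt_iff_rHat_comm :
    scalarMat B (rMatrix N s) * tensorSq M = tensorSqOp M * scalarMat B (rMatrix N s) ↔
      scalarMat B (rHat N s) * tensorSq M = tensorSq M * scalarMat B (rHat N s) := by
  have h1 : ∀ i j, (scalarMat B (rHat N s) * tensorSq M) i j =
      (scalarMat B (rMatrix N s) * tensorSq M) i.swap j := fun _ _ => rfl
  have h2 : ∀ i j, (tensorSq M * scalarMat B (rHat N s)) i j =
      (tensorSqOp M * scalarMat B (rMatrix N s)) i.swap j := by
    intro i j
    simp only [Matrix.mul_apply]
    rw [← (Equiv.prodComm (Fin N) (Fin N)).sum_comp]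
    rfl
  constructor
  · intro h
    ext i j
    rw [h1, h2, h]
  · intro h
    ext i j
    have := congrFun (congrFun h i.swap) j
    rwa [h1, h2, Prod.swap_swap] at this

theorem rHat_comm_of_projA_comm (hq' : (s : ℂ) ^ 2 + ((s : ℂ) ^ 2)⁻¹ ≠ 0)
    (hP : scalarMat B (projA N s) * tensorSq M = tensorSq M * scalarMat B (projA N s))
    (hK : scalarMat B (metricProj N s) * tensorSq M =
      tensorSq M * scalarMat B (metricProj N s)) :
    scalarMat B (rHat N s) * tensorSq M = tensorSq M * scalarMat B (rHat N s) := by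
  rw [rHat_eq_projA hq']
  simp only [scalarMat_smul, scalarMat_sub, scalarMat_one, sub_mul, mul_sub, smul_mul_assoc,
    mul_smul_comm, one_mul, mul_one, hP, hK]

theorem projA_comm_of_rHat_comm
    (hR : scalarMat B (rHat N s) * tensorSq M = tensorSq M * scalarMat B (rHat N s))
    (hK : scalarMat B (metricProj N s) * tensorSq M =
      tensorSq M * scalarMat B (metricProj N s)) :
    scalarMat B (projA N s) * tensorSq M = tensorSq M * scalarMat B (projA N s) := by
  simp only [projA, projZero, scalarMat_smul, scalarMat_sub, scalarMat_add, scalarMat_neg,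
    scalarMat_one, smul_mul_assoc, mul_smul_comm, sub_mul, mul_sub, add_mul, mul_add, neg_mul,
    mul_neg, hR, hK, one_mul, mul_one]

/-- The difference M₁ … M_N ε - ε is again fixed by P_A at neighbouring positions, so it vanishes as
soon as its component 1 2 … N does. Thus one row of the determinant relation suffices. -/
theorem det_of_projA_comm (hq : ((s : ℂ) ^ 2) ^ 2 ≠ 1)
    (hq' : (s : ℂ) ^ 2 + ((s : ℂ) ^ 2)⁻¹ ≠ 0)
    (hZ : ∑ e, ∑ f, metric N s e f * metric N s e f ≠ 0)
    (hP : scalarMat B (projA N s) * tensorSq M = tensorSq M * scalarMat B (projA N s))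
    {ε : (Fin N → Fin N) → ℂ} (hε : IsQAntisymmetric s ε)
    (h0 : ∑ j, tensorPow M id j * algebraMap ℂ B (ε j) = algebraMap ℂ B (ε id))
    (i : Fin N → Fin N) :
    ∑ j, tensorPow M i j * algebraMap ℂ B (ε j) = algebraMap ℂ B (ε i) := by
  have e : ∀ i, ∑ j, tensorPow M i j * algebraMap ℂ B (ε j) = ∑ j, ε j • tensorPow M i j := by
    intro i
    refine Finset.sum_congr rfl fun j _ => ?_
    rw [← Algebra.commutes, ← Algebra.smul_def]
  rw [e] at h0 ⊢
  -- Linear functionals separate the points of B, so the uniqueness result for complex tensors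
  -- applies to tensors with entries in B.
  rw [← sub_eq_zero, ← Module.forall_dual_apply_eq_zero_iff ℂ]
  intro φ
  refine IsQAntisymmetric.eq_zero hq hq' hZ
    (ε := fun i => φ (∑ j, ε j • tensorPow M i j - algebraMap ℂ B (ε i))) ?_ ?_ i
  · rw [isQAntisymmetric_iff] at hε ⊢
    intro k hk i
    have h1 := sum_smul_sum_tensorPow hP hε k hk i
    have h2 := hε k hk i
    simp only [← smul_eq_mul, ← map_smul, ← map_sum, smul_sub, Finset.sum_sub_distrib, h1]
    congr 2
    rw [← h2, map_sum]
    simp [Algebra.smul_def]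
  · simp [h0]

end Criterion

/-! ### Characters of the torus -/

theorem flipWeight_comm (a b : Fin N) : flipWeight s a b = flipWeight s b a := by
  unfold flipWeight
  by_cases h : a = b
  · subst h; rfl
  · have h' : b ≠ a := fun e => h e.symm
    simp only [h, h', if_false, rev_eq_comm' (a := a) (b := b)]

theorem flipWeight_ne_zero (a b : Fin N) : flipWeight s a b ≠ 0 := by
  have hs : (s : ℂ) ≠ 0 := s.ne_zero
  unfold flipWeight
  split_ifs <;> simp [hs]

theorem flipWeight_mul_rev (a b : Fin N) : flipWeight s a b * flipWeight s a b.rev = 1 := by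
  have hs : (s : ℂ) ≠ 0 := s.ne_zero
  unfold flipWeight
  simp only [Fin.rev_inj, rev_eq_comm' (a := a) (b := b)]
  by_cases h1 : a = b
  · subst h1
    by_cases h2 : a = a.rev
    · simp [← h2]
    · have h3 : a.rev ≠ a := fun h => h2 h.symm
      simp [h2, hs]
  · have h1' : b ≠ a := fun h => h1 h.symm
    by_cases h2 : b = a.rev
    · subst h2
      simp [h1, hs]
    · simp [h1, h1', h2]

/-- The flip part of the skein relation R̂ - R̂⁻¹ = (q - q⁻¹)(1 - K): it accounts for the diagonal
terms that the truncations in `rHat_apply` leave out. -/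
theorem flipWeight_sub (a b : Fin N) :
    flipWeight s a b - ((s : ℂ) ^ 2 - ((s : ℂ) ^ 2)⁻¹) *
      ((if a = b then 1 else 0) - (if b = a.rev then 1 else 0)) = (flipWeight s a b)⁻¹ := by
  unfold flipWeight
  split_ifs <;> grind

theorem prod_flipWeight (a : Fin N) : ∏ b, flipWeight s a b = 1 := by
  have hs : (s : ℂ) ≠ 0 := s.ne_zero
  by_cases h : a = a.rev
  · refine Finset.prod_eq_one fun b _ => ?_
    unfold flipWeight
    grind
  · have e : ∀ b, flipWeight s a b =
        (if b = a then (s : ℂ) ^ 2 else 1) * (if b = a.rev then ((s : ℂ) ^ 2)⁻¹ else 1) := by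
      intro b
      unfold flipWeight
      grind
    rw [Finset.prod_congr rfl fun b _ => e b, Finset.prod_mul_distrib]
    simp [hs]

/-- R̂ preserves weights: a nonzero entry either permutes the two indices or links two pairs (a, a')
and (c, c'), both of weight one. -/
theorem mul_eq_mul_of_rHat_ne_zero {t : Fin N → ℂ} (ht : ∀ a, t a * t a.rev = 1)
    {a b c d : Fin N} (h : rHat N s (a, b) (c, d) ≠ 0) : t a * t b = t c * t d := by
  by_contra hne
  apply h
  rw [rHat_apply, if_neg, if_neg, zero_add, zero_sub]
  · by_cases hb : b = a.rev
    · by_cases hd : d = c.rev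
      · subst hb hd
        exact absurd ((ht a).trans (ht c).symm) hne
      · simp [metric_of_ne hd]
    · simp [metric_of_ne hb]
  · rintro ⟨rfl, rfl, -⟩
    exact hne rfl
  · rintro ⟨rfl, rfl⟩
    exact hne (mul_comm _ _)

theorem tensorSq_diagonal (t : Fin N → ℂ) : tensorSq (Matrix.diagonal t) =
    Matrix.diagonal fun p : Fin N × Fin N => t p.1 * t p.2 := by
  ext ⟨a, b⟩ ⟨c, d⟩
  simp only [tensorSq, Matrix.diagonal_apply, Prod.mk.injEq]
  split_ifs <;> simp_all

theorem rHat_comm_diagonal {t : Fin N → ℂ} (ht : ∀ a, t a * t a.rev = 1) :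
    rHat N s * tensorSq (Matrix.diagonal t) = tensorSq (Matrix.diagonal t) * rHat N s := by
  rw [tensorSq_diagonal]
  ext ⟨a, b⟩ ⟨c, d⟩
  rw [Matrix.mul_diagonal, Matrix.diagonal_mul]
  by_cases h : rHat N s (a, b) (c, d) = 0
  · simp [h]
  · rw [mul_eq_mul_of_rHat_ne_zero ht h, mul_comm]

theorem diagonal_mul_metric_mul {t : Fin N → ℂ} (ht : ∀ a, t a * t a.rev = 1) :
    Matrix.diagonal t * metric N s * Matrix.diagonal t = metric N s := by
  ext a b
  rw [Matrix.mul_diagonal, Matrix.diagonal_mul]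
  by_cases h : b = a.rev
  · subst h
    linear_combination metric N s a a.rev * ht a
  · rw [metric_of_ne h]
    ring

theorem scalarMat_self {m n : Type*} (M : Matrix m n ℂ) : scalarMat ℂ M = M := by
  ext i j
  simp [scalarMat]

theorem tensorPow_diagonal (t : Fin N → ℂ) {n : ℕ} (i j : Fin n → Fin N) :
    tensorPow (Matrix.diagonal t) i j = if i = j then ∏ k, t (i k) else 0 := by
  rw [tensorPow, List.prod_ofFn]
  split_ifs with h
  · subst h
    simp
  · obtain ⟨k, hk⟩ := Function.ne_iff.1 h
    exact Finset.prod_eq_zero (Finset.mem_univ k) (Matrix.diagonal_apply_ne _ hk)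

section Generic

variable (hq : ((s : ℂ) ^ 2) ^ 2 ≠ 1) (hq' : (s : ℂ) ^ 2 + ((s : ℂ) ^ 2)⁻¹ ≠ 0)
  (hZ : ∑ e, ∑ f, metric N s e f * metric N s e f ≠ 0)

include hq hq' hZ

theorem isQOrthogonal_of_comm {B : Type*} [Ring B] [Algebra ℂ B] {M : Matrix (Fin N) (Fin N) B}
    (hR : scalarMat B (rHat N s) * tensorSq M = tensorSq M * scalarMat B (rHat N s))
    (hl : M * scalarMat B (metric N s) * M.transpose = scalarMat B (metric N s))
    (hr : M.transpose * scalarMat B (metric N s) * M = scalarMat B (metric N s))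
    (h0 : ∀ ε : (Fin N → Fin N) → ℂ, IsQAntisymmetric s ε →
      ∑ j, tensorPow M id j * algebraMap ℂ B (ε j) = algebraMap ℂ B (ε id)) :
    IsQOrthogonal s M where
  rtt := rtt_iff_rHat_comm.2 hR
  orth_left := hl
  orth_right := hr
  det ε hε i := det_of_projA_comm hq hq' hZ
    (projA_comm_of_rHat_comm hR (metricProj_comm_of_orth hl hr)) hε (h0 ε hε) i

theorem isQOrthogonal_diagonal {t : Fin N → ℂ} (ht : ∀ a, t a * t a.rev = 1)
    (ht' : ∏ a, t a = 1) : IsQOrthogonal s (Matrix.diagonal t) := by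
  apply isQOrthogonal_of_comm hq hq' hZ
  · simpa only [scalarMat_self] using rHat_comm_diagonal ht
  · simpa only [scalarMat_self, Matrix.diagonal_transpose] using diagonal_mul_metric_mul ht
  · simpa only [scalarMat_self, Matrix.diagonal_transpose] using diagonal_mul_metric_mul ht
  · intro ε _
    simp [tensorPow_diagonal, ht']

/-- The determinant relation evaluated at a torus character. A component of ε can be nonzero only if
its multi-index has trivial weight. -/
theorem IsQAntisymmetric.mul_prod {t : Fin N → ℂ} (ht : ∀ a, t a * t a.rev = 1)
    (ht' : ∏ a, t a = 1) {ε : (Fin N → Fin N) → ℂ} (hε : IsQAntisymmetric s ε)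
    (i : Fin N → Fin N) : (∏ k, t (i k)) * ε i = ε i := by
  have := (isQOrthogonal_diagonal hq hq' hZ ht ht').det ε hε i
  simpa [tensorPow_diagonal] using this

end Generic

/-- A point of the torus that separates `i` from all other indices. -/
def torusPoint (i : Fin N) : Fin N → ℂ :=
  fun a => if a = i then 2 else if a = i.rev then 2⁻¹ else 1

theorem torusPoint_mul_rev {i : Fin N} (hi : i ≠ i.rev) (a : Fin N) :
    torusPoint i a * torusPoint i a.rev = 1 := by
  unfold torusPoint
  simp only [Fin.rev_inj]
  by_cases h1 : a = i
  · subst h1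
    simp [hi.symm]
  · have h1' : i ≠ a := fun h => h1 h.symm
    by_cases h2 : a = i.rev
    · subst h2
      simp [hi.symm]
    · have h3 : a.rev ≠ i := fun h => h2 (by rw [← h, Fin.rev_rev])
      simp [h1, h2, h3]

theorem prod_torusPoint {i : Fin N} (hi : i ≠ i.rev) : ∏ a, torusPoint i a = 1 := by
  have e : ∀ a, torusPoint i a = (if a = i then 2 else 1) * (if a = i.rev then 2⁻¹ else 1) := by
    intro a
    unfold torusPoint
    split_ifs with h1 h2
    · exact absurd (h1.symm.trans h2) hi
    all_goals simp
  rw [Finset.prod_congr rfl fun a _ => e a, Finset.prod_mul_distrib]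
  simp

/-! ### Representations by triangular matrices -/

/-- The matrix with entries in the upper triangular `2 × 2` matrices with diagonal entries taken
from `P` and `Q` and the other entry from `E`. -/
def triMat {m n : Type*} (P E Q : Matrix m n ℂ) : Matrix m n (Matrix (Fin 2) (Fin 2) ℂ) :=
  fun a b => !![P a b, E a b; 0, Q a b]

theorem triMat_mul {m n p : Type*} [Fintype n] (P E Q : Matrix m n ℂ) (P' E' Q' : Matrix n p ℂ) :
    triMat P E Q * triMat P' E' Q' = triMat (P * P') (P * E' + E * Q') (Q * Q') := by
  ext a b x y
  fin_cases x <;> fin_cases y <;>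
    simp [triMat, Matrix.mul_apply, Matrix.sum_apply, Finset.sum_add_distrib]

theorem triMat_transpose {m n : Type*} (P E Q : Matrix m n ℂ) :
    (triMat P E Q).transpose = triMat P.transpose E.transpose Q.transpose := rfl

theorem scalarMat_eq_triMat {m n : Type*} (M : Matrix m n ℂ) :
    scalarMat (Matrix (Fin 2) (Fin 2) ℂ) M = triMat M 0 M := by
  ext a b x y
  fin_cases x <;> fin_cases y <;> simp [triMat, scalarMat, Matrix.algebraMap_matrix_apply]

/-- With P = K and Q = 1 the off-diagonal entry is K ⊗ E + E ⊗ 1, the coproduct of a skew-primitive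
element. Commutation with R̂ thereby becomes a statement about complex matrices. -/
theorem tensorSq_triMat (P E Q : Matrix (Fin N) (Fin N) ℂ) :
    tensorSq (triMat P E Q) = triMat (tensorSq P)
      (fun i j => P i.1 j.1 * E i.2 j.2 + E i.1 j.1 * Q i.2 j.2) (tensorSq Q) := by
  ext i j x y
  fin_cases x <;> fin_cases y <;>
    simp [triMat, tensorSq, Matrix.mul_apply, Fin.sum_univ_two]

/-- The action of a skew-primitive element on `ℂ^N ⊗ ℂ^N`. -/
def skewSum (K : Fin N → ℂ) (E : Matrix (Fin N) (Fin N) ℂ) :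
    Matrix (Fin N × Fin N) (Fin N × Fin N) ℂ :=
  fun i j => Matrix.diagonal K i.1 j.1 * E i.2 j.2 +
    E i.1 j.1 * (1 : Matrix (Fin N) (Fin N) ℂ) i.2 j.2

theorem skewSum_apply (K : Fin N → ℂ) (E : Matrix (Fin N) (Fin N) ℂ) (a b c d : Fin N) :
    skewSum K E (a, b) (c, d) =
      (if a = c then K a * E b d else 0) + (if b = d then E a c else 0) := by
  simp [skewSum, Matrix.diagonal_apply, Matrix.one_apply]

section

variable {K : Fin N → ℂ} {E : Matrix (Fin N) (Fin N) ℂ}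

/-- Without the truncation e < b the sum vanishes, since C is invariant (`hC`). As E raises the
index by one, the two cancelling terms have first indices c and c - 1. The truncation separates them
only for b = c, and the surviving boundary term is the right side. -/
theorem sum_metric_mul_skewSum
    (hC : ∀ c d, K c * metric N s c c.rev * E c.rev d + E d.rev c * metric N s d.rev d = 0)
    (hE : ∀ x y, E x y ≠ 0 → (y : ℕ) = x + 1) (a b c d : Fin N) :
    ∑ e, ∑ f, (if e < b then metric N s a b * metric N s e f else 0) *
      skewSum K E (e, f) (c, d) = -if b = c ∧ b = a.rev then K b * E a d else 0 := by
  have h1 : ∑ e, ∑ f, (if e < b then metric N s a b * metric N s e f else 0) *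
      skewSum K E (e, f) (c, d) = metric N s a b *
        ((if c < b then K c * metric N s c c.rev * E c.rev d else 0) +
          if d.rev < b then E d.rev c * metric N s d.rev d else 0) := by
    have h2 : ∀ e, ∑ f, (if e < b then metric N s a b * metric N s e f else 0) *
        skewSum K E (e, f) (c, d) =
        metric N s a b * ((if e = c then
          (if c < b then K c * metric N s c c.rev * E c.rev d else 0) else 0) +
          if e = d.rev then (if d.rev < b then E d.rev c * metric N s d.rev d else 0) else 0) := by
      intro e
      rw [Finset.sum_eq_single e.rev]
      · have h5 : e.rev = d ↔ e = d.rev := ⟨fun h => by rw [← h, Fin.rev_rev],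
          fun h => by rw [h, Fin.rev_rev]⟩
        simp only [skewSum_apply, h5]
        by_cases h3 : e = c
        · subst h3
          by_cases h4 : e = d.rev
          · subst h4
            simp only [Fin.rev_rev, if_true]
            split_ifs <;> ring
          · simp only [h4, if_true, if_false]
            split_ifs <;> ring
        · by_cases h4 : e = d.rev
          · subst h4
            simp only [h3, Fin.rev_rev, if_true, if_false]
            split_ifs <;> ring
          · simp only [h3, h4, if_false]
            ring
      · intro f _ hf
        simp [metric_of_ne hf]
      · simp
    simp only [h2, ← Finset.mul_sum, Finset.sum_add_distrib, Finset.sum_ite_eq',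
      Finset.mem_univ, if_true]
  rw [h1]
  by_cases hb : b = a.rev
  · subst hb
    simp only [and_true]
    have hC' := hC c d
    by_cases h3 : a.rev = c
    · subst h3
      have h4 : (if d.rev < a.rev then E d.rev a.rev * metric N s d.rev d else 0) =
          E d.rev a.rev * metric N s d.rev d := by
        by_cases hz : E d.rev a.rev = 0
        · simp [hz]
        · have := hE _ _ hz
          rw [if_pos (Fin.lt_def.2 (by omega))]
      rw [if_neg (lt_irrefl _), if_pos rfl, h4]
      rw [Fin.rev_rev] at hC'
      linear_combination metric N s a a.rev * hC' - K a.rev * E a d * metric_mul_swap (s := s) a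
    · rw [if_neg h3]
      by_cases hz : E d.rev c = 0
      · have h0 : K c * metric N s c c.rev * E c.rev d = 0 := by
          rwa [hz, zero_mul, add_zero] at hC'
        simp only [hz, h0, zero_mul, ite_self, add_zero, mul_zero, neg_zero]
      · have hc := hE _ _ hz
        have h4 : (a.rev : ℕ) ≠ c := fun h => h3 (Fin.ext h)
        have h5 : d.rev < a.rev ↔ c < a.rev := by
          simp only [Fin.lt_def]; omega
        simp only [h5]
        split_ifs
        · rw [hC', mul_zero, neg_zero]
        · simp
  · simp [metric_of_ne hb, hb]

/-- The mirror image of `sum_metric_mul_skewSum`: the cancelling terms now have second indices b and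
b + 1, and the truncation separates them only for c = b. -/
theorem sum_skewSum_mul_metric
    (hC : ∀ a b, K a * metric N s a a.rev * E b a.rev + E a b.rev * metric N s b.rev b = 0)
    (hE : ∀ x y, E x y ≠ 0 → (y : ℕ) = x + 1) (a b c d : Fin N) :
    ∑ e, ∑ f, skewSum K E (a, b) (e, f) *
      (if c < f then metric N s e f * metric N s c d else 0) =
      -if b = c ∧ d = c.rev then E a d else 0 := by
  have h1 : ∑ e, ∑ f, skewSum K E (a, b) (e, f) *
      (if c < f then metric N s e f * metric N s c d else 0) = metric N s c d *
        ((if c < a.rev then K a * metric N s a a.rev * E b a.rev else 0) +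
          if c < b then E a b.rev * metric N s b.rev b else 0) := by
    have h2 : ∀ e, ∑ f, skewSum K E (a, b) (e, f) *
        (if c < f then metric N s e f * metric N s c d else 0) =
        metric N s c d * ((if e = a then
          (if c < a.rev then K a * metric N s a a.rev * E b a.rev else 0) else 0) +
          if e = b.rev then (if c < b then E a b.rev * metric N s b.rev b else 0) else 0) := by
      intro e
      rw [Finset.sum_eq_single e.rev]
      · have h5 : b = e.rev ↔ e = b.rev := rev_eq_comm'
        simp only [skewSum_apply, h5, eq_comm (a := a) (b := e)]
        by_cases h3 : e = a
        · subst h3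
          by_cases h4 : e = b.rev
          · subst h4
            simp only [Fin.rev_rev, if_true]
            split_ifs <;> ring
          · simp only [h4, if_true, if_false]
            split_ifs <;> ring
        · by_cases h4 : e = b.rev
          · subst h4
            simp only [h3, Fin.rev_rev, if_true, if_false]
            split_ifs <;> ring
          · simp only [h3, h4, if_false]
            ring
      · intro f _ hf
        simp [metric_of_ne hf]
      · simp
    simp only [h2, ← Finset.mul_sum, Finset.sum_add_distrib, Finset.sum_ite_eq',
      Finset.mem_univ, if_true]
  rw [h1]
  by_cases hd : d = c.rev
  · subst hd
    simp only [and_true]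
    have hC' := hC a b
    by_cases h3 : b = c
    · subst h3
      have h4 : (if b < a.rev then K a * metric N s a a.rev * E b a.rev else 0) =
          K a * metric N s a a.rev * E b a.rev := by
        by_cases hz : E b a.rev = 0
        · simp [hz]
        · have := hE _ _ hz
          rw [if_pos (Fin.lt_def.2 (by omega))]
      rw [if_neg (lt_irrefl _), if_pos rfl, h4]
      linear_combination metric N s b b.rev * hC' - E a b.rev * metric_mul_swap (s := s) b
    · rw [if_neg h3]
      by_cases hz : E b a.rev = 0
      · have h0 : E a b.rev * metric N s b.rev b = 0 := by
          rwa [hz, mul_zero, zero_add] at hC'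
        simp only [hz, h0, mul_zero, ite_self, add_zero, neg_zero]
      · have hc := hE _ _ hz
        have h4 : (b : ℕ) ≠ c := fun h => h3 (Fin.ext h)
        have h5 : c < a.rev ↔ c < b := by
          simp only [Fin.lt_def]; omega
        simp only [h5]
        split_ifs
        · rw [hC', mul_zero, neg_zero]
        · simp
  · simp [metric_of_ne hd, hd]

/-- The braid matrix commutes with the action of a skew-primitive element attached to neighbouring
indices. -/
theorem rHat_comm_skewSum
    (hC : ∀ a b, K a * metric N s a a.rev * E b a.rev + E a b.rev * metric N s b.rev b = 0)
    (hC' : ∀ c d, K c * metric N s c c.rev * E c.rev d + E d.rev c * metric N s d.rev d = 0)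
    (hE : ∀ x y, E x y ≠ 0 → (y : ℕ) = x + 1)
    (hK : ∀ x y, E x y ≠ 0 → ∀ b, flipWeight s x b = K b * flipWeight s y b) :
    rHat N s * skewSum K E = skewSum K E * rHat N s := by
  ext ⟨a, b⟩ ⟨c, d⟩
  have e1 : ∑ e, ∑ f, (if a = f ∧ b = e then flipWeight s a b else 0) * skewSum K E (e, f) (c, d) =
      flipWeight s a b * skewSum K E (b, a) (c, d) := by
    rw [Finset.sum_eq_single b, Finset.sum_eq_single a]
    · simp
    · intro f _ hf; simp [hf.symm]
    · simp
    · intro e _ he; simp [he.symm]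
    · simp
  have e2 : ∑ e, ∑ f, (if a = e ∧ b = f ∧ a < b then (1 : ℂ) else 0) * skewSum K E (e, f) (c, d) =
      if a < b then skewSum K E (a, b) (c, d) else 0 := by
    rw [Finset.sum_eq_single a, Finset.sum_eq_single b]
    · simp
    · intro f _ hf; simp [hf.symm]
    · simp
    · intro e _ he; simp [he.symm]
    · simp
  have e3 := sum_metric_mul_skewSum hC' hE a b c d
  have f1 : ∑ e, ∑ f, skewSum K E (a, b) (e, f) * (if e = d ∧ f = c then flipWeight s e f else 0) =
      flipWeight s d c * skewSum K E (a, b) (d, c) := by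
    rw [Finset.sum_eq_single d, Finset.sum_eq_single c]
    · simp [mul_comm]
    · intro f _ hf; simp [hf]
    · simp
    · intro e _ he; simp [he]
    · simp
  have f2 : ∑ e, ∑ f, skewSum K E (a, b) (e, f) * (if e = c ∧ f = d ∧ e < f then (1 : ℂ) else 0) =
      if c < d then skewSum K E (a, b) (c, d) else 0 := by
    rw [Finset.sum_eq_single c, Finset.sum_eq_single d]
    · simp
    · intro f _ hf; simp [hf]
    · simp
    · intro e _ he; simp [he]
    · simp
  have f3 := sum_skewSum_mul_metric hC hE a b c d
  have hl : (rHat N s * skewSum K E) (a, b) (c, d) =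
      flipWeight s a b * skewSum K E (b, a) (c, d) + ((s : ℂ) ^ 2 - ((s : ℂ) ^ 2)⁻¹) *
        ((if a < b then skewSum K E (a, b) (c, d) else 0) +
          if b = c ∧ b = a.rev then K b * E a d else 0) := by
    rw [← neg_neg (ite (b = c ∧ b = a.rev) _ _), ← e3, ← e1, ← e2, Matrix.mul_apply,
      Fintype.sum_prod_type]
    simp only [rHat_apply, add_mul, mul_assoc, sub_mul, Finset.sum_add_distrib,
      ← Finset.mul_sum, Finset.sum_sub_distrib]
    ring
  have hr : (skewSum K E * rHat N s) (a, b) (c, d) =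
      flipWeight s d c * skewSum K E (a, b) (d, c) + ((s : ℂ) ^ 2 - ((s : ℂ) ^ 2)⁻¹) *
        ((if c < d then skewSum K E (a, b) (c, d) else 0) +
          if b = c ∧ d = c.rev then E a d else 0) := by
    rw [← neg_neg (ite (b = c ∧ d = c.rev) _ _), ← f3, ← f1, ← f2, Matrix.mul_apply,
      Fintype.sum_prod_type]
    simp only [rHat_apply, mul_add, mul_left_comm _ ((s : ℂ) ^ 2 - ((s : ℂ) ^ 2)⁻¹), mul_sub,
      Finset.sum_add_distrib, ← Finset.mul_sum, Finset.sum_sub_distrib]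
    ring
  -- The truncated identity on the left tests a < b, on the right c < d. Since E moves one index by
  -- one step, the two tests can disagree on a nonzero entry only if b = c.
  have hdiff : (if a < b then skewSum K E (a, b) (c, d) else 0) -
      (if c < d then skewSum K E (a, b) (c, d) else 0) =
      if b = c then (if b = d then E a d else 0) - (if a = b then K b * E a d else 0) else 0 := by
    rw [skewSum_apply]
    have h1 : (if a < b then (if a = c then K a * E b d else 0) else 0) -
        (if c < d then (if a = c then K a * E b d else 0) else 0) =
        if b = c then -(if a = b then K b * E a d else 0) else 0 := by
      by_cases hac : a = c
      · subst hac
        by_cases hz : E b d = 0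
        · by_cases hab : a = b
          · subst hab; simp [hz]
          · simp [hz, hab]
        · have := hE _ _ hz
          by_cases hab : a = b
          · subst hab
            rw [if_neg (lt_irrefl _), if_pos (Fin.lt_def.2 (by omega))]
            simp
          · have hba : b ≠ a := fun h => hab h.symm
            have hne : (a : ℕ) ≠ b := fun h => hab (Fin.ext h)
            have hiff : a < d ↔ a < b := by simp only [Fin.lt_def]; omega
            simp [hba, hiff]
      · by_cases hbc : b = c
        · subst hbc; simp [hac]
        · simp [hac, hbc]
    have h2 : (if a < b then (if b = d then E a c else 0) else 0) -
        (if c < d then (if b = d then E a c else 0) else 0) =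
        if b = c then (if b = d then E a d else 0) else 0 := by
      by_cases hbd : b = d
      · subst hbd
        by_cases hz : E a c = 0
        · by_cases hbc : b = c
          · subst hbc; simp [hz]
          · simp [hz, hbc]
        · have := hE _ _ hz
          by_cases hbc : b = c
          · subst hbc
            rw [if_neg (lt_irrefl b), if_pos (Fin.lt_def.2 (by omega))]
            simp
          · have hne : (b : ℕ) ≠ c := fun h => hbc (Fin.ext h)
            have hiff : a < b ↔ c < b := by simp only [Fin.lt_def]; omega
            simp [hbc, hiff]
      · simp [hbd]
    have h3 : ∀ (p r : Prop) [Decidable p] [Decidable r] (x y : ℂ),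
        (if p then x + y else 0) - (if r then x + y else 0) =
        ((if p then x else 0) - (if r then x else 0)) +
          ((if p then y else 0) - (if r then y else 0)) := by
      intro p r _ _ x y
      split_ifs <;> ring
    rw [h3, h1, h2]
    split_ifs <;> ring
  -- By `hK` the weight change of E is compensated by the factor K in the term with E b c, leaving
  -- only the contribution with b = c.
  have hS : flipWeight s a b * skewSum K E (b, a) (c, d) -
      flipWeight s d c * skewSum K E (a, b) (d, c) =
      if b = c then (K b * flipWeight s a b - flipWeight s d b) * E a d else 0 := by
    have h1 : a = d → flipWeight s a b * E b c = flipWeight s d c * (K a * E b c) := by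
      rintro rfl
      by_cases hz : E b c = 0
      · simp [hz]
      · rw [flipWeight_comm a b, hK b c hz a, flipWeight_comm c a]
        ring
    simp only [skewSum_apply]
    by_cases had : a = d
    · have h2 := h1 had
      rw [if_pos had, if_pos had]
      by_cases hbc : b = c
      · subst hbc
        simp only [if_true]
        linear_combination h2
      · simp only [hbc, if_false]
        linear_combination h2
    · by_cases hbc : b = c
      · subst hbc
        simp only [had, if_true, if_false]
        ring
      · simp [had, hbc]
  rw [hl, hr, ← sub_eq_zero]
  trans (if b = c then (K b * flipWeight s a b - flipWeight s d b) * E a d else 0) +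
    ((s : ℂ) ^ 2 - ((s : ℂ) ^ 2)⁻¹) * ((if b = c then (if b = d then E a d else 0) -
      (if a = b then K b * E a d else 0) else 0) + (if b = c ∧ b = a.rev then K b * E a d else 0) -
        if b = c ∧ d = c.rev then E a d else 0)
  · rw [← hdiff, ← hS]; ring
  · by_cases hbc : b = c
    · subst hbc
      simp only [true_and, if_true]
      by_cases hz : E a d = 0
      · simp [hz]
      · have h1 := hK a d hz b
        have h2 := flipWeight_sub (s := s) a b
        have h3 := flipWeight_sub (s := s) b d
        -- For b = c everything left over is this identity, after both inverse weights are rewritten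
        -- by `flipWeight_sub`.
        have h4 : (flipWeight s b d)⁻¹ = K b * (flipWeight s a b)⁻¹ := by
          rw [h1, flipWeight_comm d b]
          have := flipWeight_ne_zero (s := s) a b
          rw [h1] at this
          have h5 := flipWeight_ne_zero (s := s) b d
          field_simp [left_ne_zero_of_mul this]
        rw [← h2, ← h3, flipWeight_comm b d] at h4
        split_ifs at h4 ⊢ <;> linear_combination (-E a d) * h4
    · simp [hbc]

end

/-! ### Quantum root vectors for neighbouring indices -/

/-- The diagonal part of the skew-primitive element attached to the indices `i`, `j`. -/
def rootDiag (s : ℂˣ) (i j : Fin N) : Fin N → ℂ :=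
  fun b => flipWeight s i b * (flipWeight s j b)⁻¹

/-- The lower coefficient of the root vector attached to the indices `i`, `j`. -/
def rootCoeff (s : ℂˣ) (i j : Fin N) : ℂ :=
  -(rootDiag s i j j.rev * metric N s j.rev j * metric N s i i.rev)

/-- The root vector attached to the indices `i`, `j`. -/
def rootMat (s : ℂˣ) (i j : Fin N) : Matrix (Fin N) (Fin N) ℂ :=
  fun x y => (if x = i ∧ y = j then 1 else 0) +
    if x = j.rev ∧ y = i.rev then rootCoeff s i j else 0

/-- The triangular matrix built from a root vector. -/
def rootRep (s : ℂˣ) (i j : Fin N) : Matrix (Fin N) (Fin N) (Matrix (Fin 2) (Fin 2) ℂ) :=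
  triMat (Matrix.diagonal (rootDiag s i j)) (rootMat s i j) 1

theorem rootDiag_mul_rev (i j b : Fin N) : rootDiag s i j b * rootDiag s i j b.rev = 1 := by
  have h1 := flipWeight_mul_rev (s := s) i b
  have h2 := flipWeight_mul_rev (s := s) j b
  unfold rootDiag
  rw [mul_mul_mul_comm, h1, ← mul_inv, h2, inv_one, one_mul]

theorem prod_rootDiag (i j : Fin N) : ∏ b, rootDiag s i j b = 1 := by
  simp [rootDiag, Finset.prod_mul_distrib, Finset.prod_inv_distrib, prod_flipWeight]

theorem flipWeight_rev_left (a b : Fin N) : flipWeight s a.rev b = (flipWeight s a b)⁻¹ := by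
  rw [flipWeight_comm, flipWeight_comm a]
  exact eq_inv_of_mul_eq_one_right (flipWeight_mul_rev b a)

theorem rootMat_ne_zero {i j x y : Fin N} (h : rootMat s i j x y ≠ 0) :
    (x = i ∧ y = j) ∨ (x = j.rev ∧ y = i.rev) := by
  by_contra hne
  push Not at hne
  apply h
  rw [rootMat, if_neg (fun e => hne.1 e.1 e.2), if_neg (fun e => hne.2 e.1 e.2), zero_add]

theorem rootCoeff_ne_zero (i j : Fin N) : rootCoeff s i j ≠ 0 := by
  refine neg_ne_zero.2 (mul_ne_zero (mul_ne_zero (mul_ne_zero (flipWeight_ne_zero _ _)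
    (inv_ne_zero (flipWeight_ne_zero _ _))) ?_) ?_)
  · rw [rev_metric]; exact Units.ne_zero _
  · rw [metric_rev]; exact Units.ne_zero _

section Root

variable {i j : Fin N} (hij : (j : ℕ) = i + 1) (hj : j ≤ j.rev)

include hij hj

theorem ne_rev_of_succ : i ≠ j.rev ∧ i ≠ i.rev ∧ i ≠ j := by
  have h1 := Fin.le_def.1 hj
  have h2 := i.2
  have h3 := j.2
  rw [Fin.val_rev] at h1
  refine ⟨fun h => ?_, fun h => ?_, fun h => ?_⟩
  all_goals have h4 := congrArg Fin.val h
  · rw [Fin.val_rev] at h4; omega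
  · rw [Fin.val_rev] at h4; omega
  · omega

theorem rootMat_apply : rootMat s i j i j = 1 := by
  simp [rootMat, (ne_rev_of_succ hij hj).1]

theorem rootMat_apply_rev : rootMat s i j j.rev i.rev = rootCoeff s i j := by
  simp [rootMat, (ne_rev_of_succ hij hj).1.symm]

/-- The lower coefficient of the root vector is chosen to solve one invariance equation for C; this
identity makes it solve the other one too. If j < j', then ρ drops by 1 from i to j. If j = j' it
drops only by 1/2, which is matched by w(j, j') = 1 in the place of q⁻¹. -/
theorem rootDiag_mul_metric_sq :
    rootDiag s i j i * rootDiag s i j j.rev * metric N s i i.rev ^ 2 = metric N s j j.rev ^ 2 := by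
  have hs : (s : ℂ) ≠ 0 := s.ne_zero
  have hne := ne_rev_of_succ hij hj
  have h1 := Fin.le_def.1 hj
  rw [Fin.val_rev] at h1
  have e1 : flipWeight s i i = (s : ℂ) ^ 2 := by simp [flipWeight, hne.2.1]
  have e2 : flipWeight s j i = 1 := by
    rw [flipWeight, if_neg hne.2.2.symm, if_neg hne.1]
  have e3 : flipWeight s i j.rev = 1 := by
    rw [flipWeight, if_neg hne.1, if_neg (fun h => hne.2.2 (Fin.rev_injective h).symm)]
  rw [rootDiag, rootDiag, e1, e2, e3, metric_rev, metric_rev]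
  have h2 := i.2
  have h3 := j.2
  have hti : twoRho i = (N : ℤ) - 2 * (i : ℕ) - 2 := by
    rw [twoRho, if_pos (Fin.lt_def.2 (by rw [Fin.val_rev]; omega))]
  rcases hj.lt_or_eq with hlt | heq
  · have e4 : flipWeight s j j.rev = ((s : ℂ) ^ 2)⁻¹ := by
      rw [flipWeight, if_neg hlt.ne, if_pos rfl]
    have htj : twoRho j = twoRho i - 2 := by
      rw [hti, twoRho, if_pos hlt, hij]
      push_cast
      ring
    rw [e4, htj, neg_sub, sub_eq_add_neg, zpow_add, Units.val_mul]
    push_cast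
    field_simp
  · have e4 : flipWeight s j j.rev = 1 := by
      rw [← heq, flipWeight, if_pos rfl, if_pos heq]
    have htj : twoRho j = 0 := by
      rw [twoRho, ← heq, if_neg (lt_irrefl _), if_pos rfl]
    have hti' : twoRho i = 1 := by
      have := congrArg Fin.val heq
      rw [Fin.val_rev] at this
      omega
    rw [e4, htj, hti']
    push_cast
    field_simp
    simp

/-- Only two positions contribute. One equation is the definition of `rootCoeff`, the other reduces
to `rootDiag_mul_metric_sq`. -/
theorem rootMat_metric_left (a b : Fin N) :
    rootDiag s i j a * metric N s a a.rev * rootMat s i j b a.rev +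
      rootMat s i j a b.rev * metric N s b.rev b = 0 := by
  have hne := ne_rev_of_succ hij hj
  have h1 : ∀ x y : Fin N, x.rev = y ↔ x = y.rev := fun x y =>
    ⟨fun h => by rw [← h, Fin.rev_rev], fun h => by rw [h, Fin.rev_rev]⟩
  by_cases hA : a = j.rev ∧ b = i
  · obtain ⟨rfl, rfl⟩ := hA
    rw [Fin.rev_rev, rootMat_apply hij hj, rootMat_apply_rev hij hj, rootCoeff]
    have := metric_mul_swap (s := s) b
    linear_combination (-rootDiag s b j j.rev * metric N s j.rev j) * this
  · by_cases hB : a = i ∧ b = j.rev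
    · obtain ⟨rfl, rfl⟩ := hB
      rw [Fin.rev_rev, rootMat_apply hij hj, rootMat_apply_rev hij hj, rootCoeff]
      have h2 := metric_mul_swap (s := s) j
      have h3 := rootDiag_mul_metric_sq (s := s) hij hj
      linear_combination (-metric N s j.rev j) * h3 - metric N s j j.rev * h2
    · have hz1 : rootMat s i j b a.rev = 0 := by
        by_contra h
        rcases rootMat_ne_zero h with h | h
        · exact hA ⟨(h1 _ _).1 h.2, h.1⟩
        · exact hB ⟨Fin.rev_injective h.2, h.1⟩
      have hz2 : rootMat s i j a b.rev = 0 := by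
        by_contra h
        rcases rootMat_ne_zero h with h | h
        · exact hB ⟨h.1, (h1 _ _).1 h.2⟩
        · exact hA ⟨h.1, Fin.rev_injective h.2⟩
      rw [hz1, hz2]
      ring

theorem rootMat_metric_right (c d : Fin N) :
    rootDiag s i j c * metric N s c c.rev * rootMat s i j c.rev d +
      rootMat s i j d.rev c * metric N s d.rev d = 0 := by
  have hne := ne_rev_of_succ hij hj
  have h1 : ∀ x y : Fin N, x.rev = y ↔ x = y.rev := fun x y =>
    ⟨fun h => by rw [← h, Fin.rev_rev], fun h => by rw [h, Fin.rev_rev]⟩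
  have hi := metric_mul_swap (s := s) i
  have hj' := metric_mul_swap (s := s) j
  have hKi := rootDiag_mul_rev (s := s) i j i
  have hKj := rootDiag_mul_rev (s := s) i j j
  have hsq := rootDiag_mul_metric_sq (s := s) hij hj
  by_cases hA : c = i.rev ∧ d = j
  · obtain ⟨rfl, rfl⟩ := hA
    rw [Fin.rev_rev, rootMat_apply hij hj, rootMat_apply_rev hij hj, rootCoeff]
    grind
  · by_cases hB : c = j ∧ d = i.rev
    · obtain ⟨rfl, rfl⟩ := hB
      rw [Fin.rev_rev, rootMat_apply hij hj, rootMat_apply_rev hij hj, rootCoeff]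
      grind
    · have hz1 : rootMat s i j c.rev d = 0 := by
        by_contra h
        rcases rootMat_ne_zero h with h | h
        · exact hA ⟨(h1 _ _).1 h.1, h.2⟩
        · exact hB ⟨Fin.rev_injective h.1, h.2⟩
      have hz2 : rootMat s i j d.rev c = 0 := by
        by_contra h
        rcases rootMat_ne_zero h with h | h
        · exact hB ⟨h.2, (h1 _ _).1 h.1⟩
        · exact hA ⟨h.2, Fin.rev_injective h.1⟩
      rw [hz1, hz2]
      ring

theorem rootMat_succ (x y : Fin N) (h : rootMat s i j x y ≠ 0) : (y : ℕ) = x + 1 := by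
  have h2 := i.2
  have h3 := j.2
  rcases rootMat_ne_zero h with ⟨rfl, rfl⟩ | ⟨rfl, rfl⟩
  · exact hij
  · simp only [Fin.val_rev]; omega

/-- This is the requirement that dictates `rootDiag`. It holds at both nonzero positions because
reversing an index inverts its weights. -/
theorem rootMat_flipWeight (x y : Fin N) (h : rootMat s i j x y ≠ 0) (b : Fin N) :
    flipWeight s x b = rootDiag s i j b * flipWeight s y b := by
  have h1 := flipWeight_ne_zero (s := s) i b
  have h2 := flipWeight_ne_zero (s := s) j b
  rcases rootMat_ne_zero h with ⟨rfl, rfl⟩ | ⟨rfl, rfl⟩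
  · rw [rootDiag]; field_simp
  · rw [rootDiag, flipWeight_rev_left, flipWeight_rev_left]; field_simp

theorem rHat_comm_rootRep :
    scalarMat (Matrix (Fin 2) (Fin 2) ℂ) (rHat N s) * tensorSq (rootRep s i j) =
      tensorSq (rootRep s i j) * scalarMat (Matrix (Fin 2) (Fin 2) ℂ) (rHat N s) := by
  have h : tensorSq (rootRep s i j) = triMat (tensorSq (Matrix.diagonal (rootDiag s i j)))
      (skewSum (rootDiag s i j) (rootMat s i j)) 1 := by
    rw [rootRep, tensorSq_triMat, tensorSq_one]
    rfl
  rw [h, scalarMat_eq_triMat, triMat_mul, triMat_mul,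
    rHat_comm_diagonal (rootDiag_mul_rev i j)]
  simp only [mul_one, one_mul, add_zero, mul_zero, zero_add]
  congr 1
  exact rHat_comm_skewSum (rootMat_metric_left hij hj) (rootMat_metric_right hij hj)
    (rootMat_succ hij hj) (rootMat_flipWeight hij hj)

theorem rootRep_orth_left :
    rootRep s i j * scalarMat (Matrix (Fin 2) (Fin 2) ℂ) (metric N s) * (rootRep s i j).transpose =
      scalarMat (Matrix (Fin 2) (Fin 2) ℂ) (metric N s) := by
  rw [rootRep, triMat_transpose, scalarMat_eq_triMat, triMat_mul, triMat_mul,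
    Matrix.diagonal_transpose, diagonal_mul_metric_mul (rootDiag_mul_rev i j)]
  simp only [Matrix.transpose_one, one_mul, mul_one, mul_zero, zero_add]
  congr 1
  ext a b
  have h := rootMat_metric_left (s := s) hij hj a b
  rw [Matrix.add_apply, Matrix.mul_apply, Matrix.mul_apply, Finset.sum_eq_single a.rev,
    Finset.sum_eq_single b.rev, Matrix.diagonal_mul]
  · exact h
  · intro x _ hx
    rw [metric_of_ne (fun e => hx (rev_eq_comm'.1 e)), mul_zero]
  · simp
  · intro x _ hx
    rw [Matrix.diagonal_mul, metric_of_ne hx, mul_zero, zero_mul]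
  · simp

theorem rootRep_orth_right :
    (rootRep s i j).transpose * scalarMat (Matrix (Fin 2) (Fin 2) ℂ) (metric N s) * rootRep s i j =
      scalarMat (Matrix (Fin 2) (Fin 2) ℂ) (metric N s) := by
  rw [rootRep, triMat_transpose, scalarMat_eq_triMat, triMat_mul, triMat_mul,
    Matrix.diagonal_transpose, diagonal_mul_metric_mul (rootDiag_mul_rev i j)]
  simp only [Matrix.transpose_one, one_mul, mul_one, mul_zero, zero_add]
  congr 1
  ext c d
  have h := rootMat_metric_right (s := s) hij hj c d
  rw [Matrix.add_apply, Matrix.mul_apply, Matrix.mul_apply, Finset.sum_eq_single c.rev,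
    Finset.sum_eq_single d.rev, Matrix.diagonal_mul]
  · exact h
  · intro x _ hx
    rw [metric_of_ne (fun e => hx (rev_eq_comm'.1 e)), mul_zero]
  · simp
  · intro x _ hx
    rw [Matrix.diagonal_mul, metric_of_ne hx, mul_zero, zero_mul]
  · simp

theorem rootRep_apply_self (a : Fin N) :
    rootRep s i j a a = Matrix.diagonal ![rootDiag s i j a, 1] := by
  have h1 : rootMat s i j a a = 0 := by
    by_contra h
    have := rootMat_succ hij hj a a h
    omega
  ext x y
  fin_cases x <;> fin_cases y <;> simp [rootRep, triMat, h1]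

/-- The diagonal entries are commuting diagonal 2 × 2 matrices, and the weights w(i, ·) and w(j, ·)
each have product one over all indices. -/
theorem tensorPow_rootRep_id :
    tensorPow (rootRep s i j) id id = 1 := by
  have h1 : (fun k => rootRep s i j (id k) (id k)) =
      fun k => Matrix.diagonalRingHom (Fin 2) ℂ ![rootDiag s i j k, 1] := by
    funext k
    exact rootRep_apply_self hij hj k
  have h2 : ∏ k, ![rootDiag s i j k, 1] = 1 := by
    ext x
    rw [Finset.prod_apply]
    fin_cases x
    · simpa using prod_rootDiag i j
    · simp
  rw [tensorPow, h1, ← Function.comp_def, ← List.map_ofFn, ← map_list_prod, List.prod_ofFn, h2,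
    map_one]

/-- At the torus point of i, the move i → j changes 2 to 1 and j' → i' changes 1 to 1/2. Every
allowed move strictly lowers the absolute value, so a nontrivial f has product of norm less than
one. -/
theorem prod_torusPoint_ne_one {f : Fin N → Fin N}
    (hf : ∀ k, f k = k ∨ (k = i ∧ f k = j) ∨ (k = j.rev ∧ f k = i.rev)) (hne : f ≠ id) :
    ∏ k, torusPoint i (f k) ≠ 1 := by
  have h := ne_rev_of_succ hij hj
  have hij' : j ≠ i.rev := fun e => h.1 (rev_eq_comm'.1 e)
  have e1 : torusPoint i i = 2 := by simp [torusPoint]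
  have e2 : torusPoint i j = 1 := by simp [torusPoint, h.2.2.symm, hij']
  have e3 : torusPoint i j.rev = 1 := by
    simp [torusPoint, h.1.symm, h.2.2.symm]
  have e4 : torusPoint i i.rev = 2⁻¹ := by simp [torusPoint, h.2.1.symm]
  have hle : ∀ k, ‖torusPoint i (f k)‖ ≤ ‖torusPoint i k‖ := by
    intro k
    rcases hf k with h1 | ⟨rfl, h1⟩ | ⟨rfl, h1⟩
    · rw [h1]
    · rw [h1, e1, e2]; norm_num
    · rw [h1, e3, e4]; norm_num
  have hpos : ∀ k, 0 < ‖torusPoint i k‖ := by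
    intro k
    rw [norm_pos_iff]
    exact left_ne_zero_of_mul (a := torusPoint i k) (b := torusPoint i k.rev)
      (by rw [torusPoint_mul_rev h.2.1]; exact one_ne_zero)
  obtain ⟨k, hk⟩ := Function.ne_iff.1 hne
  have hlt : ‖torusPoint i (f k)‖ < ‖torusPoint i k‖ := by
    rcases hf k with h1 | ⟨rfl, h1⟩ | ⟨rfl, h1⟩
    · exact absurd h1 hk
    · rw [h1, e1, e2]; norm_num
    · rw [h1, e3, e4]; norm_num
  have hprod : ∏ k, ‖torusPoint i (f k)‖ < ∏ k, ‖torusPoint i k‖ :=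
    Finset.prod_lt_prod (fun k _ => hpos _) (fun k _ => hle k) ⟨k, Finset.mem_univ k, hlt⟩
  rw [← norm_prod, ← norm_prod, prod_torusPoint h.2.1] at hprod
  intro e
  rw [e] at hprod
  exact lt_irrefl _ hprod

/-- In the row 1 2 … N of the determinant relation, a column f other than the identity either has a
vanishing factor or uses only the two root moves. In the second case ε f = 0, since f has nontrivial
torus weight. -/
theorem isQOrthogonal_rootRep (hq : ((s : ℂ) ^ 2) ^ 2 ≠ 1)
    (hq' : (s : ℂ) ^ 2 + ((s : ℂ) ^ 2)⁻¹ ≠ 0)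
    (hZ : ∑ e, ∑ f, metric N s e f * metric N s e f ≠ 0) :
    IsQOrthogonal s (rootRep s i j) := by
  have h := ne_rev_of_succ hij hj
  refine isQOrthogonal_of_comm hq hq' hZ (rHat_comm_rootRep hij hj) (rootRep_orth_left hij hj)
    (rootRep_orth_right hij hj) fun ε hε => ?_
  rw [Finset.sum_eq_single id, tensorPow_rootRep_id hij hj, one_mul]
  · intro f _ hf
    by_cases hz : ∃ k, rootRep s i j k (f k) = 0
    · obtain ⟨k, hk⟩ := hz
      rw [tensorPow, List.prod_eq_zero, zero_mul]
      rw [List.mem_ofFn]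
      exact ⟨k, hk⟩
    · push Not at hz
      have hf' : ∀ k, f k = k ∨ (k = i ∧ f k = j) ∨ (k = j.rev ∧ f k = i.rev) := by
        intro k
        by_cases hk : f k = k
        · exact Or.inl hk
        · right
          apply rootMat_ne_zero (s := s)
          intro h0
          apply hz k
          ext x y
          fin_cases x <;> fin_cases y <;>
            simp [rootRep, triMat, h0, Ne.symm hk]
      have h1 := hε.mul_prod hq hq' hZ (torusPoint_mul_rev h.2.1) (prod_torusPoint h.2.1) f
      have h2 := prod_torusPoint_ne_one hij hj hf' hf
      have h3 : ε f = 0 := by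
        by_contra h3
        exact h2 (mul_right_cancel₀ h3 (h1.trans (one_mul _).symm))
      rw [h3, map_zero, mul_zero]
  · simp

end Root

/-! ### Matrices commuting with the generators -/

theorem apply_comm_of_commute {B : Type*} [Ring B] [Algebra ℂ B] {X : Matrix (Fin N) (Fin N) ℂ}
    (hX : scalarMat (SOq N s) X * genT N s = genT N s * scalarMat (SOq N s) X)
    {M : Matrix (Fin N) (Fin N) B} (hM : IsQOrthogonal s M) :
    scalarMat B X * M = M * scalarMat B X := by
  have h1 : (genT N s).map (SOq.lift M hM) = M := by
    ext a b
    simp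
  have h2 := congrArg (fun Y => Y.map (SOq.lift M hM)) hX
  simpa only [Matrix.map_mul, map_scalarMat, h1] using h2

section Commutant

variable (hq : ((s : ℂ) ^ 2) ^ 2 ≠ 1) (hq' : (s : ℂ) ^ 2 + ((s : ℂ) ^ 2)⁻¹ ≠ 0)
  (hZ : ∑ e, ∑ f, metric N s e f * metric N s e f ≠ 0)
  {X : Matrix (Fin N) (Fin N) ℂ}
  (hX : scalarMat (SOq N s) X * genT N s = genT N s * scalarMat (SOq N s) X)

include hq hq' hZ hX

/-- Evaluate at a torus character that takes different values at a and b. At least one of the two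
indices is not fixed by reversal, and its torus point separates them. -/
theorem off_diagonal_eq_zero_of_commute {a b : Fin N} (hab : a ≠ b) : X a b = 0 := by
  have key : ∀ i : Fin N, i ≠ i.rev → torusPoint i a ≠ torusPoint i b → X a b = 0 := by
    intro i hi hne
    have h1 := apply_comm_of_commute hX
      (isQOrthogonal_diagonal hq hq' hZ (torusPoint_mul_rev hi) (prod_torusPoint hi))
    rw [scalarMat_self] at h1
    have h2 := congrFun (congrFun h1 a) b
    rw [Matrix.mul_diagonal, Matrix.diagonal_mul] at h2
    have h3 : (torusPoint i a - torusPoint i b) * X a b = 0 := by linear_combination -h2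
    exact (mul_eq_zero.1 h3).resolve_left (sub_ne_zero.2 hne)
  by_cases ha : a = a.rev
  · have hb : b ≠ b.rev := by
      intro hb
      apply hab
      have h1 := congrArg Fin.val ha
      have h2 := congrArg Fin.val hb
      rw [Fin.val_rev] at h1 h2
      exact Fin.ext (by omega)
    refine key b hb ?_
    simp only [torusPoint, hab, if_true, if_false]
    split_ifs <;> norm_num
  · refine key a ha ?_
    simp only [torusPoint, hab.symm, if_true, if_false]
    split_ifs <;> norm_num

/-- The off-diagonal entry of the root representation says that X commutes with the root vector. As
X is diagonal, each nonzero entry of the root vector equates two diagonal entries of X. -/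
theorem apply_eq_of_commute {i j : Fin N} (hij : (j : ℕ) = i + 1) (hj : j ≤ j.rev) :
    X i i = X j j ∧ X j.rev j.rev = X i.rev i.rev := by
  have h1 := apply_comm_of_commute hX (isQOrthogonal_rootRep hij hj hq hq' hZ)
  rw [scalarMat_eq_triMat, rootRep, triMat_mul, triMat_mul] at h1
  have h2 : ∀ a b, X a a * rootMat s i j a b = rootMat s i j a b * X b b := by
    intro a b
    have h3 := congrFun (congrFun (congrFun (congrFun h1 a) b) 0) 1
    simp only [triMat, mul_zero, mul_one, add_zero, zero_add, Matrix.of_apply,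
      Matrix.cons_val', Matrix.cons_val_one,
      Matrix.cons_val_zero, Matrix.cons_val_fin_one] at h3
    rw [Matrix.mul_apply, Matrix.mul_apply, Finset.sum_eq_single a, Finset.sum_eq_single b] at h3
    · exact h3
    · intro c _ hc
      rw [off_diagonal_eq_zero_of_commute hq hq' hZ hX hc, mul_zero]
    · simp
    · intro c _ hc
      rw [off_diagonal_eq_zero_of_commute hq hq' hZ hX hc.symm, zero_mul]
    · simp
  constructor
  · simpa [rootMat_apply hij hj] using h2 i j
  · have h3 := h2 j.rev i.rev
    rw [rootMat_apply_rev hij hj, mul_comm] at h3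
    exact mul_left_cancel₀ (rootCoeff_ne_zero i j) h3

/-- A matrix that commutes with the matrix of generators is scalar, if its first and last diagonal
entries agree. -/
theorem eq_smul_one_of_commute {x : ℂ} (h0 : ∀ a : Fin N, (a : ℕ) = 0 → X a a = x)
    (hlast : ∀ a : Fin N, (a : ℕ) + 1 = N → X a a = x) :
    X = x • (1 : Matrix (Fin N) (Fin N) ℂ) := by
  -- Equality propagates inward from both ends at once. For even N the root vectors used here never
  -- connect the two halves, which is why both end entries are assumed.
  have key : ∀ (k : ℕ) (hk : k < N), 2 * k + 1 ≤ N →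
      X ⟨k, hk⟩ ⟨k, hk⟩ = x ∧ X (Fin.rev ⟨k, hk⟩) (Fin.rev ⟨k, hk⟩) = x := by
    intro k
    induction k with
    | zero =>
      intro hk _
      refine ⟨h0 _ rfl, hlast _ ?_⟩
      rw [Fin.val_rev]
      dsimp only
      omega
    | succ k ih =>
      intro hk hk2
      have h1 := ih (by omega) (by omega)
      have h2 := apply_eq_of_commute hq hq' hZ hX (i := ⟨k, by omega⟩) (j := ⟨k + 1, hk⟩) rfl
        (by rw [Fin.le_def, Fin.val_rev]; dsimp only; omega)
      exact ⟨h2.1.symm.trans h1.1, h2.2.trans h1.2⟩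
  ext a b
  by_cases hab : a = b
  · subst hab
    rw [Matrix.smul_apply, Matrix.one_apply_eq, smul_eq_mul, mul_one]
    by_cases h : 2 * (a : ℕ) + 1 ≤ N
    · exact (key a a.2 h).1
    · have h1 := a.2
      have h2 := (key a.rev a.rev.2 (by rw [Fin.val_rev]; omega)).2
      rwa [Fin.eta, Fin.rev_rev] at h2
  · rw [off_diagonal_eq_zero_of_commute hq hq' hZ hX hab, Matrix.smul_apply,
      Matrix.one_apply_ne hab, smul_zero]

end Commutant

/-! ### Complex solutions of the RTT relation: the first row -/

theorem mul_metric_mul_transpose {D : Matrix (Fin N) (Fin N) ℂ}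
    (hC : D.transpose * metric N s * D = metric N s) :
    D * metric N s * D.transpose = metric N s := by
  have h1 : metric N s * D.transpose * metric N s * D = 1 := by
    rw [mul_assoc, mul_assoc, ← mul_assoc D.transpose, hC, metric_mul_metric]
  have h2 := mul_eq_one_comm.1 h1
  calc D * metric N s * D.transpose
      = D * (metric N s * D.transpose * metric N s) * metric N s := by
        simp only [mul_assoc, metric_mul_metric, mul_one]
    _ = metric N s := by rw [h2, one_mul]

theorem metric_mul_apply_rev {D : Matrix (Fin N) (Fin N) ℂ}
    (hC : D.transpose * metric N s * D = metric N s) (a b : Fin N) :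
    ∑ e, D a e * metric N s e e.rev * D b e.rev = metric N s a b := by
  conv_rhs => rw [← mul_metric_mul_transpose hC]
  rw [Matrix.mul_apply, ← Equiv.sum_comp Fin.revPerm]
  refine Finset.sum_congr rfl fun e _ => ?_
  rw [Matrix.mul_apply, Finset.sum_eq_single e.rev]
  · simp
  · intro x _ hx
    rw [metric_of_ne (fun h => hx (rev_eq_comm'.1 h)), mul_zero]
  · simp

section Scalar

variable {D : Matrix (Fin N) (Fin N) ℂ}

/-- For b ≠ a' and d ≠ c' neither side sees the metric term of R̂, so only two products of entries
of D occur. -/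
theorem rHat_comm_apply (h : rHat N s * tensorSq D = tensorSq D * rHat N s)
    {a b c d : Fin N} (hb : b ≠ a.rev) (hd : d ≠ c.rev) :
    flipWeight s a b * (D b c * D a d) + ((s : ℂ) ^ 2 - ((s : ℂ) ^ 2)⁻¹) *
        (if a < b then D a c * D b d else 0) =
      flipWeight s d c * (D a d * D b c) + ((s : ℂ) ^ 2 - ((s : ℂ) ^ 2)⁻¹) *
        (if c < d then D a c * D b d else 0) := by
  have h1 := congrFun (congrFun h (a, b)) (c, d)
  rw [Matrix.mul_apply, Matrix.mul_apply] at h1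
  simp only [Fintype.sum_prod_type, rHat_apply, tensorSq, metric_of_ne hb, metric_of_ne hd,
    zero_mul, mul_zero, ite_self, sub_zero, add_mul, mul_add, Finset.sum_add_distrib] at h1
  convert h1 using 1
  · congr 1
    · rw [Finset.sum_eq_single b, Finset.sum_eq_single a]
      · simp
      · intro x _ hx; simp [hx.symm]
      · simp
      · intro x _ hx; simp [hx.symm]
      · simp
    · rw [Finset.sum_eq_single a, Finset.sum_eq_single b]
      · simp
      · intro x _ hx; simp [hx.symm]
      · simp
      · intro x _ hx; simp [hx.symm]
      · simp
  · congr 1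
    · rw [Finset.sum_eq_single d, Finset.sum_eq_single c]
      · simp [mul_comm]
      · intro x _ hx; simp [hx]
      · simp
      · intro x _ hx; simp [hx]
      · simp
    · rw [Finset.sum_eq_single c, Finset.sum_eq_single d]
      · simp [mul_comm]
      · intro x _ hx; simp [hx]
      · simp
      · intro x _ hx; simp [hx]
      · simp

variable (hq : ((s : ℂ) ^ 2) ^ 2 ≠ 1) (h : rHat N s * tensorSq D = tensorSq D * rHat N s)

include hq h

/-- Taking both row indices equal to a turns the RTT relation into (q - 1) D_{ac} D_{ad} = 0. Hence
such a row is supported on a single pair of columns {c, c'}. -/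
theorem mul_apply_eq_zero {a c d : Fin N} (ha : a ≠ a.rev) (hcd : c ≠ d) (hd : d ≠ c.rev) :
    D a c * D a d = 0 := by
  wlog hlt : d < c generalizing c d
  · rw [mul_comm]
    exact this hcd.symm (fun e => hd (rev_eq_comm'.1 e)) (lt_of_le_of_ne (not_lt.1 hlt) hcd)
  have h1 := rHat_comm_apply h ha hd
  have e1 : flipWeight s a a = (s : ℂ) ^ 2 := by simp [flipWeight, ha]
  have e2 : flipWeight s d c = 1 := by
    rw [flipWeight, if_neg hcd.symm, if_neg (fun e => hd (rev_eq_comm'.1 e))]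
  rw [e1, e2, if_neg (lt_irrefl _), if_neg hlt.not_gt] at h1
  have h2 : ((s : ℂ) ^ 2 - 1) * (D a c * D a d) = 0 := by linear_combination h1
  refine (mul_eq_zero.1 h2).resolve_left fun h3 => hq ?_
  linear_combination ((s : ℂ) ^ 2 + 1) * h3

/-- Suppose the first row has a nonzero entry in a column c ≠ 1. For a column d < c with d ≠ c' and
a row b with D_{bd} ≠ 0, the orderings 1 < b and d < c leave (q - q⁻¹) D_{1c} D_{bd} = 0 in the RTT
relation, a contradiction once b is neither 1 nor 1'. -/
theorem apply_first_eq_zero (hN : 2 < N) (hC : D.transpose * metric N s * D = metric N s)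
    {a c : Fin N} (ha : (a : ℕ) = 0) (hc : c ≠ a) : D a c = 0 := by
  by_contra hD
  have hs : (s : ℂ) ≠ 0 := s.ne_zero
  have hra : (a.rev : ℕ) = N - 1 := by rw [Fin.val_rev, ha]
  have haa : a ≠ a.rev := fun e => by
    have := congrArg Fin.val e
    omega
  -- Take the first column, except when c is the last one, whose reverse is the first. Then the
  -- second column works because N > 2.
  obtain ⟨d, hdc, hdr⟩ : ∃ d : Fin N, d < c ∧ d ≠ c.rev := by
    have hc0 : (c : ℕ) ≠ 0 := fun e => hc (Fin.ext (e.trans ha.symm))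
    have hc2 := c.2
    by_cases hcl : (c : ℕ) = N - 1
    · refine ⟨⟨1, by omega⟩, Fin.lt_def.2 (by dsimp only; omega), fun e => ?_⟩
      have := congrArg Fin.val e
      rw [Fin.val_rev] at this
      dsimp only at this
      omega
    · refine ⟨a, Fin.lt_def.2 (by omega), fun e => ?_⟩
      have := congrArg Fin.val e
      rw [Fin.val_rev] at this
      omega
  have hunit : ∃ b, D b d ≠ 0 := by
    by_contra hall
    push Not at hall
    have h1 : metric N s d d.rev = 0 := by
      rw [← hC, Matrix.mul_apply]
      have : ∀ x, (D.transpose * metric N s) d x = 0 := by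
        intro x
        rw [Matrix.mul_apply]
        refine Finset.sum_eq_zero fun y _ => ?_
        rw [Matrix.transpose_apply, hall, zero_mul]
      simp [this]
    rw [metric_rev] at h1
    exact Units.ne_zero _ h1
  obtain ⟨b, hb⟩ := hunit
  have hzero : ∀ e, e ≠ c → e ≠ c.rev → D a e = 0 := by
    intro e h1 h2
    exact (mul_eq_zero.1 (mul_apply_eq_zero hq h haa h1.symm h2)).resolve_left hD
  have hba : b ≠ a := by
    rintro rfl
    exact hb (hzero d hdc.ne hdr)
  -- Otherwise the first row lives on {c, c'} and the last row on {d, d'}. These supports are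
  -- disjoint and stable under reversal, so C pairs the two rows to zero, against orthogonality.
  have hbr : b ≠ a.rev := by
    rintro rfl
    have haa' : a.rev ≠ a.rev.rev := by rw [Fin.rev_rev]; exact haa.symm
    have hz2 : ∀ e, d ≠ e → e ≠ d.rev → D a.rev e = 0 := fun e h1 h2 =>
      (mul_eq_zero.1 (mul_apply_eq_zero hq h haa' h1 h2)).resolve_left hb
    have h1 := metric_mul_apply_rev hC a a.rev
    rw [Finset.sum_eq_zero, metric_rev] at h1
    · exact Units.ne_zero _ h1.symm
    · intro e _
      by_cases h2 : e = c
      · subst h2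
        rw [hz2 _ hdr (fun e' => hdc.ne (Fin.rev_injective e').symm), mul_zero]
      · by_cases h3 : e = c.rev
        · subst h3
          rw [Fin.rev_rev, hz2 _ hdc.ne (fun e' => hdr (rev_eq_comm'.1 e')), mul_zero]
        · rw [hzero e h2 h3, zero_mul, zero_mul]
  have h1 := rHat_comm_apply h hbr hdr
  have e1 : flipWeight s a b = 1 := by rw [flipWeight, if_neg hba.symm, if_neg hbr]
  have e2 : flipWeight s d c = 1 := by
    rw [flipWeight, if_neg hdc.ne, if_neg (fun e => hdr (rev_eq_comm'.1 e))]
  have hab : a < b := Fin.lt_def.2 (by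
    have : (b : ℕ) ≠ a := fun e => hba (Fin.ext e)
    omega)
  rw [e1, e2, if_pos hab, if_neg hdc.not_gt] at h1
  have h2 : ((s : ℂ) ^ 2 - ((s : ℂ) ^ 2)⁻¹) * (D a c * D b d) = 0 := by linear_combination h1
  rcases mul_eq_zero.1 h2 with h3 | h3
  · apply hq
    field_simp at h3
    linear_combination h3
  · exact mul_ne_zero hD hb h3

theorem sq_apply_first (hN : 2 < N) (hC : D.transpose * metric N s * D = metric N s)
    {a : Fin N} (ha : (a : ℕ) = 0) : (D * D) a a = D a a * D a a := by
  rw [Matrix.mul_apply, Finset.sum_eq_single a]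
  · intro c _ hc
    rw [apply_first_eq_zero hq h hN hC ha hc, zero_mul]
  · simp

theorem apply_first_mul_apply_last (hN : 2 < N) (hC : D.transpose * metric N s * D = metric N s)
    {a : Fin N} (ha : (a : ℕ) = 0) : D a a * D a.rev a.rev = 1 := by
  have h1 := metric_mul_apply_rev hC a a.rev
  rw [Finset.sum_eq_single a] at h1
  · have h2 : metric N s a a.rev ≠ 0 := by rw [metric_rev]; exact Units.ne_zero _
    apply mul_left_cancel₀ h2
    linear_combination h1
  · intro c _ hc
    rw [apply_first_eq_zero hq h hN hC ha hc, zero_mul, zero_mul]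
  · simp

end Scalar

/-! ### Complex conjugation of P_A, for |q| = 1 and for real q -/

/-- The complex conjugate of a matrix acting on `ℂ^N ⊗ ℂ^N`, with the tensor factors exchanged. -/
def flipConj (P : Matrix (Fin N × Fin N) (Fin N × Fin N) ℂ) :
    Matrix (Fin N × Fin N) (Fin N × Fin N) ℂ :=
  fun i j => starRingEnd ℂ (P i.swap j.swap)

theorem flipConj_sub (P P' : Matrix (Fin N × Fin N) (Fin N × Fin N) ℂ) :
    flipConj (P - P') = flipConj P - flipConj P' := by
  ext i j; simp [flipConj]

theorem flipConj_add (P P' : Matrix (Fin N × Fin N) (Fin N × Fin N) ℂ) :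
    flipConj (P + P') = flipConj P + flipConj P' := by
  ext i j; simp [flipConj]

theorem flipConj_neg (P : Matrix (Fin N × Fin N) (Fin N × Fin N) ℂ) :
    flipConj (-P) = -flipConj P := by
  ext i j; simp [flipConj]

theorem flipConj_smul (c : ℂ) (P : Matrix (Fin N × Fin N) (Fin N × Fin N) ℂ) :
    flipConj (c • P) = starRingEnd ℂ c • flipConj P := by
  ext i j; simp [flipConj]

theorem flipConj_one : flipConj (1 : Matrix (Fin N × Fin N) (Fin N × Fin N) ℂ) = 1 := by
  ext ⟨a, b⟩ ⟨c, d⟩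
  simp [flipConj, Matrix.one_apply, and_comm, apply_ite (starRingEnd ℂ)]

theorem conj_sum_metric (h : ∀ a b, starRingEnd ℂ (metric N s a b) = metric N s b a) :
    starRingEnd ℂ (∑ e, ∑ f, metric N s e f * metric N s e f) =
      ∑ e, ∑ f, metric N s e f * metric N s e f := by
  simp only [map_sum, map_mul, h]
  rw [Finset.sum_comm]

section Unitary

variable (hs : starRingEnd ℂ (s : ℂ) = (s : ℂ)⁻¹)

include hs

theorem conj_metric_of_unitary (a b : Fin N) :
    starRingEnd ℂ (metric N s a b) = metric N s b a := by
  by_cases h : b = a.rev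
  · subst h
    rw [metric_rev, rev_metric, Units.val_zpow_eq_zpow_val, map_zpow₀, hs, inv_zpow', neg_neg,
      Units.val_zpow_eq_zpow_val]
  · rw [metric_of_ne h, metric_of_ne (fun e => h (rev_eq_comm'.1 e)), map_zero]

theorem conj_q_of_unitary : starRingEnd ℂ ((s : ℂ) ^ 2) = ((s : ℂ) ^ 2)⁻¹ := by
  rw [map_pow, hs, inv_pow]

theorem conj_flipWeight_of_unitary (a b : Fin N) :
    starRingEnd ℂ (flipWeight s a b) = (flipWeight s a b)⁻¹ := by
  have h := conj_q_of_unitary hs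
  unfold flipWeight
  split_ifs
  · simp
  · rw [h]
  · rw [map_inv₀, h]
  · simp

theorem flipConj_metricProj_of_unitary : flipConj (metricProj N s) = metricProj N s := by
  ext ⟨a, b⟩ ⟨c, d⟩
  simp [flipConj, metricProj, conj_metric_of_unitary hs]

/-- For |q| = 1, conjugation inverts q and exchange of the factors reverses the truncations. The
strict truncations a < b and b < a, together with diagonal corrections supplied by `flipWeight_sub`,
add up to the full identity and the full K. -/
theorem flipConj_rHat_of_unitary : flipConj (rHat N s) =
    rHat N s - ((s : ℂ) ^ 2 - ((s : ℂ) ^ 2)⁻¹) • (1 - metricProj N s) := by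
  have hq := conj_q_of_unitary hs
  ext ⟨a, b⟩ ⟨c, d⟩
  have h1 : flipConj (rHat N s) (a, b) (c, d) =
      (if a = d ∧ b = c then (flipWeight s a b)⁻¹ else 0) -
      ((s : ℂ) ^ 2 - ((s : ℂ) ^ 2)⁻¹) * ((if a = c ∧ b = d ∧ b < a then 1 else 0) -
        (if d < a then metric N s a b * metric N s c d else 0)) := by
    have p1 : (b = c ∧ a = d) ↔ (a = d ∧ b = c) := and_comm
    have p2 : (b = d ∧ a = c ∧ b < a) ↔ (a = c ∧ b = d ∧ b < a) := and_left_comm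
    simp only [flipConj, Prod.swap_prod_mk, rHat_apply, map_add, map_mul, map_sub,
      apply_ite (starRingEnd ℂ), map_inv₀, hq, inv_inv, map_one, map_zero,
      conj_metric_of_unitary hs, conj_flipWeight_of_unitary hs, p1, p2]
    rw [flipWeight_comm b a]
    ring
  have h2 : (if a = d ∧ b = c then flipWeight s a b else 0) -
      (if a = d ∧ b = c then (flipWeight s a b)⁻¹ else 0) =
      ((s : ℂ) ^ 2 - ((s : ℂ) ^ 2)⁻¹) * ((if a = d ∧ b = c ∧ a = b then 1 else 0) -
        if a = d ∧ b = c ∧ b = a.rev then 1 else 0) := by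
    rw [← flipWeight_sub]
    by_cases h : a = d ∧ b = c
    · obtain ⟨rfl, rfl⟩ := h
      simp only [true_and, and_self, if_true]
      ring
    · have h4 : ¬ (a = d ∧ b = c ∧ a = b) := fun e => h ⟨e.1, e.2.1⟩
      have h5 : ¬ (a = d ∧ b = c ∧ b = a.rev) := fun e => h ⟨e.1, e.2.1⟩
      rw [if_neg h, if_neg h, if_neg h4, if_neg h5]
      ring
  have h3 : (if a = c ∧ b = d ∧ a < b then (1 : ℂ) else 0) +
      (if a = c ∧ b = d ∧ b < a then 1 else 0) + (if a = d ∧ b = c ∧ a = b then 1 else 0) =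
      if a = c ∧ b = d then 1 else 0 := by
    by_cases h : a = c ∧ b = d
    · obtain ⟨rfl, rfl⟩ := h
      rcases lt_trichotomy a b with h | h | h
      · simp [h, h.not_gt, h.ne]
      · subst h; simp
      · simp [h, h.not_gt, h.ne']
    · have h4 : ¬ (a = c ∧ b = d ∧ a < b) := fun e => h ⟨e.1, e.2.1⟩
      have h5 : ¬ (a = c ∧ b = d ∧ b < a) := fun e => h ⟨e.1, e.2.1⟩
      have h6 : ¬ (a = d ∧ b = c ∧ a = b) := fun e =>
        h ⟨e.2.2.trans e.2.1, e.2.2.symm.trans e.1⟩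
      simp [h, h4, h5, h6]
  have h4 : (if c < b then metric N s a b * metric N s c d else 0) +
      (if d < a then metric N s a b * metric N s c d else 0) +
      (if a = d ∧ b = c ∧ b = a.rev then 1 else 0) = metric N s a b * metric N s c d := by
    by_cases hb : b = a.rev
    · by_cases hd : d = c.rev
      · subst hb hd
        have hiff : c.rev < a ↔ a.rev < c := by
          conv_lhs => rw [← Fin.rev_rev a]
          exact Fin.rev_lt_rev
        simp only [hiff]
        rcases lt_trichotomy c a.rev with h | h | h
        · simp [h, h.not_gt, h.ne']
        · subst h
          rw [Fin.rev_rev]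
          simpa using (metric_mul_swap (s := s) a).symm
        · simp [h, h.not_gt, h.ne]
      · have : ¬ (a = d ∧ b = c ∧ b = a.rev) := by
          rintro ⟨rfl, rfl, h⟩
          exact hd (rev_eq_comm'.1 h)
        simp [metric_of_ne hd, this]
    · simp [metric_of_ne hb, hb]
  rw [h1, Matrix.sub_apply, Matrix.smul_apply, Matrix.sub_apply, rHat_apply, smul_eq_mul,
    Matrix.one_apply, metricProj]
  simp only [Prod.mk.injEq]
  linear_combination (-1 : ℂ) * h2 - ((s : ℂ) ^ 2 - ((s : ℂ) ^ 2)⁻¹) * h3 +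
    ((s : ℂ) ^ 2 - ((s : ℂ) ^ 2)⁻¹) * h4

/-- Conjugating R̂ produces an additional multiple of 1 - K. The part with 1 turns q⁻¹ back into q;
the part with K matches the conjugated coefficient of P_0 by the closed form of C_{ef} C^{ef} in
`mul_sum_metric_metric`. -/
theorem flipConj_projA_of_unitary (hN : 0 < N)
    (hZ : ∑ e, ∑ f, metric N s e f * metric N s e f ≠ 0) :
    flipConj (projA N s) = projA N s := by
  have hq := conj_q_of_unitary hs
  have hsum := mul_sum_metric_metric (N := N) (s := s) hN
  have hc : starRingEnd ℂ (((s : ℂ) ^ 2) ^ (1 - (N : ℤ))) = ((s : ℂ) ^ 2) ^ ((N : ℤ) - 1) := by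
    rw [map_zpow₀, hq, inv_zpow', neg_sub]
  rw [projA, projZero, flipConj_smul, flipConj_sub, flipConj_smul, flipConj_smul, flipConj_add,
    flipConj_neg, flipConj_smul, flipConj_one, flipConj_metricProj_of_unitary hs,
    flipConj_rHat_of_unitary hs]
  simp only [map_inv₀, map_add, map_sub, hq, hc, inv_inv,
    conj_sum_metric (conj_metric_of_unitary hs)]
  rw [add_comm ((s : ℂ) ^ 2)⁻¹]
  congr 1
  generalize (∑ e, ∑ f, metric N s e f * metric N s e f) = Z at hZ hsum
  ext i j
  simp only [Matrix.sub_apply, Matrix.add_apply, Matrix.neg_apply, Matrix.smul_apply, smul_eq_mul]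
  field_simp at hsum ⊢
  linear_combination (-metricProj N s i j) * hsum

end Unitary

section Real

variable (hq : starRingEnd ℂ ((s : ℂ) ^ 2) = (s : ℂ) ^ 2)
  (hm : ∀ a b : Fin N, starRingEnd ℂ (metric N s a b) = metric N s a b)

theorem conj_metric_of_real (hq : starRingEnd ℂ ((s : ℂ) ^ 2) = (s : ℂ) ^ 2)
    (hs : Odd N → starRingEnd ℂ (s : ℂ) = s) (a b : Fin N) :
    starRingEnd ℂ (metric N s a b) = metric N s a b := by
  by_cases h : b = a.rev
  · subst h
    rw [metric_rev, Units.val_zpow_eq_zpow_val, map_zpow₀]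
    -- For even N every 2ρ_a is even, so the metric involves only powers of q. For odd N
    -- half-integral powers occur and q^{1/2} itself must be real.
    rcases Nat.even_or_odd N with hN | hN
    · have h1 : Even (-twoRho a) := by
        rw [Int.even_iff]
        have := Nat.even_iff.1 hN
        unfold twoRho
        split_ifs <;> omega
      obtain ⟨m, hm⟩ := h1
      rw [hm, ← two_mul, zpow_mul, zpow_mul, zpow_ofNat, zpow_ofNat, ← map_pow, hq]
    · rw [hs hN]
  · rw [metric_of_ne h, map_zero]

include hq hm

theorem conj_rHat_of_real (i j : Fin N × Fin N) :
    starRingEnd ℂ (rHat N s i j) = rHat N s i j := by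
  obtain ⟨a, b⟩ := i
  obtain ⟨c, d⟩ := j
  have hw : starRingEnd ℂ (flipWeight s a b) = flipWeight s a b := by
    unfold flipWeight
    simp only [apply_ite (starRingEnd ℂ), map_one, map_inv₀, hq]
  simp only [rHat_apply, map_add, map_mul, map_sub, apply_ite (starRingEnd ℂ), map_inv₀, hq,
    map_one, map_zero, hm, hw]

theorem conj_projA_of_real (i j : Fin N × Fin N) :
    starRingEnd ℂ (projA N s i j) = projA N s i j := by
  simp only [projA, projZero, metricProj, Matrix.smul_apply, Matrix.sub_apply, Matrix.add_apply,
    Matrix.neg_apply, smul_eq_mul, map_mul, map_inv₀, map_add, map_sub, map_neg, map_zpow₀, hq,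
    map_sum, hm, conj_rHat_of_real hq hm, Matrix.one_apply, apply_ite (starRingEnd ℂ), map_one,
    map_zero]

end Real

theorem tensorSq_metric_transpose_apply (a b c d : Fin N) :
    tensorSq (metric N s).transpose (a, b) (c, d) =
      if c = a.rev ∧ d = b.rev then metric N s a.rev a * metric N s b.rev b else 0 := by
  simp only [tensorSq, Matrix.transpose_apply]
  by_cases h1 : c = a.rev
  · by_cases h2 : d = b.rev
    · simp [h1, h2]
    · rw [metric_of_ne (a := d) (fun e => h2 (rev_eq_comm'.1 e))]
      simp [h2]
  · rw [metric_of_ne (a := c) (fun e => h1 (rev_eq_comm'.1 e))]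
    simp [h1]

theorem mul_tensorSq_metric_transpose (P : Matrix (Fin N × Fin N) (Fin N × Fin N) ℂ)
    (a b c d : Fin N) : (P * tensorSq (metric N s).transpose) (a, b) (c, d) =
      P (a, b) (c.rev, d.rev) * (metric N s c c.rev * metric N s d d.rev) := by
  rw [Matrix.mul_apply, Finset.sum_eq_single (c.rev, d.rev)]
  · rw [tensorSq_metric_transpose_apply]
    simp
  · rintro ⟨x, y⟩ _ hxy
    rw [tensorSq_metric_transpose_apply, if_neg, mul_zero]
    rintro ⟨h1, h2⟩
    exact hxy (Prod.ext (rev_eq_comm'.1 h1) (rev_eq_comm'.1 h2))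
  · simp

theorem tensorSq_metric_transpose_mul (P : Matrix (Fin N × Fin N) (Fin N × Fin N) ℂ)
    (a b c d : Fin N) : (tensorSq (metric N s).transpose * P) (a, b) (c, d) =
      metric N s a.rev a * metric N s b.rev b * P (a.rev, b.rev) (c, d) := by
  rw [Matrix.mul_apply, Finset.sum_eq_single (a.rev, b.rev)]
  · rw [tensorSq_metric_transpose_apply]
    simp
  · rintro ⟨x, y⟩ _ hxy
    rw [tensorSq_metric_transpose_apply, if_neg, zero_mul]
    rintro ⟨h1, h2⟩
    exact hxy (Prod.ext h1 h2)
  · simp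

/-- Cᵗ ⊗ Cᵗ intertwines R̂ with its flip: reversing both indices and exchanging them preserves the
weights and the truncations. For real q this is the intertwining relation that ⋆ needs. -/
theorem rHat_metric_flip (a b c d : Fin N) :
    rHat N s (a, b) (c.rev, d.rev) * (metric N s c c.rev * metric N s d d.rev) =
      metric N s a.rev a * metric N s b.rev b * rHat N s (b.rev, a.rev) (d, c) := by
  have hw : flipWeight s b.rev a.rev = flipWeight s a b := by
    rw [flipWeight_rev_left, flipWeight_comm, flipWeight_rev_left, inv_inv]
  have h1 : ∀ x y : Fin N, x.rev = y ↔ x = y.rev := fun x y =>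
    ⟨fun h => by rw [← h, Fin.rev_rev], fun h => by rw [h, Fin.rev_rev]⟩
  rw [rHat_apply, rHat_apply, hw]
  simp only [h1, Fin.rev_lt_rev]
  have e1 : (if a = d.rev ∧ b = c.rev then flipWeight s a b else 0) *
      (metric N s c c.rev * metric N s d d.rev) = metric N s a.rev a * metric N s b.rev b *
      if b = c.rev ∧ a = d.rev then flipWeight s a b else 0 := by
    by_cases h : a = d.rev ∧ b = c.rev
    · obtain ⟨rfl, rfl⟩ := h
      simp only [Fin.rev_rev, and_self, if_true]
      ring
    · rw [if_neg h, if_neg (fun e => h e.symm)]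
      ring
  have e2 : (if a = c.rev ∧ b = d.rev ∧ a < b then (1 : ℂ) else 0) *
      (metric N s c c.rev * metric N s d d.rev) = metric N s a.rev a * metric N s b.rev b *
      if b = d.rev ∧ a = c.rev ∧ a < b then 1 else 0 := by
    by_cases h : a = c.rev ∧ b = d.rev ∧ a < b
    · rw [if_pos h, if_pos ⟨h.2.1, h.1, h.2.2⟩, h.1, h.2.1, Fin.rev_rev, Fin.rev_rev]
      ring
    · rw [if_neg h, if_neg (fun e => h ⟨e.2.1, e.1, e.2.2⟩)]
      ring
  have e3 : (if c.rev < b then metric N s a b * metric N s c.rev d.rev else 0) *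
      (metric N s c c.rev * metric N s d d.rev) = metric N s a.rev a * metric N s b.rev b *
      if d < a.rev then metric N s b.rev a.rev * metric N s d c else 0 := by
    by_cases hb : b = a.rev
    · by_cases hd : d = c.rev
      · subst hb hd
        simp only [Fin.rev_rev]
        split_ifs
        · have h2 := metric_mul_swap (s := s) a
          have h3 := metric_mul_swap (s := s) c
          linear_combination metric N s a a.rev * metric N s c.rev c * (h3 - h2)
        · ring
      · rw [metric_of_ne (a := c.rev) (b := d.rev) (fun e => hd (Fin.rev_injective e)),
          metric_of_ne (a := d) (b := c) (fun e => hd (rev_eq_comm'.1 e))]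
        simp
    · rw [metric_of_ne hb, metric_of_ne (a := b.rev) (b := a.rev)
        (fun e => hb (rev_eq_comm'.1 (Fin.rev_injective e)))]
      simp
  linear_combination e1 + ((s : ℂ) ^ 2 - ((s : ℂ) ^ 2)⁻¹) * (e2 - e3)

theorem metricProj_metric_flip (a b c d : Fin N) :
    metricProj N s (a, b) (c.rev, d.rev) * (metric N s c c.rev * metric N s d d.rev) =
      metric N s a.rev a * metric N s b.rev b * metricProj N s (b.rev, a.rev) (d, c) := by
  simp only [metricProj]
  by_cases hb : b = a.rev
  · by_cases hd : d = c.rev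
    · subst hb hd
      simp only [Fin.rev_rev]
      have h2 := metric_mul_swap (s := s) a
      have h3 := metric_mul_swap (s := s) c
      linear_combination metric N s a a.rev * metric N s c.rev c * (h3 - h2)
    · rw [metric_of_ne (a := c.rev) (b := d.rev) (fun e => hd (Fin.rev_injective e)),
        metric_of_ne (a := d) (b := c) (fun e => hd (rev_eq_comm'.1 e))]
      simp
  · rw [metric_of_ne hb, metric_of_ne (a := b.rev) (b := a.rev)
      (fun e => hb (rev_eq_comm'.1 (Fin.rev_injective e)))]
    simp

theorem projA_mul_tensorSq_metric_of_real (hq : starRingEnd ℂ ((s : ℂ) ^ 2) = (s : ℂ) ^ 2)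
    (hm : ∀ a b : Fin N, starRingEnd ℂ (metric N s a b) = metric N s a b) :
    projA N s * tensorSq (metric N s).transpose =
      tensorSq (metric N s).transpose * flipConj (projA N s) := by
  have h1 : ∀ x y : Fin N, x.rev = y ↔ x = y.rev := fun x y =>
    ⟨fun h => by rw [← h, Fin.rev_rev], fun h => by rw [h, Fin.rev_rev]⟩
  ext ⟨a, b⟩ ⟨c, d⟩
  rw [mul_tensorSq_metric_transpose, tensorSq_metric_transpose_mul, flipConj,
    conj_projA_of_real hq hm]
  simp only [projA, projZero, Matrix.smul_apply, Matrix.sub_apply, Matrix.add_apply,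
    Matrix.neg_apply, smul_eq_mul, Prod.swap_prod_mk]
  have e1 := rHat_metric_flip (s := s) a b c d
  have e2 := metricProj_metric_flip (s := s) a b c d
  have e3 : (1 : Matrix (Fin N × Fin N) (Fin N × Fin N) ℂ) (a, b) (c.rev, d.rev) *
      (metric N s c c.rev * metric N s d d.rev) = metric N s a.rev a * metric N s b.rev b *
      (1 : Matrix (Fin N × Fin N) (Fin N × Fin N) ℂ) (b.rev, a.rev) (d, c) := by
    simp only [Matrix.one_apply, Prod.mk.injEq, h1]
    by_cases h : a = c.rev ∧ b = d.rev
    · rw [if_pos h, if_pos ⟨h.2, h.1⟩, h.1, h.2, Fin.rev_rev, Fin.rev_rev]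
      ring
    · rw [if_neg h, if_neg (fun e => h ⟨e.2, e.1⟩)]
      ring
  linear_combination ((s : ℂ) ^ 2 + ((s : ℂ) ^ 2)⁻¹)⁻¹ * (-e1 + (s : ℂ) ^ 2 * e3 -
    ((s : ℂ) ^ 2 - ((s : ℂ) ^ 2) ^ (1 - (N : ℤ))) *
      (∑ e, ∑ f, metric N s e f * metric N s e f)⁻¹ * e2)

/-! ### Relations with another antisymmetrizer and another metric -/

section Twisted

variable {B : Type*} [Ring B] [Algebra ℂ B]

theorem scalarMat_transpose {m n : Type*} (M : Matrix m n ℂ) :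
    (scalarMat B M).transpose = scalarMat B M.transpose := rfl

theorem scalarMat_eq_map {m n : Type*} (M : Matrix m n ℂ) :
    scalarMat B M = M.map (Algebra.ofId ℂ B) := rfl

theorem tensorSq_scalarMat (M : Matrix (Fin N) (Fin N) ℂ) :
    tensorSq (scalarMat B M) = scalarMat B (tensorSq M) := by
  rw [scalarMat_eq_map, scalarMat_eq_map, map_tensorSq]

theorem tensorPow_scalarMat {n : ℕ} (M : Matrix (Fin N) (Fin N) ℂ) (i j : Fin n → Fin N) :
    tensorPow (scalarMat B M) i j = algebraMap ℂ B (tensorPow M i j) := by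
  rw [scalarMat_eq_map, ← map_tensorPow, Algebra.ofId_apply]

theorem commute_scalarMat (V : Matrix (Fin N) (Fin N) ℂ) (M : Matrix (Fin N) (Fin N) B)
    (a b c d : Fin N) : Commute (scalarMat B V a b) (M c d) :=
  Algebra.commutes _ _

theorem sandwich_apply (V M' : Matrix (Fin N) (Fin N) ℂ) (M : Matrix (Fin N) (Fin N) B)
    (a b : Fin N) : (scalarMat B V * M * scalarMat B M') a b =
      ∑ e, ∑ f, (V a e * M' f b) • M e f := by
  simp only [Matrix.mul_apply, scalarMat, Matrix.map_apply, Finset.sum_mul]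
  rw [Finset.sum_comm]
  refine Finset.sum_congr rfl fun e _ => Finset.sum_congr rfl fun f _ => ?_
  rw [← Algebra.commutes, ← mul_assoc, ← map_mul, ← Algebra.smul_def, mul_comm]

/-- The relations of `SO_q(N)` with other matrices in the place of the antisymmetrizer and of the
metric. -/
structure IsTwistedOrthogonal (P : Matrix (Fin N × Fin N) (Fin N × Fin N) ℂ)
    (G : Matrix (Fin N) (Fin N) ℂ) (M : Matrix (Fin N) (Fin N) B) : Prop where
  comm : scalarMat B P * tensorSq M = tensorSq M * scalarMat B P
  orth_left : M * scalarMat B G * M.transpose = scalarMat B G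
  orth_right : M.transpose * scalarMat B G * M = scalarMat B G
  det : ∀ ε : (Fin N → Fin N) → ℂ, NeighbourFixed P ε → ∀ i,
    ∑ j, tensorPow M i j * algebraMap ℂ B (ε j) = algebraMap ℂ B (ε i)

theorem IsQOrthogonal.isTwistedOrthogonal {M : Matrix (Fin N) (Fin N) B}
    (h : IsQOrthogonal s M) : IsTwistedOrthogonal (projA N s) (metric N s) M where
  comm := h.projA_comm
  orth_left := h.orth_left
  orth_right := h.orth_right
  det ε hε := h.det ε (isQAntisymmetric_iff.2 hε)

variable {P : Matrix (Fin N × Fin N) (Fin N × Fin N) ℂ} {G : Matrix (Fin N) (Fin N) ℂ}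
  {M : Matrix (Fin N) (Fin N) B}

theorem tensorSq_mul_inv {V V' : Matrix (Fin N) (Fin N) ℂ} (h : V * V' = 1) :
    tensorSq V * tensorSq V' = 1 := by
  rw [← tensorSq_mul fun _ _ _ _ => Commute.all _ _, h, tensorSq_one]

theorem comm_inv {P' : Matrix (Fin N × Fin N) (Fin N × Fin N) ℂ}
    {V V' : Matrix (Fin N) (Fin N) ℂ} (h : V * V' = 1)
    (hP : P' * tensorSq V = tensorSq V * P) : P * tensorSq V' = tensorSq V' * P' := by
  have h1 := tensorSq_mul_inv h
  have h2 := tensorSq_mul_inv (mul_eq_one_comm.1 h)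
  calc P * tensorSq V' = tensorSq V' * (tensorSq V * P) * tensorSq V' := by
        rw [← mul_assoc, h2, one_mul]
    _ = tensorSq V' * P' := by rw [← hP, mul_assoc, mul_assoc, h1, mul_one]

/-- Transport of structure along V. Commutation with P becomes commutation with P_A, hence with R̂
once orthogonality is known. For the determinant, V⁻¹ carries an epsilon tensor for P_A to one for
P, which M fixes, and V carries it back. -/
theorem IsTwistedOrthogonal.sandwich (hM : IsTwistedOrthogonal P G M)
    (hq' : (s : ℂ) ^ 2 + ((s : ℂ) ^ 2)⁻¹ ≠ 0) {V V' : Matrix (Fin N) (Fin N) ℂ}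
    (hV : V * V' = 1) (hP : projA N s * tensorSq V = tensorSq V * P)
    (hl : V * G * V.transpose = metric N s) (hr : V.transpose * metric N s * V = G) :
    IsQOrthogonal s (scalarMat B V * M * scalarMat B V') := by
  have hV' := mul_eq_one_comm.1 hV
  have ht1 : V.transpose * V'.transpose = 1 := by
    rw [← Matrix.transpose_mul, hV', Matrix.transpose_one]
  have ht2 : V'.transpose * V.transpose = 1 := by
    rw [← Matrix.transpose_mul, hV, Matrix.transpose_one]
  have hl' : V' * metric N s * V'.transpose = G := by
    rw [← hl]
    calc V' * (V * G * V.transpose) * V'.transpose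
        = (V' * V) * G * (V.transpose * V'.transpose) := by simp only [mul_assoc]
      _ = G := by rw [hV', ht1, one_mul, mul_one]
  have hr' : V'.transpose * G * V' = metric N s := by
    rw [← hr]
    calc V'.transpose * (V.transpose * metric N s * V) * V'
        = (V'.transpose * V.transpose) * metric N s * (V * V') := by simp only [mul_assoc]
      _ = metric N s := by rw [hV, ht2, one_mul, mul_one]
  have hP' := comm_inv hV hP
  have htr : (scalarMat B V * M * scalarMat B V').transpose =
      scalarMat B V'.transpose * M.transpose * scalarMat B V.transpose := by
    rw [transpose_mul_scalarMat, transpose_scalarMat_mul, scalarMat_transpose,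
      scalarMat_transpose, mul_assoc]
  have hc1 := commute_scalarMat V (M * scalarMat B V')
  have hc2 : ∀ a b c d, Commute (M a b) (scalarMat B V' c d) :=
    fun a b c d => (commute_scalarMat V' M c d a b).symm
  have horth_left : scalarMat B V * M * scalarMat B V' * scalarMat B (metric N s) *
      (scalarMat B V * M * scalarMat B V').transpose = scalarMat B (metric N s) := by
    rw [htr]
    calc _ = scalarMat B V * (M * (scalarMat B V' * scalarMat B (metric N s) *
          scalarMat B V'.transpose) * M.transpose) * scalarMat B V.transpose := by
          simp only [mul_assoc]
      _ = _ := by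
          rw [← scalarMat_mul, ← scalarMat_mul, hl', hM.orth_left, ← scalarMat_mul,
            ← scalarMat_mul, hl]
  have horth_right : (scalarMat B V * M * scalarMat B V').transpose * scalarMat B (metric N s) *
      (scalarMat B V * M * scalarMat B V') = scalarMat B (metric N s) := by
    rw [htr]
    calc _ = scalarMat B V'.transpose * (M.transpose * (scalarMat B V.transpose *
          scalarMat B (metric N s) * scalarMat B V) * M) * scalarMat B V' := by
          simp only [mul_assoc]
      _ = _ := by
          rw [← scalarMat_mul, ← scalarMat_mul, hr, hM.orth_right, ← scalarMat_mul,
            ← scalarMat_mul, hr']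
  refine ⟨rtt_iff_rHat_comm.2 (rHat_comm_of_projA_comm hq' ?_
    (metricProj_comm_of_orth horth_left horth_right)), horth_left, horth_right, ?_⟩
  · rw [mul_assoc, tensorSq_mul hc1, tensorSq_mul hc2, tensorSq_scalarMat, tensorSq_scalarMat,
      ← mul_assoc, ← scalarMat_mul, hP, scalarMat_mul, mul_assoc, ← mul_assoc (scalarMat B P),
      hM.comm, mul_assoc (tensorSq M), ← scalarMat_mul, hP', scalarMat_mul]
    simp only [mul_assoc]
  · intro ε hε i
    have hε' : NeighbourFixed P (Matrix.mulVec (tensorPow V') ε) :=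
      (isQAntisymmetric_iff.1 hε).tensorPow hP'
    rw [mul_assoc, tensorPow_mul hc1, tensorPow_mul hc2]
    calc _ = ∑ j, tensorPow (scalarMat B V) i j * ∑ k, tensorPow M j k *
          ∑ l, tensorPow (scalarMat B V') k l * algebraMap ℂ B (ε l) := by
          simp only [Matrix.mul_apply, Finset.sum_mul, Finset.mul_sum, mul_assoc]
          rw [Finset.sum_comm]
          refine Finset.sum_congr rfl fun j _ => ?_
          rw [Finset.sum_comm]
      _ = ∑ j, tensorPow (scalarMat B V) i j * ∑ k, tensorPow M j k *
          algebraMap ℂ B (Matrix.mulVec (tensorPow V') ε k) := by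
          simp only [tensorPow_scalarMat, Matrix.mulVec, dotProduct, map_sum, map_mul]
      _ = algebraMap ℂ B (Matrix.mulVec (tensorPow V)
            (Matrix.mulVec (tensorPow V') ε) i) := by
          simp only [hM.det _ hε', tensorPow_scalarMat]
          simp only [Matrix.mulVec, dotProduct, map_sum, map_mul]
      _ = algebraMap ℂ B (ε i) := by
          rw [Matrix.mulVec_mulVec, ← tensorPow_mul fun _ _ _ _ => Commute.all _ _, hV,
            tensorPow_one, Matrix.one_mulVec]

end Twisted

/-! ### The opposite algebra with the conjugate scalar action -/

/-- The opposite of an algebra, with scalars acting through complex conjugation. -/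
def ConjOp (A : Type*) : Type _ := Aᵐᵒᵖ

namespace ConjOp

section Ring

variable {A : Type*} [Ring A]

instance : Ring (ConjOp A) := inferInstanceAs (Ring Aᵐᵒᵖ)

/-- The identity map, onto the opposite algebra. -/
def op : A ≃+ ConjOp A := MulOpposite.opAddEquiv

theorem op_mul (x y : A) : op (x * y) = op y * op x := rfl

theorem op_one : op (1 : A) = 1 := rfl

theorem op_symm_mul (x y : ConjOp A) : op.symm (x * y) = op.symm y * op.symm x := rfl

end Ring

variable {A : Type*} [Ring A] [Algebra ℂ A]

instance : Algebra ℂ (ConjOp A) :=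
  RingHom.toAlgebra' ((algebraMap ℂ Aᵐᵒᵖ).comp (starRingEnd ℂ)) fun c x =>
    Algebra.commutes (R := ℂ) (A := Aᵐᵒᵖ) (starRingEnd ℂ c) x

theorem algebraMap_eq (c : ℂ) :
    algebraMap ℂ (ConjOp A) c = op (algebraMap ℂ A (starRingEnd ℂ c)) := rfl

theorem smul_op (c : ℂ) (x : A) : c • op x = op (starRingEnd ℂ c • x) := by
  rw [Algebra.smul_def, algebraMap_eq, ← op_mul, Algebra.smul_def, Algebra.commutes]

theorem op_symm_smul (c : ℂ) (x : ConjOp A) :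
    op.symm (c • x) = starRingEnd ℂ c • op.symm x := by
  obtain ⟨y, rfl⟩ := op.surjective x
  rw [smul_op, AddEquiv.symm_apply_apply, AddEquiv.symm_apply_apply]

end ConjOp

/-- The antilinear map attached to an algebra map into the conjugate opposite algebra. -/
def antilinearMap {A B : Type*} [Ring A] [Algebra ℂ A] [Ring B] [Algebra ℂ B]
    (f : A →ₐ[ℂ] ConjOp B) : A →ₛₗ[starRingEnd ℂ] B where
  toFun x := ConjOp.op.symm (f x)
  map_add' x y := by rw [map_add, map_add]
  map_smul' c x := by rw [map_smul, ConjOp.op_symm_smul]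

/-- An antilinear map that is antimultiplicative and unital. -/
structure IsAntiHom {A B : Type*} [Ring A] [Algebra ℂ A] [Ring B] [Algebra ℂ B]
    (f : A →ₛₗ[starRingEnd ℂ] B) : Prop where
  map_mul : ∀ x y, f (x * y) = f y * f x
  map_one : f 1 = 1

theorem isAntiHom_antilinearMap {A B : Type*} [Ring A] [Algebra ℂ A] [Ring B] [Algebra ℂ B]
    (f : A →ₐ[ℂ] ConjOp B) : IsAntiHom (antilinearMap f) where
  map_mul x y := by
    change ConjOp.op.symm (f (x * y)) = _
    rw [map_mul, ConjOp.op_symm_mul]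
    rfl
  map_one := by
    change ConjOp.op.symm (f 1) = 1
    rw [map_one, ← ConjOp.op_one, AddEquiv.symm_apply_apply]

theorem IsAntiHom.map_algebraMap {A B : Type*} [Ring A] [Algebra ℂ A] [Ring B] [Algebra ℂ B]
    {f : A →ₛₗ[starRingEnd ℂ] B} (hf : IsAntiHom f) (c : ℂ) :
    f (algebraMap ℂ A c) = algebraMap ℂ B (starRingEnd ℂ c) := by
  rw [Algebra.algebraMap_eq_smul_one, map_smulₛₗ, hf.map_one, Algebra.algebraMap_eq_smul_one]

section ConjOpRelations

theorem tensorPow_op {A : Type*} [Ring A] {M : Matrix (Fin N) (Fin N) A} {n : ℕ} (i j : Fin n → Fin N) :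
    tensorPow (M.map ConjOp.op) i j =
      ConjOp.op (tensorPow M (fun k => i k.rev) (fun k => j k.rev)) := by
  change (List.ofFn fun k => MulOpposite.op (M (i k) (j k))).prod =
    MulOpposite.op (List.ofFn fun k => M (i k.rev) (j k.rev)).prod
  rw [MulOpposite.op_list_prod, List.map_ofFn]
  congr 1
  refine List.ext_getElem (by simp) fun k h₁ h₂ => ?_
  simp only [List.getElem_ofFn, List.getElem_reverse, Function.comp_apply, List.length_ofFn]
  rw [List.length_ofFn] at h₁
  have hk : (⟨n - 1 - k, by omega⟩ : Fin n).rev = ⟨k, h₁⟩ :=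
    Fin.ext (by rw [Fin.val_rev]; dsimp only; omega)
  rw [hk]

/-- Products in the opposite algebra are read backwards, so epsilon tensors there must be compared
after reversing the order of their indices. This reversal exchanges the two factors on which P acts,
as `flipConj` does. -/
theorem NeighbourFixed.conj_rev {P : Matrix (Fin N × Fin N) (Fin N × Fin N) ℂ} {n : ℕ}
    {ε : (Fin n → Fin N) → ℂ} (hε : NeighbourFixed (flipConj P) ε) :
    NeighbourFixed P fun i => starRingEnd ℂ (ε fun k => i k.rev) := by
  intro k hk i
  -- Reversal sends positions k, k + 1 to n - 1 - k, n - 2 - k, so the reversed pair starts at n - 2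
  -- - k and its entries are swapped.
  have hk' : n - 2 - k + 1 < n := by omega
  have hr1 : Fin.rev (⟨k, by omega⟩ : Fin n) = ⟨n - 2 - k + 1, hk'⟩ :=
    Fin.ext (by rw [Fin.val_rev]; dsimp only; omega)
  have hr2 : Fin.rev (⟨k + 1, hk⟩ : Fin n) = ⟨n - 2 - k, by omega⟩ :=
    Fin.ext (by rw [Fin.val_rev]; dsimp only; omega)
  have hpair : pairAt (fun l => i l.rev) (n - 2 - k) hk' = (pairAt i k hk).swap := by
    rw [pairAt, pairAt, ← hr1, ← hr2, Fin.rev_rev, Fin.rev_rev, Prod.swap_prod_mk]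
  have hupd : ∀ p : Fin N × Fin N, (fun l => updatePair i k hk p l.rev) =
      updatePair (fun l => i l.rev) (n - 2 - k) hk' p.swap := by
    intro p
    funext l
    have h1 : l.rev = ⟨k, by omega⟩ ↔ l = ⟨n - 2 - k + 1, hk'⟩ := by
      rw [← hr1]
      exact ⟨fun h => by rw [← h, Fin.rev_rev], fun h => by rw [h, Fin.rev_rev]⟩
    have h2 : l.rev = ⟨k + 1, hk⟩ ↔ l = ⟨n - 2 - k, by omega⟩ := by
      rw [← hr2]
      exact ⟨fun h => by rw [← h, Fin.rev_rev], fun h => by rw [h, Fin.rev_rev]⟩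
    simp only [updatePair, Function.update_apply, h1, h2, Prod.fst_swap, Prod.snd_swap]
    split_ifs with h3 h4
    · exfalso
      rw [h3] at h4
      have := congrArg Fin.val h4
      dsimp only at this
      omega
    all_goals rfl
  have h := congrArg (starRingEnd ℂ) (hε (n - 2 - k) hk' fun l => i l.rev)
  rw [map_sum] at h
  change ∑ p, P (pairAt i k hk) p * starRingEnd ℂ (ε fun l => updatePair i k hk p l.rev) =
    starRingEnd ℂ (ε fun l => i l.rev)
  rw [← h, ← Equiv.sum_comp (Equiv.prodComm (Fin N) (Fin N))]
  refine Finset.sum_congr rfl fun p _ => ?_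
  rw [map_mul, hpair, flipConj, Prod.swap_swap, Complex.conj_conj, hupd]
  rfl

variable {A : Type*} [Ring A] [Algebra ℂ A] {M : Matrix (Fin N) (Fin N) A}

/-- Each relation is the original one read in the opposite order: reversal of products exchanges the
tensor factors and transposes the metric, while the scalar action conjugates all coefficients. -/
theorem IsQOrthogonal.conjOp (hM : IsQOrthogonal s M) :
    IsTwistedOrthogonal (flipConj (projA N s)) ((metric N s).map (starRingEnd ℂ)).transpose
      (M.map ConjOp.op) where
  comm := by
    ext i j
    have h := congrArg ConjOp.op (congrFun (congrFun hM.projA_comm i.swap) j.swap)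
    simp only [Matrix.mul_apply, map_sum] at h ⊢
    rw [← (Equiv.prodComm (Fin N) (Fin N)).sum_comp,
      ← (Equiv.prodComm (Fin N) (Fin N)).sum_comp (fun x =>
        ConjOp.op (tensorSq M i.swap x * scalarMat A (projA N s) x j.swap))] at h
    have e1 : ∀ k l, scalarMat (ConjOp A) (flipConj (projA N s)) k l =
        ConjOp.op (scalarMat A (projA N s) k.swap l.swap) := by
      intro k l
      rw [scalarMat, Matrix.map_apply, ConjOp.algebraMap_eq, flipConj, Complex.conj_conj]
      rfl
    have e2 : ∀ k l, tensorSq (M.map ConjOp.op) k l = ConjOp.op (tensorSq M k.swap l.swap) :=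
      fun _ _ => rfl
    have e3 : ∀ k l (x : A), ConjOp.op (scalarMat A (projA N s) k l) * ConjOp.op x =
        ConjOp.op (scalarMat A (projA N s) k l * x) := fun k l x => by
      rw [← ConjOp.op_mul]
      exact congrArg _ (Algebra.commutes _ _).symm
    have e4 : ∀ k l (x : A), ConjOp.op x * ConjOp.op (scalarMat A (projA N s) k l) =
        ConjOp.op (x * scalarMat A (projA N s) k l) := fun k l x => by
      rw [← ConjOp.op_mul]
      exact congrArg _ (Algebra.commutes _ _)
    simp only [e1, e2, e3, e4]
    exact h
  orth_left := by
    ext a d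
    have h := congrArg ConjOp.op (congrFun (congrFun hM.orth_left d) a)
    simp only [Matrix.mul_apply, map_sum, Finset.sum_mul, Matrix.transpose_apply, scalarMat,
      Matrix.map_apply, ConjOp.algebraMap_eq, Complex.conj_conj, ConjOp.op_mul] at h ⊢
    rw [Finset.sum_comm, ← h]
    simp only [mul_assoc]
  orth_right := by
    ext a d
    have h := congrArg ConjOp.op (congrFun (congrFun hM.orth_right d) a)
    simp only [Matrix.mul_apply, map_sum, Finset.sum_mul, Matrix.transpose_apply, scalarMat,
      Matrix.map_apply, ConjOp.algebraMap_eq, Complex.conj_conj, ConjOp.op_mul] at h ⊢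
    rw [Finset.sum_comm, ← h]
    simp only [mul_assoc]
  det := by
    intro ε hε i
    have h := congrArg ConjOp.op (hM.det _ (isQAntisymmetric_iff.2 hε.conj_rev)
      fun k => i k.rev)
    simp only [Fin.rev_rev] at h
    rw [ConjOp.algebraMap_eq, ← h, map_sum,
      ← (Equiv.arrowCongr (Fin.revPerm (n := N)) (Equiv.refl (Fin N))).sum_comp]
    refine Finset.sum_congr rfl fun j _ => ?_
    have he : Equiv.arrowCongr (Fin.revPerm (n := N)) (Equiv.refl (Fin N)) j =
        fun k => j k.rev := rfl
    rw [tensorPow_op, ConjOp.algebraMap_eq, ← ConjOp.op_mul, Algebra.commutes]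
    simp only [he, Fin.rev_rev]

end ConjOpRelations

/-! ### Conjugating the generators by complex matrices -/

section Sandwich

variable {A B : Type*} [Ring A] [Algebra ℂ A] [Ring B] [Algebra ℂ B]

theorem map_sandwich (f : A →ₗ[ℂ] B) (V V' : Matrix (Fin N) (Fin N) ℂ)
    (M : Matrix (Fin N) (Fin N) A) :
    (scalarMat A V * M * scalarMat A V').map f = scalarMat B V * M.map f * scalarMat B V' := by
  ext a b
  rw [Matrix.map_apply, sandwich_apply, sandwich_apply]
  simp only [map_sum, map_smul, Matrix.map_apply]

theorem map_sandwich_antilinear (f : A →ₛₗ[starRingEnd ℂ] B) (V V' : Matrix (Fin N) (Fin N) ℂ)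
    (M : Matrix (Fin N) (Fin N) A) :
    (scalarMat A V * M * scalarMat A V').map f =
      scalarMat B (V.map (starRingEnd ℂ)) * M.map f * scalarMat B (V'.map (starRingEnd ℂ)) := by
  ext a b
  rw [Matrix.map_apply, sandwich_apply, sandwich_apply]
  simp only [map_sum, map_smulₛₗ, map_mul, Matrix.map_apply]

theorem sandwich_sandwich (U U' V V' : Matrix (Fin N) (Fin N) ℂ)
    (M : Matrix (Fin N) (Fin N) A) :
    scalarMat A U * (scalarMat A V * M * scalarMat A V') * scalarMat A U' =
      scalarMat A (U * V) * M * scalarMat A (V' * U') := by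
  simp only [scalarMat_mul, mul_assoc]

theorem sandwich_one (M : Matrix (Fin N) (Fin N) A) :
    scalarMat A 1 * M * scalarMat A 1 = M := by
  rw [scalarMat_one, one_mul, mul_one]

end Sandwich

section Tensor

variable {V V' : Matrix (Fin N) (Fin N) ℂ}

theorem genT_map_comul :
    (genT N s).map (Coalgebra.comul (R := ℂ)) = tensorT N s :=
  Matrix.ext comul_genT

theorem genT_map_counit : (genT N s).map (Coalgebra.counit (R := ℂ)) = 1 :=
  Matrix.ext counit_genT

theorem tensorT_eq :
    tensorT N s =
      (genT N s).map (Algebra.TensorProduct.includeLeft : SOq N s →ₐ[ℂ] SOq N s ⊗[ℂ] SOq N s) *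
        (genT N s).map
          (Algebra.TensorProduct.includeRight : SOq N s →ₐ[ℂ] SOq N s ⊗[ℂ] SOq N s) := by
  ext a b
  simp [tensorT, Matrix.mul_apply]

/-- The inner factors V' V cancel between the two legs; therefore T ↦ V T V' respects the coproduct.
-/
theorem sum_sandwich_tmul_sandwich (h : V' * V = 1) (a b : Fin N) :
    ∑ c, (scalarMat (SOq N s) V * genT N s * scalarMat (SOq N s) V') a c ⊗ₜ[ℂ]
        (scalarMat (SOq N s) V * genT N s * scalarMat (SOq N s) V') c b =
      (scalarMat (SOq N s ⊗[ℂ] SOq N s) V * tensorT N s *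
        scalarMat (SOq N s ⊗[ℂ] SOq N s) V') a b := by
  set M := scalarMat (SOq N s) V * genT N s * scalarMat (SOq N s) V' with hM
  have hm : ∀ f : SOq N s →ₐ[ℂ] SOq N s ⊗[ℂ] SOq N s,
      M.map f = scalarMat _ V * (genT N s).map f * scalarMat _ V' := fun f => by
    rw [hM, Matrix.map_mul, Matrix.map_mul, map_scalarMat, map_scalarMat]
  calc _ = (M.map (Algebra.TensorProduct.includeLeft : SOq N s →ₐ[ℂ] SOq N s ⊗[ℂ] SOq N s) *
        M.map (Algebra.TensorProduct.includeRight : SOq N s →ₐ[ℂ] SOq N s ⊗[ℂ] SOq N s)) a b := by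
        simp [Matrix.mul_apply]
    _ = _ := by
        rw [hm, hm, tensorT_eq]
        simp only [mul_assoc]
        rw [← mul_assoc (scalarMat _ V'), ← scalarMat_mul, h, scalarMat_one, one_mul]

theorem sandwich_one_middle {B : Type*} [Ring B] [Algebra ℂ B] (h : V * V' = 1) :
    scalarMat B V * 1 * scalarMat B V' = 1 := by
  rw [mul_one, ← scalarMat_mul, h, scalarMat_one]

end Tensor

/-! ### Automorphisms `T ↦ V T V⁻¹` -/

section Automorphism

variable {V V' : Matrix (Fin N) (Fin N) ℂ}

theorem genT_map_lift {B : Type*} [Ring B] [Algebra ℂ B] (M : Matrix (Fin N) (Fin N) B)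
    (h : IsQOrthogonal s M) : (genT N s).map (SOq.lift M h) = M :=
  Matrix.ext (SOq.lift_genT M h)

theorem exists_bialgEquiv_of_sandwich
    (hO : IsQOrthogonal s (scalarMat (SOq N s) V * genT N s * scalarMat (SOq N s) V'))
    (hV : V * V' = 1)
    (hsq : scalarMat (SOq N s) (V * V) * genT N s * scalarMat (SOq N s) (V' * V') = genT N s) :
    ∃ f : SOq N s ≃ₐc[ℂ] SOq N s,
      (genT N s).map f = scalarMat (SOq N s) V * genT N s * scalarMat (SOq N s) V' ∧
      Function.Involutive f := by
  have hV' := mul_eq_one_comm.1 hV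
  set f := SOq.lift _ hO
  have hT : (genT N s).map f = _ := genT_map_lift _ hO
  have hTL : (genT N s).map f.toLinearMap = _ := hT
  have hTa : ∀ a b, f (genT N s a b) = _ := fun a b => congrFun (congrFun hT a) b
  have hff : f.comp f = AlgHom.id ℂ _ := by
    refine SOq.hom_ext fun a b => ?_
    have h1 : ((genT N s).map f).map f.toLinearMap = genT N s := by
      rw [hT, map_sandwich, hTL, sandwich_sandwich, hsq]
    exact congrFun (congrFun h1 a) b
  have hinv : Function.Involutive f := fun x => AlgHom.congr_fun hff x
  refine ⟨BialgEquiv.ofAlgEquiv (AlgEquiv.ofAlgHom f f hff hff) ?_ ?_, hT, hinv⟩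
  · refine SOq.hom_ext fun a b => ?_
    change Coalgebra.counit (R := ℂ) (f (genT N s a b)) = Coalgebra.counit (R := ℂ) (genT N s a b)
    have h1 : ((genT N s).map f).map (Coalgebra.counit (R := ℂ)) =
        (genT N s).map (Coalgebra.counit (R := ℂ)) := by
      rw [hT, map_sandwich, genT_map_counit, sandwich_one_middle hV]
    exact congrFun (congrFun h1 a) b
  · refine SOq.hom_ext fun a b => ?_
    change Algebra.TensorProduct.map f f (Coalgebra.comul (R := ℂ) (genT N s a b)) =
      Coalgebra.comul (R := ℂ) (f (genT N s a b))
    have h1 : ((genT N s).map f).map (Coalgebra.comul (R := ℂ)) =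
        scalarMat _ V * tensorT N s * scalarMat _ V' := by
      rw [hT, map_sandwich, genT_map_comul]
    have h2 := congrFun (congrFun h1 a) b
    simp only [Matrix.map_apply] at h2
    rw [h2, ← sum_sandwich_tmul_sandwich hV' a b, comul_genT, map_sum]
    simp only [Algebra.TensorProduct.map_tmul, hTa]

/-- Both composites are antimultiplicative, so generators suffice. There the antipode is C Tᵗ C, and
`hl` and `hr`, which are orthogonality of V, move V and V' past C. -/
theorem antipode_comm_of_sandwich (f : SOq N s →ₐ[ℂ] SOq N s)
    (hT : (genT N s).map f = scalarMat (SOq N s) V * genT N s * scalarMat (SOq N s) V')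
    (hl : V * metric N s = metric N s * V'.transpose)
    (hr : metric N s * V' = V.transpose * metric N s) (x : SOq N s) :
    HopfAlgebra.antipode ℂ (f x) = f (HopfAlgebra.antipode ℂ x) := by
  change antipodeLin N s (f x) = f (antipodeLin N s x)
  induction x using SOq.induction with
  | hc c => rw [AlgHom.commutes, antipodeLin_algebraMap, AlgHom.commutes]
  | hadd x y hx hy => rw [map_add, map_add, hx, hy, map_add, map_add]
  | hmul x y hx hy => rw [map_mul, antipodeLin_mul, hx, hy, antipodeLin_mul, map_mul]
  | hT a b =>
    have hTL : (genT N s).map f.toLinearMap = _ := hT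
    have hκ : (genT N s).map (antipodeLin N s) = qInv s (genT N s) :=
      Matrix.ext antipodeLin_genT
    have h1 : ((genT N s).map f).map (antipodeLin N s) =
        ((genT N s).map (antipodeLin N s)).map f.toLinearMap := by
      rw [hκ, hT, map_sandwich, hκ, qInv, map_sandwich, Matrix.transpose_map, hTL,
        transpose_mul_scalarMat, transpose_scalarMat_mul, scalarMat_transpose,
        scalarMat_transpose, sandwich_sandwich, ← mul_assoc (scalarMat (SOq N s) V'.transpose),
        sandwich_sandwich, hl, hr]
    exact congrFun (congrFun h1 a) b

end Automorphism

/-! ### Antilinear antihomomorphisms -/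

section AntiHom

variable {A A' B B' : Type*} [Ring A] [Algebra ℂ A] [Ring B] [Algebra ℂ B]
  [Ring A'] [Algebra ℂ A'] [Ring B'] [Algebra ℂ B']

theorem IsAntiHom.tensor {f : A →ₛₗ[starRingEnd ℂ] B} {g : A' →ₛₗ[starRingEnd ℂ] B'}
    (hf : IsAntiHom f) (hg : IsAntiHom g) : IsAntiHom (TensorProduct.map f g) where
  map_mul x y := by
    induction x using TensorProduct.induction_on with
    | zero => rw [zero_mul, map_zero, mul_zero]
    | add x x' hx hx' => rw [add_mul, map_add, map_add, mul_add, hx, hx']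
    | tmul a b =>
      induction y using TensorProduct.induction_on with
      | zero => rw [mul_zero, map_zero, zero_mul]
      | add y y' hy hy' => rw [mul_add, map_add, map_add, add_mul, hy, hy']
      | tmul c d =>
        rw [Algebra.TensorProduct.tmul_mul_tmul, TensorProduct.map_tmul, hf.map_mul, hg.map_mul,
          TensorProduct.map_tmul, TensorProduct.map_tmul, Algebra.TensorProduct.tmul_mul_tmul]
  map_one := by
    rw [Algebra.TensorProduct.one_def, TensorProduct.map_tmul, hf.map_one, hg.map_one,
      Algebra.TensorProduct.one_def]

theorem IsAntiHom.comp_algHom {f : A →ₛₗ[starRingEnd ℂ] B} (hf : IsAntiHom f)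
    (g : A' →ₐ[ℂ] A) : IsAntiHom (f ∘ₛₗ g.toLinearMap) where
  map_mul x y := by
    change f (g (x * y)) = f (g y) * f (g x)
    rw [_root_.map_mul, hf.map_mul]
  map_one := by
    change f (g 1) = 1
    rw [_root_.map_one, hf.map_one]

theorem IsAntiHom.algHom_comp {f : A →ₛₗ[starRingEnd ℂ] B} (hf : IsAntiHom f)
    (g : B →ₐ[ℂ] B') : IsAntiHom (g.toLinearMap ∘ₛₗ f) where
  map_mul x y := by
    change g (f (x * y)) = g (f y) * g (f x)
    rw [hf.map_mul, _root_.map_mul]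
  map_one := by
    change g (f 1) = 1
    rw [hf.map_one, _root_.map_one]

theorem IsAntiHom.ext {f g : SOq N s →ₛₗ[starRingEnd ℂ] B} (hf : IsAntiHom f)
    (hg : IsAntiHom g) (h : (genT N s).map f = (genT N s).map g) (x : SOq N s) : f x = g x := by
  induction x using SOq.induction with
  | hc c => rw [hf.map_algebraMap, hg.map_algebraMap]
  | hT a b => exact congrFun (congrFun h a) b
  | hadd x y hx hy => rw [map_add, map_add, hx, hy]
  | hmul x y hx hy => rw [hf.map_mul, hg.map_mul, hx, hy]

end AntiHom

section Conjugation

variable {W W' : Matrix (Fin N) (Fin N) ℂ} {f : SOq N s →ₛₗ[starRingEnd ℂ] SOq N s}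

theorem map_conj_mul {M M' K : Matrix (Fin N) (Fin N) ℂ} (h : M * M' = K) :
    M.map (starRingEnd ℂ) * M'.map (starRingEnd ℂ) = K.map (starRingEnd ℂ) := by
  rw [← h, Matrix.map_mul]

theorem map_conj_one :
    (1 : Matrix (Fin N) (Fin N) ℂ).map (starRingEnd ℂ) = 1 :=
  Matrix.map_one _ (map_zero _) (map_one _)

/-- All axioms propagate from the generators. Applying f twice conjugates T by W̄ W, so `hbar` gives
the involution. -/
theorem IsAntiHom.isHopfConjugation (hf : IsAntiHom f)
    (hT : (genT N s).map f = scalarMat (SOq N s) W * genT N s * scalarMat (SOq N s) W')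
    (hW : W * W' = 1) (hbar : W.map (starRingEnd ℂ) * W = 1) : IsHopfConjugation f where
  map_mul := hf.map_mul
  comul x := by
    induction x using SOq.induction with
    | hc c =>
      rw [hf.map_algebraMap, Bialgebra.comul_algebraMap, Bialgebra.comul_algebraMap,
        (hf.tensor hf).map_algebraMap]
    | hadd x y hx hy => rw [map_add, map_add, hx, hy, map_add, map_add]
    | hmul x y hx hy =>
      rw [hf.map_mul, Bialgebra.comul_mul, hx, hy, Bialgebra.comul_mul,
        (hf.tensor hf).map_mul]
    | hT a b =>
      have hTa : ∀ a b, f (genT N s a b) = _ := fun a b => congrFun (congrFun hT a) b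
      have h1 : ((genT N s).map f).map (Coalgebra.comul (R := ℂ)) =
          scalarMat _ W * tensorT N s * scalarMat _ W' := by
        rw [hT, map_sandwich, genT_map_comul]
      have h2 := congrFun (congrFun h1 a) b
      simp only [Matrix.map_apply] at h2
      rw [h2, ← sum_sandwich_tmul_sandwich (mul_eq_one_comm.1 hW) a b, comul_genT, map_sum]
      simp only [TensorProduct.map_tmul, hTa]
  counit x := by
    induction x using SOq.induction with
    | hc c => rw [hf.map_algebraMap, Bialgebra.counit_algebraMap, Bialgebra.counit_algebraMap]
    | hadd x y hx hy => rw [map_add, map_add, hx, hy, map_add, map_add]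
    | hmul x y hx hy =>
      rw [hf.map_mul, Bialgebra.counit_mul, hx, hy, Bialgebra.counit_mul, _root_.map_mul, mul_comm]
    | hT a b =>
      have h1 : ((genT N s).map f).map (Coalgebra.counit (R := ℂ)) = 1 := by
        rw [hT, map_sandwich, genT_map_counit, sandwich_one_middle hW]
      refine (congrFun (congrFun h1 a) b).trans ?_
      rw [counit_genT, Matrix.one_apply]
      split_ifs
      · rw [_root_.map_one]
      · rw [map_zero]
  involutive x := by
    induction x using SOq.induction with
    | hc c => rw [hf.map_algebraMap, hf.map_algebraMap, Complex.conj_conj]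
    | hadd x y hx hy => rw [map_add, map_add, hx, hy]
    | hmul x y hx hy => rw [hf.map_mul, hf.map_mul, hx, hy]
    | hT a b =>
      have hW' : W' = W.map (starRingEnd ℂ) :=
        (left_inv_eq_right_inv hbar hW).symm
      have hc : W' * W'.map (starRingEnd ℂ) = 1 := by
        have : W'.map (starRingEnd ℂ) = W := by
          rw [hW']
          ext a b
          exact Complex.conj_conj _
        rw [this, hW', hbar]
      have h1 : ((genT N s).map f).map f = genT N s := by
        rw [hT, map_sandwich_antilinear, hT, sandwich_sandwich, hbar, hc, sandwich_one]
      exact congrFun (congrFun h1 a) b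

/-- For involutions f and g, the composite g f is an involution exactly when f and g commute; the
other axioms of a conjugation hold for g f in any case. -/
theorem isHopfConjugation_comp_iff (hf : IsHopfConjugation f)
    (g : SOq N s ≃ₐc[ℂ] SOq N s) (hg : Function.Involutive g) :
    IsHopfConjugation ((g : SOq N s →ₗ[ℂ] SOq N s) ∘ₛₗ f) ↔ ∀ x, g (f x) = f (g x) := by
  constructor
  · intro h x
    have h1 : g (f (g (f x))) = x := h.involutive x
    have h2 : f (g (f x)) = g x := by rw [← hg (f (g (f x))), h1]
    rw [← h2, hf.involutive]
  · intro h
    refine ⟨fun x y => ?_, fun x => ?_, fun x => ?_, fun x => ?_⟩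
    · change g (f (x * y)) = g (f y) * g (f x)
      rw [hf.map_mul, map_mul]
    · change Coalgebra.comul (R := ℂ) (g (f x)) = _
      rw [← CoalgHomClass.map_comp_comul_apply, hf.comul]
      generalize Coalgebra.comul (R := ℂ) x = t
      induction t using TensorProduct.induction_on with
      | zero => simp only [map_zero]
      | add t t' ht ht' => simp only [map_add, ht, ht']
      | tmul a b => rfl
    · change Coalgebra.counit (R := ℂ) (g (f x)) = _
      rw [CoalgHomClass.counit_comp_apply, hf.counit]
    · change g (f (g (f x))) = x
      rw [← h, hf.involutive, hg]

end Conjugation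

/-- Lift T to V T V⁻¹ in the conjugate opposite algebra. Read back in SO_q(N), the scalars act
through their conjugates, whence V̄ in the formula. -/
theorem exists_isAntiHom (hq' : (s : ℂ) ^ 2 + ((s : ℂ) ^ 2)⁻¹ ≠ 0)
    {V V' : Matrix (Fin N) (Fin N) ℂ} (hV : V * V' = 1)
    (hP : projA N s * tensorSq V = tensorSq V * flipConj (projA N s))
    (hl : V * ((metric N s).map (starRingEnd ℂ)).transpose * V.transpose = metric N s)
    (hr : V.transpose * metric N s * V = ((metric N s).map (starRingEnd ℂ)).transpose) :
    ∃ f : SOq N s →ₛₗ[starRingEnd ℂ] SOq N s, IsAntiHom f ∧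
      (genT N s).map f = scalarMat (SOq N s) (V.map (starRingEnd ℂ)) * genT N s *
        scalarMat (SOq N s) (V'.map (starRingEnd ℂ)) := by
  have hO := (isQOrthogonal_genT N s).conjOp.sandwich hq' hV hP hl hr
  refine ⟨antilinearMap (SOq.lift _ hO), isAntiHom_antilinearMap _, ?_⟩
  ext a b
  change ConjOp.op.symm (SOq.lift _ hO (genT N s a b)) = _
  rw [SOq.lift_genT, sandwich_apply, sandwich_apply]
  simp only [map_sum, ConjOp.op_symm_smul, map_mul, Matrix.map_apply, AddEquiv.symm_apply_apply]

/-! ### When an automorphism commutes with a conjugation -/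

section Commutation

variable {D D' W W' : Matrix (Fin N) (Fin N) ℂ} {f : SOq N s →ₛₗ[starRingEnd ℂ] SOq N s}
  {g : SOq N s →ₐ[ℂ] SOq N s}

theorem comm_iff_sandwich
    (hg : (genT N s).map g = scalarMat (SOq N s) D * genT N s * scalarMat (SOq N s) D')
    (hf : IsAntiHom f)
    (hT : (genT N s).map f = scalarMat (SOq N s) W * genT N s * scalarMat (SOq N s) W') :
    (∀ x, g (f x) = f (g x)) ↔
      scalarMat (SOq N s) (W * D) * genT N s * scalarMat (SOq N s) (D' * W') =
        scalarMat (SOq N s) (D.map (starRingEnd ℂ) * W) * genT N s *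
          scalarMat (SOq N s) (W' * D'.map (starRingEnd ℂ)) := by
  have h1 : (genT N s).map (g.toLinearMap ∘ₛₗ f) =
      scalarMat (SOq N s) (W * D) * genT N s * scalarMat (SOq N s) (D' * W') := by
    have hg' : (genT N s).map g.toLinearMap = _ := hg
    rw [← sandwich_sandwich, ← hg', ← map_sandwich, ← hT]
    rfl
  have h2 : (genT N s).map (f ∘ₛₗ g.toLinearMap) =
      scalarMat (SOq N s) (D.map (starRingEnd ℂ) * W) * genT N s *
          scalarMat (SOq N s) (W' * D'.map (starRingEnd ℂ)) := by
    rw [← sandwich_sandwich, ← hT, ← map_sandwich_antilinear, ← hg]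
    rfl
  rw [← h1, ← h2]
  exact ⟨fun h => Matrix.ext fun a b => h _,
    fun h x => (hf.algHom_comp g).ext (hf.comp_algHom g) h x⟩

/-- Commutation says that D and W⁻¹ D̄ W differ by a matrix X commuting with T, hence scalar up to
fixing its end entries. The hypothesis `hdiag` reads these off from the first and last diagonal
entries. Conversely a nonzero scalar factor cancels between V and V⁻¹. -/
theorem comm_iff (hq : ((s : ℂ) ^ 2) ^ 2 ≠ 1) (hq' : (s : ℂ) ^ 2 + ((s : ℂ) ^ 2)⁻¹ ≠ 0)
    (hZ : ∑ e, ∑ f, metric N s e f * metric N s e f ≠ 0)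
    (hg : (genT N s).map g = scalarMat (SOq N s) D * genT N s * scalarMat (SOq N s) D')
    (hf : IsAntiHom f)
    (hT : (genT N s).map f = scalarMat (SOq N s) W * genT N s * scalarMat (SOq N s) W')
    (hD : D * D' = 1) (hW : W * W' = 1) {x : ℂ} (hx : x ≠ 0)
    (hdiag : ∀ a : Fin N, ((a : ℕ) = 0 ∨ (a : ℕ) + 1 = N) → D a a ≠ 0 ∧
      (W' * D.map (starRingEnd ℂ) * W) a a = x * D a a) :
    (∀ y, g (f y) = f (g y)) ↔ W' * D.map (starRingEnd ℂ) * W = x • D := by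
  have hD' := mul_eq_one_comm.1 hD
  have hW' := mul_eq_one_comm.1 hW
  have hDb : D.map (starRingEnd ℂ) * D'.map (starRingEnd ℂ) = 1 := by
    rw [map_conj_mul hD, map_conj_one]
  have hDb' := mul_eq_one_comm.1 hDb
  rw [comm_iff_sandwich hg hf hT]
  constructor
  · intro h
    set X := D' * W' * D.map (starRingEnd ℂ) * W with hXdef
    have hX : scalarMat (SOq N s) X * genT N s = genT N s * scalarMat (SOq N s) X := by
      have h1 := congrArg (fun M => scalarMat (SOq N s) (D' * W') * M *
        scalarMat (SOq N s) (D.map (starRingEnd ℂ) * W)) h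
      rw [sandwich_sandwich, sandwich_sandwich] at h1
      have e1 : D' * W' * (W * D) = 1 := by
        rw [mul_assoc, ← mul_assoc W', hW', one_mul, hD']
      have e2 : W' * D'.map (starRingEnd ℂ) * (D.map (starRingEnd ℂ) * W) = 1 := by
        rw [mul_assoc, ← mul_assoc (D'.map _), hDb', one_mul, hW']
      have e3 : D' * W' * (D.map (starRingEnd ℂ) * W) = X := by rw [hXdef]; simp only [mul_assoc]
      rw [e1, e2, e3, scalarMat_one, one_mul, mul_one] at h1
      exact h1.symm
    have hDX : D * X = W' * D.map (starRingEnd ℂ) * W := by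
      rw [hXdef]
      simp only [← mul_assoc]
      rw [hD, one_mul]
    -- X is already diagonal, so the diagonal entry of D X is D_{aa} X_{aa}, and D_{aa} ≠ 0 can be
    -- cancelled.
    have hXa : ∀ a : Fin N, ((a : ℕ) = 0 ∨ (a : ℕ) + 1 = N) → X a a = x := by
      intro a ha
      obtain ⟨h1, h2⟩ := hdiag a ha
      rw [← hDX, Matrix.mul_apply, Finset.sum_eq_single a] at h2
      · exact mul_left_cancel₀ h1 (by rw [h2, mul_comm])
      · intro c _ hc
        rw [off_diagonal_eq_zero_of_commute hq hq' hZ hX hc, mul_zero]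
      · exact fun h => absurd (Finset.mem_univ a) h
    rw [← hDX, eq_smul_one_of_commute hq hq' hZ hX (fun a ha => hXa a (.inl ha))
      (fun a ha => hXa a (.inr ha)), mul_smul_comm, mul_one]
  · intro h
    have e1 : D.map (starRingEnd ℂ) * W = x • (W * D) := by
      rw [← mul_smul_comm, ← h]
      simp only [← mul_assoc]
      rw [hW, one_mul]
    have e2 : W' * D'.map (starRingEnd ℂ) = x⁻¹ • (D' * W') := by
      have h1 : (W' * D'.map (starRingEnd ℂ)) * (D.map (starRingEnd ℂ) * W) = 1 := by
        rw [mul_assoc, ← mul_assoc (D'.map _), hDb', one_mul, hW']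
      have h2 : (D.map (starRingEnd ℂ) * W) * (x⁻¹ • (D' * W')) = 1 := by
        rw [e1, smul_mul_smul_comm, mul_inv_cancel₀ hx, one_smul, mul_assoc, ← mul_assoc D, hD,
          one_mul, hW]
      exact left_inv_eq_right_inv h1 h2
    rw [e1, e2, scalarMat_smul, scalarMat_smul, smul_mul_assoc, smul_mul_smul_comm,
      mul_inv_cancel₀ hx, one_smul]

end Commutation

/-! ### Conjugations of the quantum plane -/

theorem QPlane.induction {P : QPlane N s → Prop} (hc : ∀ c : ℂ, P (algebraMap ℂ _ c))
    (hx : ∀ a, P (coord N s a)) (hadd : ∀ x y, P x → P y → P (x + y))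
    (hmul : ∀ x y, P x → P y → P (x * y)) (x : QPlane N s) : P x := by
  obtain ⟨y, rfl⟩ := RingQuot.mkAlgHom_surjective ℂ (PlaneRel N s) x
  induction y using FreeAlgebra.induction with
  | grade0 c => rw [AlgHom.commutes]; exact hc c
  | grade1 a => exact hx a
  | mul a b ha hb => rw [map_mul]; exact hmul _ _ ha hb
  | add a b ha hb => rw [map_add]; exact hadd _ _ ha hb

theorem scalarMat_mulVec_apply {B : Type*} [Ring B] [Algebra ℂ B]
    (V : Matrix (Fin N) (Fin N) ℂ) (v : Fin N → B) (a : Fin N) :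
    (scalarMat B V).mulVec v a = ∑ b, V a b • v b := by
  simp only [Matrix.mulVec, dotProduct, scalarMat, Matrix.map_apply, Algebra.smul_def]

theorem sum_flipConj_projA_mul {V : Matrix (Fin N) (Fin N) ℂ}
    (hP : flipConj (projA N s) * tensorSq V = tensorSq V * projA N s) (i : Fin N × Fin N) :
    ∑ j : Fin N × Fin N, flipConj (projA N s) i j •
      ((∑ b, V j.1 b • coord N s b) * ∑ b, V j.2 b • coord N s b) = 0 := by
  have h1 : ∀ j : Fin N × Fin N, (∑ b, V j.1 b • coord N s b) * (∑ b, V j.2 b • coord N s b) =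
      ∑ k : Fin N × Fin N, tensorSq V j k • (coord N s k.1 * coord N s k.2) := by
    intro j
    rw [Fintype.sum_prod_type, Finset.sum_mul_sum]
    simp only [smul_mul_smul_comm, tensorSq]
  calc _ = ∑ k : Fin N × Fin N, (flipConj (projA N s) * tensorSq V) i k •
        (coord N s k.1 * coord N s k.2) := by
        simp only [h1, Finset.smul_sum, smul_smul, Matrix.mul_apply, Finset.sum_smul]
        exact Finset.sum_comm
    _ = ∑ j : Fin N × Fin N, tensorSq V i j • ∑ k : Fin N × Fin N,
        algebraMap ℂ (QPlane N s) (projA N s j k) * (coord N s k.1 * coord N s k.2) := by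
        rw [hP]
        simp only [← Algebra.smul_def, Finset.smul_sum, smul_smul, Matrix.mul_apply,
          Finset.sum_smul]
        exact Finset.sum_comm
    _ = 0 := by simp only [sum_projA_coord, smul_zero, Finset.sum_const_zero]

/-- In the conjugate opposite algebra the plane relations for V x involve the flipped conjugate of
P_A, and `hP` carries them back to the original relations for x. -/
theorem exists_isAntiHom_plane {V : Matrix (Fin N) (Fin N) ℂ}
    (hP : flipConj (projA N s) * tensorSq V = tensorSq V * projA N s) :
    ∃ g : QPlane N s →ₛₗ[starRingEnd ℂ] QPlane N s, IsAntiHom g ∧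
      ∀ a, g (coord N s a) = ∑ b, V a b • coord N s b := by
  refine ⟨antilinearMap (QPlane.lift (fun a => ConjOp.op (∑ b, V a b • coord N s b)) ?_),
    isAntiHom_antilinearMap _, fun a => ?_⟩
  · intro i
    have h := congrArg ConjOp.op (sum_flipConj_projA_mul hP i.swap)
    rw [map_zero, map_sum, ← (Equiv.prodComm (Fin N) (Fin N)).sum_comp] at h
    rw [← h]
    refine Finset.sum_congr rfl fun j _ => ?_
    rw [← Algebra.smul_def, ← ConjOp.op_mul, ConjOp.smul_op]
    rfl
  · change ConjOp.op.symm (QPlane.lift _ _ (coord N s a)) = _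
    rw [QPlane.lift_coord, AddEquiv.symm_apply_apply]

theorem coaction_sum_smul_coord {V V' : Matrix (Fin N) (Fin N) ℂ} (h : V' * V = 1) (a : Fin N) :
    coaction N s (∑ b, V a b • coord N s b) =
      ∑ c, (scalarMat (SOq N s) V * genT N s * scalarMat (SOq N s) V') a c ⊗ₜ[ℂ]
        ∑ b, V c b • coord N s b := by
  set L : SOq N s →ₐ[ℂ] SOq N s ⊗[ℂ] QPlane N s := Algebra.TensorProduct.includeLeft
  set x : Fin N → SOq N s ⊗[ℂ] QPlane N s := fun a => 1 ⊗ₜ coord N s a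
  have hm : (scalarMat (SOq N s) V * genT N s * scalarMat (SOq N s) V').map L =
      scalarMat _ V * (genT N s).map L * scalarMat _ V' := by
    rw [Matrix.map_mul, Matrix.map_mul, map_scalarMat, map_scalarMat]
  have hx : ∀ (M : Matrix (Fin N) (Fin N) (SOq N s)) (y : Fin N → QPlane N s) (a : Fin N),
      ∑ c, M a c ⊗ₜ[ℂ] y c = (M.map L).mulVec (fun c => 1 ⊗ₜ y c) a := by
    intro M y a
    simp [Matrix.mulVec, dotProduct, L]
  have hy : (fun c => (1 : SOq N s) ⊗ₜ[ℂ] ∑ b, V c b • coord N s b) =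
      (scalarMat _ V).mulVec x := by
    funext c
    rw [scalarMat_mulVec_apply]
    simp only [TensorProduct.tmul_sum, TensorProduct.tmul_smul, x]
  rw [hx, hy, hm, Matrix.mulVec_mulVec, mul_assoc, ← scalarMat_mul, h, scalarMat_one, mul_one,
    ← Matrix.mulVec_mulVec, scalarMat_mulVec_apply, map_sum]
  simp only [map_smul, coaction_coord]
  refine Finset.sum_congr rfl fun b _ => ?_
  rw [hx]

theorem IsAntiHom.isAlgConjugation {g : QPlane N s →ₛₗ[starRingEnd ℂ] QPlane N s}
    (hg : IsAntiHom g) {V : Matrix (Fin N) (Fin N) ℂ}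
    (hx : ∀ a, g (coord N s a) = ∑ b, V a b • coord N s b)
    (hV : V.map (starRingEnd ℂ) * V = 1) : IsAlgConjugation g where
  map_mul := hg.map_mul
  involutive x := by
    induction x using QPlane.induction with
    | hc c => rw [hg.map_algebraMap, hg.map_algebraMap, Complex.conj_conj]
    | hadd x y hx hy => rw [map_add, map_add, hx, hy]
    | hmul x y hx hy => rw [hg.map_mul, hg.map_mul, hx, hy]
    | hx a =>
      have h1 : g (g (coord N s a)) =
          (scalarMat _ (V.map (starRingEnd ℂ))).mulVec ((scalarMat _ V).mulVec (coord N s)) a := by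
        rw [hx, map_sum, scalarMat_mulVec_apply]
        simp only [map_smulₛₗ, hx, scalarMat_mulVec_apply, Matrix.map_apply]
      rw [h1, Matrix.mulVec_mulVec, ← scalarMat_mul, hV, scalarMat_one, Matrix.one_mulVec]

/-- The image of V x under the coaction is V T ⊗ x = (V T V⁻¹) ⊗ (V x), so the same V must govern
both conjugations. -/
theorem coactionCompatible_of_sandwich {f : SOq N s →ₛₗ[starRingEnd ℂ] SOq N s}
    {g : QPlane N s →ₛₗ[starRingEnd ℂ] QPlane N s} {V V' : Matrix (Fin N) (Fin N) ℂ}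
    (hf : IsAntiHom f) (hg : IsAntiHom g)
    (hT : (genT N s).map f = scalarMat (SOq N s) V * genT N s * scalarMat (SOq N s) V')
    (hx : ∀ a, g (coord N s a) = ∑ b, V a b • coord N s b) (hV : V' * V = 1) :
    CoactionCompatible f g := by
  intro x
  induction x using QPlane.induction with
  | hc c =>
    rw [hg.map_algebraMap, AlgHom.commutes, AlgHom.commutes, (hf.tensor hg).map_algebraMap]
  | hadd x y hx hy => rw [map_add, map_add, hx, hy, map_add, map_add]
  | hmul x y hx hy =>
    rw [hg.map_mul, map_mul, hx, hy, map_mul, (hf.tensor hg).map_mul]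
  | hx a =>
    have hTa : ∀ a b, f (genT N s a b) = _ := fun a b => congrFun (congrFun hT a) b
    rw [hx, coaction_sum_smul_coord hV, coaction_coord, map_sum]
    simp only [TensorProduct.map_tmul, hTa, hx]

theorem exists_plane_conjugation {f : SOq N s →ₛₗ[starRingEnd ℂ] SOq N s} (hf : IsAntiHom f)
    {V V' : Matrix (Fin N) (Fin N) ℂ}
    (hT : (genT N s).map f = scalarMat (SOq N s) V * genT N s * scalarMat (SOq N s) V')
    (hV : V' * V = 1) (hbar : V.map (starRingEnd ℂ) * V = 1)
    (hP : flipConj (projA N s) * tensorSq V = tensorSq V * projA N s) :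
    ∃ g : QPlane N s →ₛₗ[starRingEnd ℂ] QPlane N s, IsAlgConjugation g ∧
      (∀ a, g (coord N s a) = ∑ b, V a b • coord N s b) ∧ CoactionCompatible f g := by
  obtain ⟨g, hg, hx⟩ := exists_isAntiHom_plane hP
  exact ⟨g, hg.isAlgConjugation hx hbar, hx, coactionCompatible_of_sandwich hf hg hT hx hV⟩

/-! ### The sign of D and its end entries -/

theorem conj_eq_mul_of_sq {z x : ℂ} (hx : x = 1 ∨ x = -1) (hz : z * z = x) :
    starRingEnd ℂ z = x * z := by
  rcases hx with rfl | rfl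
  · rcases mul_self_eq_one_iff.1 hz with rfl | rfl <;> simp
  · rcases mul_self_eq_mul_self_iff.1 (hz.trans Complex.I_mul_I.symm) with rfl | rfl <;> simp

theorem metric_transpose_mul_metric_transpose (N : ℕ) (s : ℂˣ) :
    (metric N s).transpose * (metric N s).transpose = 1 := by
  rw [← Matrix.transpose_mul, metric_mul_metric, Matrix.transpose_one]

theorem metric_transpose_sandwich_apply_self (M : Matrix (Fin N) (Fin N) ℂ) (a : Fin N) :
    ((metric N s).transpose * M * (metric N s).transpose) a a = M a.rev a.rev := by
  rw [Matrix.mul_apply, Finset.sum_eq_single a.rev]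
  · rw [Matrix.mul_apply, Finset.sum_eq_single a.rev]
    · have h := metric_mul_swap (s := s) a
      simp only [Matrix.transpose_apply]
      linear_combination M a.rev a.rev * h
    · intro c _ hc
      rw [Matrix.transpose_apply, metric_of_ne (fun e => hc (rev_eq_comm'.1 e)), zero_mul]
    · simp
  · intro c _ hc
    rw [Matrix.transpose_apply, metric_of_ne hc, mul_zero]
  · simp

theorem one_ne_neg_one (hN : 0 < N) : (1 : Matrix (Fin N) (Fin N) ℂ) ≠ -1 := by
  intro h
  have := congrFun (congrFun h ⟨0, hN⟩) ⟨0, hN⟩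
  simp only [Matrix.one_apply_eq, Matrix.neg_apply] at this
  norm_num at this

/-- A matrix that satisfies the numerical `RTT` and orthogonality relations and whose square is the
sign `x`. -/
structure IsOrthogonalRoot (s : ℂˣ) (D : Matrix (Fin N) (Fin N) ℂ) (x : ℂ) : Prop where
  rHat_comm : rHat N s * tensorSq D = tensorSq D * rHat N s
  orth : D.transpose * metric N s * D = metric N s
  sq : D * D = x • 1
  sign : x = 1 ∨ x = -1

namespace IsOrthogonalRoot

variable {D : Matrix (Fin N) (Fin N) ℂ} {x : ℂ} (h : IsOrthogonalRoot s D x)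

include h

theorem sign_mul_sign : x * x = 1 := by
  rcases h.sign with rfl | rfl <;> norm_num

theorem sign_ne_zero : x ≠ 0 := left_ne_zero_of_mul_eq_one h.sign_mul_sign

theorem inv_eq : D⁻¹ = x • D := by
  refine Matrix.inv_eq_right_inv ?_
  rw [mul_smul_comm, h.sq, smul_smul, h.sign_mul_sign, one_smul]

theorem mul_inv : D * D⁻¹ = 1 := by
  rw [h.inv_eq, mul_smul_comm, h.sq, smul_smul, h.sign_mul_sign, one_smul]

theorem inv_mul : D⁻¹ * D = 1 := mul_eq_one_comm.1 h.mul_inv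

theorem orth' : D * metric N s * D.transpose = metric N s := mul_metric_mul_transpose h.orth

theorem projA_comm : projA N s * tensorSq D = tensorSq D * projA N s := by
  have h1 := projA_comm_of_rHat_comm (B := ℂ) (s := s) (M := D)
    (by rw [scalarMat_self, h.rHat_comm])
    (metricProj_comm_of_orth (by rw [scalarMat_self, h.orth'])
      (by rw [scalarMat_self, h.orth]))
  rwa [scalarMat_self] at h1

theorem exists_sharp (hq' : (s : ℂ) ^ 2 + ((s : ℂ) ^ 2)⁻¹ ≠ 0) :
    ∃ f : SOq N s ≃ₐc[ℂ] SOq N s,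
      (genT N s).map f = scalarMat (SOq N s) D * genT N s * scalarMat (SOq N s) D⁻¹ ∧
      Function.Involutive f ∧
      ∀ y, HopfAlgebra.antipode ℂ (f y) = f (HopfAlgebra.antipode ℂ y) := by
  have hO := (isQOrthogonal_genT N s).isTwistedOrthogonal.sandwich hq' h.mul_inv h.projA_comm
    h.orth' h.orth
  obtain ⟨f, hf, hinv⟩ := exists_bialgEquiv_of_sandwich hO h.mul_inv (by
    rw [h.inv_eq, smul_mul_smul_comm, h.sign_mul_sign, one_smul, h.sq, scalarMat_smul,
      scalarMat_one, smul_mul_assoc, smul_mul_smul_comm, one_mul, mul_one, h.sign_mul_sign,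
      one_smul])
  refine ⟨f, hf, hinv, antipode_comm_of_sandwich (f : SOq N s →ₐ[ℂ] SOq N s) hf ?_ ?_⟩
  · have ht : D.transpose * D⁻¹.transpose = 1 := by
      rw [← Matrix.transpose_mul, h.inv_mul, Matrix.transpose_one]
    calc D * metric N s = D * metric N s * (D.transpose * D⁻¹.transpose) := by rw [ht, mul_one]
      _ = metric N s * D⁻¹.transpose := by rw [← mul_assoc, h.orth']
  · calc metric N s * D⁻¹ = D.transpose * metric N s * D * D⁻¹ := by rw [h.orth]
      _ = D.transpose * metric N s := by rw [mul_assoc, h.mul_inv, mul_one]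

section Diagonal

variable (hq : ((s : ℂ) ^ 2) ^ 2 ≠ 1) (hN : 2 < N)

include hq hN

theorem apply_mul_apply_rev {a : Fin N} (ha : (a : ℕ) = 0 ∨ (a : ℕ) + 1 = N) :
    D a a * D a.rev a.rev = 1 := by
  rcases ha with ha | ha
  · exact apply_first_mul_apply_last hq h.rHat_comm hN h.orth ha
  · have h1 := apply_first_mul_apply_last hq h.rHat_comm hN h.orth (a := a.rev)
      (by rw [Fin.val_rev]; omega)
    rwa [Fin.rev_rev, mul_comm] at h1

theorem apply_mul_apply_self {a : Fin N} (ha : (a : ℕ) = 0 ∨ (a : ℕ) + 1 = N) :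
    D a a * D a a = x := by
  have hfirst : ∀ b : Fin N, (b : ℕ) = 0 → D b b * D b b = x := by
    intro b hb
    rw [← sq_apply_first hq h.rHat_comm hN h.orth hb, h.sq, Matrix.smul_apply,
      Matrix.one_apply_eq, smul_eq_mul, mul_one]
  rcases ha with ha | ha
  · exact hfirst a ha
  -- The last diagonal entry is the inverse of the first, so its square is x⁻¹ = x.
  · have h1 := hfirst a.rev (by rw [Fin.val_rev]; omega)
    have h2 := h.apply_mul_apply_rev hq hN (.inr ha)
    have h3 := h.sign_mul_sign
    linear_combination -(D a a * D a a) * h3 - x * (D a a * D a a) * h1 +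
      x * (D a a * D a.rev a.rev + 1) * h2

/-- The end entries are ±1 or ±i according to the sign x. This pins the scalar between D̄ and D to x
in the case of ×. -/
theorem conj_apply {a : Fin N} (ha : (a : ℕ) = 0 ∨ (a : ℕ) + 1 = N) :
    starRingEnd ℂ (D a a) = x * D a a :=
  conj_eq_mul_of_sq h.sign (h.apply_mul_apply_self hq hN ha)

/-- Conjugation by Cᵗ exchanges the two end entries, which are inverse to each other and of modulus
one. So the scalar for ⋆ is 1, whatever the sign of D². -/
theorem conj_apply_rev {a : Fin N} (ha : (a : ℕ) = 0 ∨ (a : ℕ) + 1 = N) :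
    starRingEnd ℂ (D a.rev a.rev) = D a a := by
  have ha' : (a.rev : ℕ) = 0 ∨ (a.rev : ℕ) + 1 = N := by rw [Fin.val_rev]; omega
  rw [h.conj_apply hq hN ha', ← h.apply_mul_apply_self hq hN ha, mul_assoc,
    h.apply_mul_apply_rev hq hN ha, mul_one]

theorem apply_ne_zero {a : Fin N} (ha : (a : ℕ) = 0 ∨ (a : ℕ) + 1 = N) : D a a ≠ 0 :=
  left_ne_zero_of_mul_eq_one (h.apply_mul_apply_rev hq hN ha)

end Diagonal

end IsOrthogonalRoot

/-! ### The conjugations × and ⋆ and their composites with ♯ -/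

theorem exists_cross (hs : starRingEnd ℂ (s : ℂ) = (s : ℂ)⁻¹)
    (hq' : (s : ℂ) ^ 2 + ((s : ℂ) ^ 2)⁻¹ ≠ 0)
    (hZ : ∑ e, ∑ f, metric N s e f * metric N s e f ≠ 0) (hN : 0 < N) :
    ∃ f : SOq N s →ₛₗ[starRingEnd ℂ] SOq N s, IsAntiHom f ∧ (genT N s).map f = genT N s := by
  have hm : ((metric N s).map (starRingEnd ℂ)).transpose = metric N s :=
    Matrix.ext fun a b => conj_metric_of_unitary hs b a
  obtain ⟨f, hf, hT⟩ := exists_isAntiHom (N := N) (V := 1) (V' := 1) hq' (mul_one 1)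
    (by rw [flipConj_projA_of_unitary hs hN hZ, tensorSq_one, one_mul, mul_one])
    (by rw [hm, Matrix.transpose_one, one_mul, mul_one])
    (by rw [hm, Matrix.transpose_one, one_mul, mul_one])
  rw [map_conj_one, sandwich_one] at hT
  exact ⟨f, hf, hT⟩

theorem exists_star (hqr : starRingEnd ℂ ((s : ℂ) ^ 2) = (s : ℂ) ^ 2)
    (hm : ∀ a b : Fin N, starRingEnd ℂ (metric N s a b) = metric N s a b)
    (hq' : (s : ℂ) ^ 2 + ((s : ℂ) ^ 2)⁻¹ ≠ 0) :
    ∃ f : SOq N s →ₛₗ[starRingEnd ℂ] SOq N s, IsAntiHom f ∧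
      (genT N s).map f = scalarMat (SOq N s) (metric N s).transpose * genT N s *
        scalarMat (SOq N s) (metric N s).transpose := by
  have hm' : (metric N s).map (starRingEnd ℂ) = metric N s := Matrix.ext hm
  have hK := metric_transpose_mul_metric_transpose N s
  obtain ⟨f, hf, hT⟩ := exists_isAntiHom (N := N) (V := (metric N s).transpose)
    (V' := (metric N s).transpose) hq' hK
    (projA_mul_tensorSq_metric_of_real hqr hm)
    (by rw [hm', hK, one_mul, Matrix.transpose_transpose])
    (by rw [hm', Matrix.transpose_transpose, metric_mul_metric, one_mul])
  rw [Matrix.transpose_map, hm'] at hT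
  exact ⟨f, hf, hT⟩

section Conjugations

variable {D : Matrix (Fin N) (Fin N) ℂ} {x : ℂ} (h : IsOrthogonalRoot s D x)
  {g : SOq N s ≃ₐc[ℂ] SOq N s}
  (hg : (genT N s).map g = scalarMat (SOq N s) D * genT N s * scalarMat (SOq N s) D⁻¹)
  (hq : ((s : ℂ) ^ 2) ^ 2 ≠ 1) (hq' : (s : ℂ) ^ 2 + ((s : ℂ) ^ 2)⁻¹ ≠ 0)
  (hZ : ∑ e, ∑ f, metric N s e f * metric N s e f ≠ 0) (hN : 2 < N)

include h hg

section

include hq hq' hZ hN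

theorem IsOrthogonalRoot.comm_cross_iff {f : SOq N s →ₛₗ[starRingEnd ℂ] SOq N s}
    (hf : IsAntiHom f) (hT : (genT N s).map f = genT N s) :
    (∀ y, g (f y) = f (g y)) ↔ D.map (starRingEnd ℂ) = x • D := by
  have h1 := comm_iff (g := (g : SOq N s →ₐ[ℂ] SOq N s)) hq hq' hZ hg hf
    (hT.trans (sandwich_one _).symm) h.mul_inv (mul_one 1) h.sign_ne_zero
    (fun a ha => ⟨h.apply_ne_zero hq hN ha, by
      rw [one_mul, mul_one, Matrix.map_apply, h.conj_apply hq hN ha]⟩)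
  rw [one_mul, mul_one] at h1
  exact h1

theorem IsOrthogonalRoot.comm_star_iff {f : SOq N s →ₛₗ[starRingEnd ℂ] SOq N s}
    (hf : IsAntiHom f)
    (hT : (genT N s).map f = scalarMat (SOq N s) (metric N s).transpose * genT N s *
        scalarMat (SOq N s) (metric N s).transpose) :
    (∀ y, g (f y) = f (g y)) ↔
      D.map (starRingEnd ℂ) = (metric N s).transpose * D * (metric N s).transpose := by
  have hK := metric_transpose_mul_metric_transpose N s
  have h1 := comm_iff (g := (g : SOq N s →ₐ[ℂ] SOq N s)) hq hq' hZ hg hf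
    hT h.mul_inv hK one_ne_zero
    (fun a ha => ⟨h.apply_ne_zero hq hN ha, by
      rw [metric_transpose_sandwich_apply_self, Matrix.map_apply, h.conj_apply_rev hq hN ha,
        one_mul]⟩)
  rw [one_smul] at h1
  have hinv : ∀ M : Matrix (Fin N) (Fin N) ℂ, (metric N s).transpose *
      ((metric N s).transpose * M * (metric N s).transpose) * (metric N s).transpose = M := by
    intro M
    simp only [← mul_assoc]
    rw [hK, one_mul, mul_assoc, hK, mul_one]
  exact h1.trans ⟨fun e => by rw [← hinv (D.map _), e], fun e => by rw [e, hinv]⟩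

end

theorem IsOrthogonalRoot.exists_plane_cross
    {f : SOq N s →ₛₗ[starRingEnd ℂ] SOq N s} (hf : IsAntiHom f)
    (hT : (genT N s).map f = genT N s) (hP : flipConj (projA N s) = projA N s)
    (hbar : D.map (starRingEnd ℂ) = D) (hD : D * D = 1) :
    ∃ k : QPlane N s →ₛₗ[starRingEnd ℂ] QPlane N s, IsAlgConjugation k ∧
      (∀ a, k (coord N s a) = ∑ b, D a b • coord N s b) ∧
      CoactionCompatible ((g : SOq N s →ₗ[ℂ] SOq N s) ∘ₛₗ f) k := by
  have hT' : (genT N s).map ((g : SOq N s →ₗ[ℂ] SOq N s) ∘ₛₗ f) =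
      scalarMat (SOq N s) D * genT N s * scalarMat (SOq N s) D⁻¹ := by
    have h1 : (genT N s).map ((g : SOq N s →ₗ[ℂ] SOq N s) ∘ₛₗ f) =
        ((genT N s).map f).map g := rfl
    rw [h1, hT, hg]
  exact exists_plane_conjugation (hf.algHom_comp (g : SOq N s →ₐ[ℂ] SOq N s)) hT' h.inv_mul
    (by rw [hbar, hD]) (by rw [hP, h.projA_comm])

theorem IsOrthogonalRoot.exists_plane_star
    {f : SOq N s →ₛₗ[starRingEnd ℂ] SOq N s} (hf : IsAntiHom f)
    (hT : (genT N s).map f = scalarMat (SOq N s) (metric N s).transpose * genT N s *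
        scalarMat (SOq N s) (metric N s).transpose)
    (hqr : starRingEnd ℂ ((s : ℂ) ^ 2) = (s : ℂ) ^ 2)
    (hm : ∀ a b : Fin N, starRingEnd ℂ (metric N s a b) = metric N s a b)
    (hbar : D.map (starRingEnd ℂ) = (metric N s).transpose * D * (metric N s).transpose)
    (hD : D * D = 1) :
    ∃ k : QPlane N s →ₛₗ[starRingEnd ℂ] QPlane N s, IsAlgConjugation k ∧
      (∀ a, k (coord N s a) = ∑ b, ((metric N s).transpose * D) a b • coord N s b) ∧
      CoactionCompatible ((g : SOq N s →ₗ[ℂ] SOq N s) ∘ₛₗ f) k := by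
  have hK := metric_transpose_mul_metric_transpose N s
  have hT' : (genT N s).map ((g : SOq N s →ₗ[ℂ] SOq N s) ∘ₛₗ f) =
      scalarMat (SOq N s) ((metric N s).transpose * D) * genT N s *
        scalarMat (SOq N s) (D⁻¹ * (metric N s).transpose) := by
    have h1 : (genT N s).map ((g : SOq N s →ₗ[ℂ] SOq N s) ∘ₛₗ f) =
        ((genT N s).map f).map (g : SOq N s →ₗ[ℂ] SOq N s) := rfl
    have hg' : (genT N s).map (g : SOq N s →ₗ[ℂ] SOq N s) = _ := hg
    rw [h1, hT, map_sandwich, hg', sandwich_sandwich]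
  refine exists_plane_conjugation (hf.algHom_comp (g : SOq N s →ₐ[ℂ] SOq N s)) hT' ?_ ?_ ?_
  · rw [mul_assoc, ← mul_assoc (metric N s).transpose, hK, one_mul, h.inv_mul]
  · have hm' : (metric N s).map (starRingEnd ℂ) = metric N s := Matrix.ext hm
    rw [Matrix.map_mul, Matrix.transpose_map, hm', hbar]
    simp only [← mul_assoc]
    rw [hK, one_mul, mul_assoc D, hK, mul_one, hD]
  · rw [tensorSq_mul fun _ _ _ _ => Commute.all _ _, ← mul_assoc,
      comm_inv hK (projA_mul_tensorSq_metric_of_real hqr hm), mul_assoc, h.projA_comm, mul_assoc]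

end Conjugations

/-- The sign in D̄ = x D is the same as in D² = x, and 1 ≠ -1 rules out the mixed cases. -/
theorem IsOrthogonalRoot.conj_eq_smul_iff {D : Matrix (Fin N) (Fin N) ℂ} {x : ℂ}
    (h : IsOrthogonalRoot s D x) (hN : 0 < N) :
    D.map (starRingEnd ℂ) = x • D ↔ (D.map (starRingEnd ℂ) = D ∧ D * D = 1) ∨
      (D.map (starRingEnd ℂ) = -D ∧ D * D = -1) := by
  have hne := one_ne_neg_one hN
  have hsq := h.sq
  rcases h.sign with rfl | rfl
  · rw [one_smul] at hsq ⊢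
    exact ⟨fun e => .inl ⟨e, hsq⟩,
      fun e => e.elim And.left fun e => absurd (hsq.symm.trans e.2) hne⟩
  · rw [neg_one_smul] at hsq ⊢
    exact ⟨fun e => .inr ⟨e, hsq⟩,
      fun e => e.elim (fun e => absurd (e.2.symm.trans hsq) hne) And.left⟩

end QOrthogonal

end

theorem theorem1 (N : ℕ) (hN : 2 < N) (q s : ℂˣ) (hs : s ^ 2 = q)
    (hq : (q : ℂ) ^ 2 ≠ 1) (hq' : (q : ℂ) + (q : ℂ)⁻¹ ≠ 0)
    (hZ : ∑ e, ∑ f, QOrthogonal.metric N s e f * QOrthogonal.metric N s e f ≠ 0)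
    (D : Matrix (Fin N) (Fin N) ℂ)
    (hR : QOrthogonal.rMatrix N s * QOrthogonal.tensorSq D =
      QOrthogonal.tensorSqOp D * QOrthogonal.rMatrix N s)
    (hC : D.transpose * QOrthogonal.metric N s * D = QOrthogonal.metric N s)
    (hD : D * D = 1 ∨ D * D = -1) :
    -- the map `T ↦ D T D⁻¹` defines an involutive Hopf algebra automorphism
    ∃ sharp : QOrthogonal.SOq N s ≃ₐc[ℂ] QOrthogonal.SOq N s,
      (∀ a b, sharp (QOrthogonal.genT N s a b) =
        ∑ e, ∑ f, (D a e * D⁻¹ f b) • QOrthogonal.genT N s e f) ∧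
      Function.Involutive sharp ∧
      (∀ x, HopfAlgebra.antipode ℂ (sharp x) = sharp (HopfAlgebra.antipode ℂ x)) ∧
      -- the conjugation with `T ↦ T`, for `|q| = 1`
      (‖(q : ℂ)‖ = 1 →
        ∃ cross : QOrthogonal.SOq N s →ₛₗ[starRingEnd ℂ] QOrthogonal.SOq N s,
          QOrthogonal.IsHopfConjugation cross ∧
          (∀ a b, cross (QOrthogonal.genT N s a b) = QOrthogonal.genT N s a b) ∧
          (QOrthogonal.IsHopfConjugation
              ((sharp : QOrthogonal.SOq N s →ₗ[ℂ] QOrthogonal.SOq N s) ∘ₛₗ cross) ↔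
            ∀ x, sharp (cross x) = cross (sharp x)) ∧
          ((∀ x, sharp (cross x) = cross (sharp x)) ↔
            (D.map (starRingEnd ℂ) = D ∧ D * D = 1) ∨
              (D.map (starRingEnd ℂ) = -D ∧ D * D = -1)) ∧
          (D * D = 1 → (∀ x, sharp (cross x) = cross (sharp x)) →
            ∃ g : QOrthogonal.QPlane N s →ₛₗ[starRingEnd ℂ] QOrthogonal.QPlane N s,
              QOrthogonal.IsAlgConjugation g ∧
              (∀ a, g (QOrthogonal.coord N s a) = ∑ b, D a b • QOrthogonal.coord N s b) ∧
              QOrthogonal.CoactionCompatible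
                ((sharp : QOrthogonal.SOq N s →ₗ[ℂ] QOrthogonal.SOq N s) ∘ₛₗ cross) g)) ∧
      -- the conjugation with `T ↦ Cᵗ T Cᵗ`, for real `q` (and real `q ^ (1/2)` if `N` is odd)
      (starRingEnd ℂ (q : ℂ) = q → (Odd N → starRingEnd ℂ (s : ℂ) = s) →
        ∃ star : QOrthogonal.SOq N s →ₛₗ[starRingEnd ℂ] QOrthogonal.SOq N s,
          QOrthogonal.IsHopfConjugation star ∧
          (∀ a b, star (QOrthogonal.genT N s a b) =
            ∑ e, ∑ f, ((QOrthogonal.metric N s).transpose a e *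
              (QOrthogonal.metric N s).transpose f b) • QOrthogonal.genT N s e f) ∧
          (QOrthogonal.IsHopfConjugation
              ((sharp : QOrthogonal.SOq N s →ₗ[ℂ] QOrthogonal.SOq N s) ∘ₛₗ star) ↔
            ∀ x, sharp (star x) = star (sharp x)) ∧
          ((∀ x, sharp (star x) = star (sharp x)) ↔
            D.map (starRingEnd ℂ) =
              (QOrthogonal.metric N s).transpose * D * (QOrthogonal.metric N s).transpose) ∧
          (D * D = 1 → (∀ x, sharp (star x) = star (sharp x)) →
            ∃ g : QOrthogonal.QPlane N s →ₛₗ[starRingEnd ℂ] QOrthogonal.QPlane N s,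
              QOrthogonal.IsAlgConjugation g ∧
              (∀ a, g (QOrthogonal.coord N s a) =
                ∑ b, ((QOrthogonal.metric N s).transpose * D) a b • QOrthogonal.coord N s b) ∧
              QOrthogonal.CoactionCompatible
                ((sharp : QOrthogonal.SOq N s →ₗ[ℂ] QOrthogonal.SOq N s) ∘ₛₗ star) g)) := by
  subst hs
  have hqs : ((s ^ 2 : ℂˣ) : ℂ) = (s : ℂ) ^ 2 := Units.val_pow_eq_pow_val s 2
  rw [hqs] at hq hq'
  rw [hqs]
  obtain ⟨x, h⟩ : ∃ x, QOrthogonal.IsOrthogonalRoot s D x := by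
    have hRD : QOrthogonal.rHat N s * QOrthogonal.tensorSq D =
        QOrthogonal.tensorSq D * QOrthogonal.rHat N s := by
      have h1 := QOrthogonal.rtt_iff_rHat_comm (B := ℂ) (s := s) (M := D)
      simp only [QOrthogonal.scalarMat_self] at h1
      exact h1.1 hR
    rcases hD with hD | hD
    · exact ⟨1, hRD, hC, by rw [hD, one_smul], .inl rfl⟩
    · exact ⟨-1, hRD, hC, by rw [hD, neg_one_smul], .inr rfl⟩
  obtain ⟨sharp, hg, hinv, hanti⟩ := h.exists_sharp hq'
  have hN0 : 0 < N := by omega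
  refine ⟨sharp, fun a b => ?_, hinv, hanti, fun hn => ?_, fun hqr hsr => ?_⟩
  · rw [← QOrthogonal.sandwich_apply]
    exact congrFun (congrFun hg a) b
  -- From |q| = 1 and q = s² the square root s has modulus one as well, so its conjugate is its
  -- inverse.
  · have hs : starRingEnd ℂ (s : ℂ) = (s : ℂ)⁻¹ := by
      rw [norm_pow] at hn
      exact (Complex.inv_eq_conj ((pow_eq_one_iff_of_nonneg (norm_nonneg _) two_ne_zero).1 hn)).symm
    obtain ⟨cross, hf, hT⟩ := QOrthogonal.exists_cross hs hq' hZ hN0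
    have hconj : QOrthogonal.IsHopfConjugation cross :=
      hf.isHopfConjugation (hT.trans (QOrthogonal.sandwich_one _).symm) (mul_one 1)
        (by rw [QOrthogonal.map_conj_one, mul_one])
    have hiff := (h.comm_cross_iff hg hq hq' hZ hN hf hT).trans (h.conj_eq_smul_iff hN0)
    refine ⟨cross, hconj, fun a b => congrFun (congrFun hT a) b,
      QOrthogonal.isHopfConjugation_comp_iff hconj sharp hinv, hiff, fun hD1 hcomm => ?_⟩
    have hbar : D.map (starRingEnd ℂ) = D := by
      rcases hiff.1 hcomm with h1 | h1
      · exact h1.1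
      · exact absurd (hD1.symm.trans h1.2) (QOrthogonal.one_ne_neg_one hN0)
    exact h.exists_plane_cross hg hf hT (QOrthogonal.flipConj_projA_of_unitary hs hN0 hZ) hbar hD1
  · have hm := QOrthogonal.conj_metric_of_real hqr hsr
    have hm' : (QOrthogonal.metric N s).map (starRingEnd ℂ) = QOrthogonal.metric N s :=
      Matrix.ext hm
    obtain ⟨star, hf, hT⟩ := QOrthogonal.exists_star (N := N) hqr hm hq'
    have hK := QOrthogonal.metric_transpose_mul_metric_transpose N s
    have hconj : QOrthogonal.IsHopfConjugation star :=
      hf.isHopfConjugation hT hK (by rw [Matrix.transpose_map, hm', hK])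
    have hiff := h.comm_star_iff hg hq hq' hZ hN hf hT
    refine ⟨star, hconj, fun a b => ?_,
      QOrthogonal.isHopfConjugation_comp_iff hconj sharp hinv, hiff, fun hD1 hcomm => ?_⟩
    · rw [← QOrthogonal.sandwich_apply]
      exact congrFun (congrFun hT a) b
    · exact h.exists_plane_star hg hf hT hqr hm (hiff.1 hcomm) hD1
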